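/- Let $(M^n,g)$ be a Hermitian manifold of complex dimension $n\ge 1$ (a complex manifold with a smooth Hermitian metric $g$, complex structure $J$ and Kähler form $\omega(X,Y)=g(JX,Y)$) that is Bismut flat: the Bismut connection, i.e. the unique connection $\nabla^b$ with $\nabla^bg=0$, $\nabla^bJ=0$ and totally skew-symmetric torsion, has zero curvature. Let $T^c$ be the torsion tensor of the Chern connection, i.e. of the unique connection with $\nabla^cg=0$, $\nabla^cJ=0$ whose torsion has no $(1,1)$-part. In a local unitary frame $e_1,\dots,e_n$ of type $(1,0)$ with dual coframe $\varphi_1,\dots,\varphi_n$ write $T^c(e_i,e_j)=2\sum_kT_{ij}^k e_k$, let $|T|^2=\sum_{i,j,k}|T_{ij}^k|^2$, so that the tensor norm of $T^c$ is given by $|T^c|^2=8|T|^2$, and let $\eta=\sum_{i,j}T_{ij}^i\varphi_j$ be the Gauduchon $1$-form, the trace of the torsion, with $|\eta|^2=\sum_j|\sum_iT^i_{ij}|^2$. Then: 1. If $(M,g)$ is balanced, i.e. $d(\omega^{n-1})=0$, then it is Kähler, i.e. $d\omega=0$. 2. If $M$ is compact, then $\displaystyle\int_M|T^c|^2\,\omega^n=16\int_M|\eta|^2\,\omega^n$.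 3. At every point of $M$, $\displaystyle-\sqrt{-1}\,\partial\bar\partial\omega^{n-1}=\frac{4}{3n}\left(|T|^2-2|\eta|^2\right)\omega^n$. -/

import Mathlib

open Bundle
open scoped Manifold ContDiff

noncomputable section

/-! ### The model space and complex manifolds -/

/-- The model space `ℂⁿ` with its Hermitian norm. A complex manifold of complex dimension `n` is
modelled on it over `𝓘(ℂ, Cn n)`; the underlying real manifold uses the same charts over
`𝓘(ℝ, Cn n)`. -/
abbrev Cn (n : ℕ) : Type := EuclideanSpace ℂ (Fin n)

/-- The real manifold underlying a complex manifold is real-analytic (hence smooth). -/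
instance instIsManifoldRealOfComplex (n : ℕ) (M : Type*) [TopologicalSpace M]
    [ChartedSpace (Cn n) M] [IsManifold 𝓘(ℂ, Cn n) ω M] : IsManifold 𝓘(ℝ, Cn n) ω M := by
  apply isManifold_of_contDiffOn
  intro e e' he he'
  have h := (contDiffGroupoid ω 𝓘(ℂ, Cn n)).compatible he he'
  rw [contDiffGroupoid, mem_groupoid_of_pregroupoid] at h
  have h1 := h.1
  simp only [contDiffPregroupoid] at h1
  exact h1.restrict_scalars ℝ

/-- The (real) tangent space of `M` at `x`. -/
abbrev TM (n : ℕ) {M : Type*} [TopologicalSpace M] [ChartedSpace (Cn n) M] (x : M) : Type :=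
  TangentSpace 𝓘(ℝ, Cn n) x

section Forms

variable (n : ℕ) {M : Type*} [TopologicalSpace M] [ChartedSpace (Cn n) M]

/-- The complex structure `J` of a complex manifold: multiplication by `i` in holomorphic
charts. -/
def complexStructure (x : M) : TM n x →L[ℝ] TM n x :=
  (Complex.I • ContinuousLinearMap.id ℝ (Cn n) : Cn n →L[ℝ] Cn n)

/-! ### Differential forms on `M` -/

/-- A (not necessarily continuous) `F`-valued differential `k`-form on `M`. -/
abbrev MForm (M : Type*) [TopologicalSpace M] [ChartedSpace (Cn n) M]
    (F : Type*) [NormedAddCommGroup F] [NormedSpace ℝ F] (k : ℕ) : Type _ :=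
  ∀ x : M, TM n x [⋀^Fin k]→L[ℝ] F

variable {n} {F : Type*} [NormedAddCommGroup F] [NormedSpace ℝ F] {k : ℕ}

/-- The expression of a form in the chart around `x₀`, i.e. its pull-back under the inverse of
that chart. -/
def MForm.inChart (α : MForm n M F k) (x₀ : M) (y : Cn n) : Cn n [⋀^Fin k]→L[ℝ] F :=
  (α ((extChartAt 𝓘(ℝ, Cn n) x₀).symm y)).compContinuousLinearMap
    (mfderiv 𝓘(ℝ, Cn n) 𝓘(ℝ, Cn n) (extChartAt 𝓘(ℝ, Cn n) x₀).symm y)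

/-- The exterior derivative `dα` of a differential form `α` on `M`: at `x`, it is computed in the
chart around `x` and pulled back to `M`. -/
def MForm.extDeriv (α : MForm n M F k) : MForm n M F (k + 1) := fun x =>
  (_root_.extDeriv (α.inChart x) (extChartAt 𝓘(ℝ, Cn n) x x)).compContinuousLinearMap
    (mfderiv 𝓘(ℝ, Cn n) 𝓘(ℝ, Cn n) (extChartAt 𝓘(ℝ, Cn n) x) x)

/-- A real form regarded as a complex-valued form. -/
def MForm.toComplex (α : MForm n M ℝ k) : MForm n M ℂ k := fun x =>
  Complex.ofRealCLM.compContinuousAlternatingMap (α x)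

/-- A complex-valued `k`-form is of type `(p,q)`, where `p + q = k`, if
`α(e^{it} v₁, …, e^{it} v_k) = e^{i(p-q)t} α(v₁, …, v_k)` for all real `t` and all real tangent
vectors, where `e^{it} v = cos t v + sin t J v`. -/
def MForm.HasType (p q : ℕ) (α : MForm n M ℂ k) : Prop :=
  p + q = k ∧ ∀ (x : M) (t : ℝ) (v : Fin k → TM n x),
    α x (fun i => Real.cos t • v i + Real.sin t • complexStructure n x (v i)) =
      Complex.exp (Complex.I * ((p : ℂ) - (q : ℂ)) * (t : ℂ)) * α x v

/-- For `α` of type `(p,q)`: `β = ∂α`, the `(p+1,q)`-part of `dα = ∂α + ∂̄α`. -/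
def MForm.IsDel (p q : ℕ) (α : MForm n M ℂ k) (β : MForm n M ℂ (k + 1)) : Prop :=
  α.HasType p q ∧ β.HasType (p + 1) q ∧
    MForm.HasType p (q + 1) (fun x => α.extDeriv x - β x : MForm n M ℂ (k + 1))

/-- For `α` of type `(p,q)`: `β = ∂̄α`, the `(p,q+1)`-part of `dα = ∂α + ∂̄α`. -/
def MForm.IsDelbar (p q : ℕ) (α : MForm n M ℂ k) (β : MForm n M ℂ (k + 1)) : Prop :=
  α.HasType p q ∧ β.HasType p (q + 1) ∧
    MForm.HasType (p + 1) q (fun x => α.extDeriv x - β x : MForm n M ℂ (k + 1))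

/-- The positively oriented standard real basis `e₁, i e₁, e₂, i e₂, …, e_n, i e_n` of `ℂⁿ`. -/
def orientedBasis (n : ℕ) (a : Fin (2 * n)) : Cn n :=
  EuclideanSpace.single ⟨a / 2, by omega⟩ (if a.val % 2 = 0 then 1 else Complex.I)

/-- The integral `∫_M α` of a form of top degree over a compact complex manifold (with its complex
orientation): `∑ᵢ ∫ ρᵢ α`, each summand being computed in a chart, for a smooth partition of unity
`ρ` subordinate to the charts. -/
def MForm.integral [T2Space M] [SigmaCompactSpace M] [IsManifold 𝓘(ℝ, Cn n) ∞ M]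
    (α : MForm n M ℝ (2 * n)) : ℝ :=
  let ρ := Classical.choose
    (SmoothPartitionOfUnity.exists_isSubordinate_chartAt_source 𝓘(ℝ, Cn n) M)
  ∑ᶠ c : M, ∫ y in (extChartAt 𝓘(ℝ, Cn n) c).target,
    ρ c ((extChartAt 𝓘(ℝ, Cn n) c).symm y) * α.inChart c y (orientedBasis n)

end Forms

/-! ### Exterior powers of a 2-form -/

section Powers

variable {V : Type*} [NormedAddCommGroup V] [NormedSpace ℝ V]

/-- The multilinear map `(v₀, …, v_{2k-1}) ↦ B(v₀,v₁) B(v₂,v₃) ⋯ B(v_{2k-2},v_{2k-1})`. -/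
def pairProd (B : V →L[ℝ] V →L[ℝ] ℝ) :
    (k : ℕ) → ContinuousMultilinearMap ℝ (fun _ : Fin (2 * k) => V) ℝ
  | 0 => haveI : IsEmpty (Fin (2 * 0)) := Fin.isEmpty
    ContinuousMultilinearMap.constOfIsEmpty ℝ _ 1
  | k + 1 => ContinuousLinearMap.uncurryLeft (Ei := fun _ : Fin (2 * k + 1 + 1) => V)
      ((continuousMultilinearCurryLeftEquiv ℝ (fun _ : Fin (2 * k + 1) => V)
          ℝ).symm.toContinuousLinearEquiv.toContinuousLinearMap ∘L
        ((ContinuousLinearMap.smulRightL ℝ V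
          (ContinuousMultilinearMap ℝ (fun _ : Fin (2 * k) => V) ℝ)).flip (pairProd B k)) ∘L B)

theorem pairProd_apply (B : V →L[ℝ] V →L[ℝ] ℝ) (k : ℕ) (v : Fin (2 * k) → V) :
    pairProd B k v =
      ∏ i : Fin k, B (v ⟨2 * i.val, by omega⟩) (v ⟨2 * i.val + 1, by omega⟩) := by
  induction k with
  | zero => simp [pairProd]
  | succ k ih =>
    rw [Fin.prod_univ_succ]
    change B (v 0) (v 1) * pairProd B k (fun i => v i.succ.succ) = _
    rw [ih]
    rfl

/-- The `k`-th exterior power `B ∧ ⋯ ∧ B` of an alternating bilinear form `B`, with the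
convention `(α ∧ β)(v,w) = α(v)β(w) - α(w)β(v)` for 1-forms: its value on `v` is
`2^{-k} ∑_σ sign(σ) B(v_{σ(0)},v_{σ(1)}) ⋯ B(v_{σ(2k-2)},v_{σ(2k-1)})`. -/
def wedgePow (B : V →L[ℝ] V →L[ℝ] ℝ) (k : ℕ) : V [⋀^Fin (2 * k)]→L[ℝ] ℝ :=
  ((1 : ℝ) / 2 ^ k) • (pairProd B k).alternatization

theorem wedgePow_apply (B : V →L[ℝ] V →L[ℝ] ℝ) (k : ℕ) (v : Fin (2 * k) → V) :
    wedgePow B k v = (1 / 2 ^ k) * ∑ σ : Equiv.Perm (Fin (2 * k)), (Equiv.Perm.sign σ : ℤ) *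
      ∏ i : Fin k, B (v (σ ⟨2 * i.val, by omega⟩)) (v (σ ⟨2 * i.val + 1, by omega⟩)) := by
  simp only [wedgePow, ContinuousAlternatingMap.smul_apply,
    ContinuousMultilinearMap.alternatization_apply_apply, smul_eq_mul]
  congr 1
  refine Finset.sum_congr rfl fun σ _ => ?_
  rw [pairProd_apply, Units.smul_def, zsmul_eq_mul]
  rfl

theorem wedgePow_one (B : V →L[ℝ] V →L[ℝ] ℝ) (hB : ∀ v w, B v w = -B w v) (v : Fin 2 → V) :
    wedgePow B 1 v = B (v 0) (v 1) := by
  have h := wedgePow_apply B 1 v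
  rw [h]
  have : (Finset.univ : Finset (Equiv.Perm (Fin (2 * 1)))) = {1, Equiv.swap 0 1} := by decide
  rw [this, Finset.sum_pair (by decide)]
  have h2 := hB (v 1) (v 0)
  simp at h2 ⊢
  change 2⁻¹ * (B (v 0) (v 1) + -(B (v (Equiv.swap (0 : Fin 2) 1 0)) (v (Equiv.swap (0 : Fin 2) 1 1)))) = _
  rw [Equiv.swap_apply_left, Equiv.swap_apply_right, h2]
  ring

end Powers

/-! ### Hermitian metrics -/

section Hermitian

variable (n : ℕ) (M : Type*) [TopologicalSpace M] [ChartedSpace (Cn n) M]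
  [IsManifold 𝓘(ℂ, Cn n) ω M]

/-- A Hermitian metric on a complex manifold: a smooth Riemannian metric `g` (written `g.inner x v w`)
with `g(Jv, Jw) = g(v, w)`. -/
structure HermitianMetric extends
    ContMDiffRiemannianMetric 𝓘(ℝ, Cn n) ∞ (Cn n) (fun x : M => TangentSpace 𝓘(ℝ, Cn n) x) where
  hermitian : ∀ (x : M) (v w : TM n x),
    inner x (complexStructure n x v) (complexStructure n x w) = inner x v w

variable {n M} (g : HermitianMetric n M)

namespace HermitianMetric

/-- The Kähler form as a family of bilinear forms, `ω(v, w) = g(Jv, w)`. -/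
def kahlerBilin (x : M) : TM n x →L[ℝ] TM n x →L[ℝ] ℝ :=
  g.inner x ∘L complexStructure n x

theorem kahlerBilin_apply (x : M) (v w : TM n x) :
    g.kahlerBilin x v w = g.inner x (complexStructure n x v) w := rfl

/-- The differential form `ω^k = ω ∧ ⋯ ∧ ω` of degree `2k`. -/
def kahlerPow (k : ℕ) : MForm n M ℝ (2 * k) := fun x =>
  wedgePow (V := Cn n) (g.kahlerBilin x) k

/-- The metric is Kähler: `dω = 0`. -/
def IsKahler : Prop := (g.kahlerPow 1).extDeriv = 0

/-- The metric is balanced: `d(ω^{n-1}) = 0`. -/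
def IsBalanced : Prop := (g.kahlerPow (n - 1)).extDeriv = 0

/-- The Gram matrix `G_{ab} = g(b_a, b_b)` of `g` at `x`, for the standard real basis `b` of the
tangent space. -/
def gram (x : M) : Matrix (Fin (2 * n)) (Fin (2 * n)) ℝ :=
  Matrix.of fun a b => g.inner x (orientedBasis n a) (orientedBasis n b)

end HermitianMetric

end Hermitian

/-! ### Connections -/

section Connections

variable {n : ℕ} {M : Type*} [TopologicalSpace M] [ChartedSpace (Cn n) M]
  [IsManifold 𝓘(ℂ, Cn n) ω M]

variable (n M) in
/-- Vector fields on `M`, with no regularity. -/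
abbrev VField : Type _ := ∀ x : M, TangentSpace 𝓘(ℝ, Cn n) x

/-- The vector field is differentiable at `x`. -/
def VField.DiffAt (Y : VField n M) (x : M) : Prop :=
  MDifferentiableAt 𝓘(ℝ, Cn n) (𝓘(ℝ, Cn n).prod 𝓘(ℝ, Cn n))
    (fun y => (⟨y, Y y⟩ : TangentBundle 𝓘(ℝ, Cn n) M)) x

/-- The vector field is smooth. -/
def VField.Smooth (Y : VField n M) : Prop :=
  ContMDiff 𝓘(ℝ, Cn n) (𝓘(ℝ, Cn n).prod 𝓘(ℝ, Cn n)) ∞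
    (fun y => (⟨y, Y y⟩ : TangentBundle 𝓘(ℝ, Cn n) M))

variable (n M) in
/-- Affine connections on `M`. (The value `D Y x v` is `(∇_v Y)(x)`.) -/
abbrev AffineConnection : Type _ :=
  CovariantDerivative 𝓘(ℝ, Cn n) (Cn n) (TangentSpace 𝓘(ℝ, Cn n) : M → Type _)

/-- `∇g = 0`, i.e. `v(g(Y, Z)) = g(∇_v Y, Z) + g(Y, ∇_v Z)`. -/
def PreservesMetric (g : HermitianMetric n M) (D : AffineConnection n M) : Prop :=
  ∀ (Y Z : VField n M) (x : M), Y.DiffAt x → Z.DiffAt x → ∀ v : TM n x,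
    mfderiv 𝓘(ℝ, Cn n) 𝓘(ℝ, ℝ) (fun y => g.inner y (Y y) (Z y)) x v =
      g.inner x (D Y x v) (Z x) + g.inner x (Y x) (D Z x v)

/-- `∇J = 0`, i.e. `∇_v (JY) = J ∇_v Y`. -/
def PreservesComplexStructure (D : AffineConnection n M) : Prop :=
  ∀ (Y : VField n M) (x : M), Y.DiffAt x → ∀ v : TM n x,
    D (fun y => complexStructure n y (Y y)) x v = complexStructure n x (D Y x v)

/-- The curvature `R(X,Y)Z = ∇_X ∇_Y Z - ∇_Y ∇_X Z - ∇_{[X,Y]} Z`. -/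
def curvature (D : AffineConnection n M) (X Y Z : VField n M) (x : M) : TM n x :=
  D (fun y => D Z y (Y y)) x (X x) - D (fun y => D Z y (X y)) x (Y x) -
    D Z x (VectorField.mlieBracket 𝓘(ℝ, Cn n) X Y x)

/-- The connection is flat: `R(X,Y)Z = 0` for all smooth vector fields. -/
def IsFlatConnection (D : AffineConnection n M) : Prop :=
  ∀ X Y Z : VField n M, X.Smooth → Y.Smooth → Z.Smooth → ∀ x : M, curvature D X Y Z x = 0

/-- The Chern connection `∇ᶜ`: the unique connection with `∇g = 0`, `∇J = 0` whose torsion has no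
`(1,1)`-part, i.e. `T(e, ē') = 0` for all `e, e'` of type `(1,0)`, which for the real torsion tensor
says `T(Jv, Jw) = -T(v, w)`. -/
structure IsChernConnection (g : HermitianMetric n M) (D : AffineConnection n M) : Prop where
  metric : PreservesMetric g D
  complex : PreservesComplexStructure D
  torsion : ∀ (x : M) (v w : TM n x),
    D.torsion x (complexStructure n x v) (complexStructure n x w) = -D.torsion x v w

/-- The Bismut connection `∇ᵇ`: the unique connection with `∇g = 0`, `∇J = 0` whose torsion
is totally skew-symmetric, `g(T(u, v), w) = -g(T(u, w), v)`. -/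
structure IsBismutConnection (g : HermitianMetric n M) (D : AffineConnection n M) : Prop where
  metric : PreservesMetric g D
  complex : PreservesComplexStructure D
  torsion : ∀ (x : M) (u v w : TM n x),
    g.inner x (D.torsion x u v) w = -g.inner x (D.torsion x u w) v

/-- `(M, g)` is Bismut flat: its Bismut connection is flat. -/
def IsBismutFlat (g : HermitianMetric n M) : Prop :=
  ∃ D : AffineConnection n M, IsBismutConnection g D ∧ IsFlatConnection D

/-! ### Torsion and the Gauduchon 1-form -/

/-- The squared norm `|T|²` of the torsion tensor `T` of `D` at `x`, as a tensor:
`∑ G^{ac} G^{bd} g(T(b_a, b_b), T(b_c, b_d))`, which is `∑_{a,b} g(T(E_a, E_b), T(E_a, E_b))` for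
every `g`-orthonormal real basis `E` of the tangent space. -/
def torsionNormSq (g : HermitianMetric n M) (D : AffineConnection n M) (x : M) : ℝ :=
  ∑ a, ∑ b, ∑ c, ∑ d, (g.gram x)⁻¹ a c * (g.gram x)⁻¹ b d *
    g.inner x (D.torsion x (orientedBasis n a) (orientedBasis n b))
      (D.torsion x (orientedBasis n c) (orientedBasis n d))

/-- The trace of the torsion, `v ↦ tr(u ↦ T(u, v))`. -/
def torsionTrace (D : AffineConnection n M) (x : M) (v : TM n x) : ℝ :=
  LinearMap.trace ℝ (TM n x)
    { toFun := fun u => D.torsion x u v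
      map_add' := fun u u' => by simp
      map_smul' := fun c u => by simp }

/-- The Gauduchon 1-form `η`, for the Chern connection `D`. In a unitary frame `e` of type `(1,0)`
with dual coframe `φ`, writing `T(e_i, e_j) = 2 ∑_k T_{ij}^k e_k`, it is the `(1,0)`-form
`η = ∑_{i,j} T_{ij}^i φ_j`. Since `T(ē_i, e_j) = 0`, `2 η` is the `(1,0)`-part of
`θ = tr(u ↦ T(u, ·))`, namely `2 η(v) = (θ(v) - i θ(Jv)) / 2` on real vectors `v`. -/
def gauduchonForm (D : AffineConnection n M) (x : M) (v : TM n x) : ℂ :=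
  (1 / 4 : ℂ) * ((torsionTrace D x v : ℂ) -
    Complex.I * (torsionTrace D x (complexStructure n x v) : ℂ))

/-- `|η|²(x) = ∑_j |η(e_j)|²` for a unitary frame `e` of type `(1,0)` at `x`. As `η` is of type
`(1,0)`, this is also `∑_a |η(E_a)|²` for a `g`-orthonormal real basis `E` of the tangent space, i.e.
`∑ G^{ab} Re(η(b_a) conj(η(b_b)))`. -/
def gauduchonNormSq (g : HermitianMetric n M) (D : AffineConnection n M) (x : M) : ℝ :=
  ∑ a, ∑ b, (g.gram x)⁻¹ a b *
    (gauduchonForm D x (orientedBasis n a) *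
      (starRingEnd ℂ) (gauduchonForm D x (orientedBasis n b))).re

end Connections

end

noncomputable section

set_option synthInstance.maxHeartbeats 200000

set_option maxSynthPendingDepth 3

/-! Write T for the torsion of the flat Bismut connection ∇. Two facts carry everything: ∇T = 0, and
|Tᶜ|² = 16|η|² at every point, not only after integration (`torsionNormSq_eq_gauduchonNormSq`). The
pointwise identity gives the integral formula at once and makes the right side of the third claim
vanish, so that what remains there is ∂∂̄ω^{n-1} = 0.

Parallelism (`covTors_eq_zero`) is proved in a chart. For a flat connection the first Bianchi
identity gives the cyclic sum of ∇T as minus that of T(T(·,·),·); since ∇_uT is again totally skew,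
∇T is itself the 4-form -1/3 cyc(T,T). As ∇J = 0 and J is integrable, each ∇_uT has no
(3,0)+(0,3)-part, which forces the 4-form to be of type (2,2). Contracting the quadratic formula
gives ⟨∇_uT, T⟩ = 0 and ⟨∇²_{u,v}T, T⟩ = -⟨∇_uT, ∇_vT⟩. The (2,2)-type rewrites the trace of ⟨∇²T,
T⟩ as a trace against J, where only the part antisymmetric in the two derivatives survives; by the
Ricci identity that part is a multiple of ⟨∇_{·}T, T⟩ = 0. Hence |∇T|² = 0
(`covariantDeriv_torsion_eq_zero`), and T satisfies the Jacobi identity.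

Let ξ = 1/2 ∑ T(e_k, Je_k) over an orthonormal basis. The Chern torsion is 1/2 (T(J·,J·) - T), and
its trace is v ↦ g(ξ, Jv), so that |η|² = |ξ|²/8. Integrability and the Jacobi identity applied to
e_i, Je_i, e_j, Je_j give |T|² = 6|ξ|² and |Tᶜ|² = 2|ξ|².

For forms, skew torsion gives dω^{n-1} = λ ∧ ω^{n-1} with λ = g(Jξ,·). If this vanishes, then ι_ξ
ω^n = 0, so ξ = 0, T = 0, and the parallel form ω is closed: balanced implies Kähler. In general,
with ρ = g(ξ,·), the form ∂̄ω^{n-1} is 1/2 (λ + iρ) ∧ ω^{n-1}. Both λ ∧ ω^{n-1} and ρ ∧ ω^{n-1} are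
parallel of degree 2n-1, and a parallel form of codegree one is closed when the torsion is totally
skew. -/

namespace BismutFlat

/-! ### Orthonormal bases of a real inner product -/

section Orthonormal

variable {V : Type*} [NormedAddCommGroup V] [NormedSpace ℝ V]
  {ι : Type*} [Fintype ι] [DecidableEq ι]

/-- The basis `b` is orthonormal for the bilinear form `g`. -/
def IsOrthonormal (g : V →L[ℝ] V →L[ℝ] ℝ) (b : Module.Basis ι ℝ V) : Prop :=
  ∀ i j, g (b i) (b j) = if i = j then 1 else 0

variable {g : V →L[ℝ] V →L[ℝ] ℝ} {b : Module.Basis ι ℝ V}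

theorem IsOrthonormal.repr_apply (hb : IsOrthonormal g b) (v : V) (i : ι) :
    b.repr v i = g v (b i) := by
  conv_rhs => rw [← b.sum_repr v]
  rw [map_sum, sum_apply, Finset.sum_eq_single i]
  · simp [hb i i]
  · intro j _ hj
    simp [hb j i, hj]
  · simp

theorem IsOrthonormal.sum_smul (hb : IsOrthonormal g b) (v : V) :
    ∑ i, g v (b i) • b i = v := by
  conv_rhs => rw [← b.sum_repr v]
  simp [hb.repr_apply]

theorem IsOrthonormal.apply_eq_sum (hb : IsOrthonormal g b) (v w : V) :
    g v w = ∑ i, g v (b i) * g w (b i) := by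
  conv_lhs => rw [← hb.sum_smul w]
  simp [mul_comm]

theorem exists_isOrthonormal [FiniteDimensional ℝ V] (hsymm : ∀ v w, g v w = g w v)
    (hpos : ∀ v, v ≠ 0 → 0 < g v v) :
    ∃ b : Module.Basis (Fin (Module.finrank ℝ V)) ℝ V, IsOrthonormal g b := by
  let core : InnerProductSpace.Core ℝ V :=
    { inner := fun v w => g v w
      conj_inner_symm := fun v w => by simp [hsymm v w]
      re_inner_nonneg := fun v => by
        by_cases h : v = 0
        · simp [h]
        · simpa using (hpos v h).le
      add_left := fun u v w => by simp
      smul_left := fun u v r => by simp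
      definite := fun v h => by
        by_contra hv
        exact (hpos v hv).ne' h }
  -- `V` already carries a norm unrelated to `g`. Quantifying over the algebraic structure keeps
  -- that norm out of sight while the one defined by `g` is installed.
  have key : ∀ (a : AddCommGroup V) (m : @Module ℝ V _ a.toAddCommMonoid)
      (_ : @FiniteDimensional ℝ V _ a m) (c : @InnerProductSpace.Core ℝ V _ a m),
      ∃ b : @Module.Basis (Fin (@Module.finrank ℝ V _ a.toAddCommMonoid m)) ℝ V _ a.toAddCommMonoid m,
        ∀ i j, c.inner (b i) (b j) = if i = j then 1 else 0 := by
    intro a m hfin c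
    let _ : NormedAddCommGroup V := c.toNormedAddCommGroup
    let _ : InnerProductSpace ℝ V := InnerProductSpace.ofCore c.toCore
    have : FiniteDimensional ℝ V := hfin
    refine ⟨(stdOrthonormalBasis ℝ V).toBasis, fun i j => ?_⟩
    rw [OrthonormalBasis.coe_toBasis]
    exact orthonormal_iff_ite.mp (stdOrthonormalBasis ℝ V).orthonormal i j
  exact key _ _ inferInstance core

/-- The `g`-trace of a bilinear form does not depend on the orthonormal basis: expand one basis in
the other and use Parseval. `F` is an unbundled function so that it can later be a sum of
contractions. -/
theorem IsOrthonormal.trace_eq {κ : Type*} [Fintype κ] [DecidableEq κ]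
    (hb : IsOrthonormal g b) {b' : Module.Basis κ ℝ V} (hb' : IsOrthonormal g b')
    (hsymm : ∀ v w, g v w = g w v) (F : V → V → ℝ)
    (h₁ : ∀ v, IsLinearMap ℝ fun u => F u v) (h₂ : ∀ u, IsLinearMap ℝ (F u)) :
    ∑ j, F (b' j) (b' j) = ∑ i, F (b i) (b i) := by
  have expand : ∀ j, F (b' j) (b' j) =
      ∑ i, ∑ k, (g (b i) (b' j) * g (b k) (b' j)) * F (b i) (b k) := by
    intro j
    conv_lhs => rw [← hb.sum_smul (b' j)]
    have e₁ : ∀ (f : V → ℝ), IsLinearMap ℝ f → ∀ c : ι → ℝ,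
        f (∑ i, c i • b i) = ∑ i, c i * f (b i) := by
      intro f hf c
      change hf.mk' f _ = _
      rw [map_sum]
      exact Finset.sum_congr rfl fun i _ => hf.map_smul _ _
    rw [e₁ (fun u => F u _) (h₁ _)]
    refine Finset.sum_congr rfl fun i _ => ?_
    rw [e₁ _ (h₂ _), Finset.mul_sum]
    refine Finset.sum_congr rfl fun k _ => ?_
    rw [hsymm (b' j), hsymm (b' j), mul_assoc]
  simp_rw [expand]
  rw [Finset.sum_comm]
  refine Finset.sum_congr rfl fun i _ => ?_
  rw [Finset.sum_comm]
  simp_rw [← Finset.sum_mul, ← hb'.apply_eq_sum, hb i]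
  simp

variable {J : V →L[ℝ] V}

/-- `J` is an isometry, so it maps an orthonormal basis to an orthonormal basis. -/
theorem IsOrthonormal.trace_comp_J (hb : IsOrthonormal g b) (hsymm : ∀ v w, g v w = g w v)
    (hJ : ∀ v, J (J v) = -v) (hgJ : ∀ v w, g (J v) (J w) = g v w) (F : V → V → ℝ)
    (h₁ : ∀ v, IsLinearMap ℝ fun u => F u v) (h₂ : ∀ u, IsLinearMap ℝ (F u)) :
    ∑ i, F (J (b i)) (J (b i)) = ∑ i, F (b i) (b i) := by
  let e : V ≃ₗ[ℝ] V := LinearEquiv.ofLinearMap J.toLinearMap (-J.toLinearMap)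
    (by ext v; simp [hJ]) (by ext v; simp [hJ])
  have hb' : IsOrthonormal g (b.map e) := fun i j => by
    simpa [e, hgJ] using hb i j
  simpa [e] using hb.trace_eq hb' hsymm F h₁ h₂

/-- Moving `J` across a trace costs a sign because `J² = -1`. A trace against `J` therefore sees
only the antisymmetric part of `F`, which is how the Ricci identity enters later. -/
theorem IsOrthonormal.trace_J_left (hb : IsOrthonormal g b) (hsymm : ∀ v w, g v w = g w v)
    (hJ : ∀ v, J (J v) = -v) (hgJ : ∀ v w, g (J v) (J w) = g v w) (F : V → V → ℝ)
    (h₁ : ∀ v, IsLinearMap ℝ fun u => F u v) (h₂ : ∀ u, IsLinearMap ℝ (F u)) :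
    ∑ i, F (J (b i)) (b i) = -∑ i, F (b i) (J (b i)) := by
  have h := hb.trace_comp_J hsymm hJ hgJ (fun u v => F u (J v)) (fun v => h₁ _)
    (fun u => ⟨fun x y => by simp [(h₂ u).map_add], fun c x => by simp [(h₂ u).map_smul]⟩)
  rw [← h, ← Finset.sum_neg_distrib]
  refine Finset.sum_congr rfl fun i _ => ?_
  rw [hJ, (h₂ _).map_neg, neg_neg]

end Orthonormal

/-! ### Vector-valued 2-forms with totally skew-symmetric metric dual -/

section Skew

variable {V : Type*} [NormedAddCommGroup V] [NormedSpace ℝ V]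
  {ι : Type*} [Fintype ι] [DecidableEq ι]

/-- The trilinear form `(u, v, w) ↦ g(X(u, v), w)` is totally skew-symmetric. -/
structure IsSkew (g : V →L[ℝ] V →L[ℝ] ℝ) (X : V →L[ℝ] V →L[ℝ] V) : Prop where
  swap : ∀ u v, X u v = -X v u
  skew : ∀ u v w, g (X u v) w = -g (X u w) v

variable {g : V →L[ℝ] V →L[ℝ] ℝ} {b : Module.Basis ι ℝ V} {X Y Z : V →L[ℝ] V →L[ℝ] V}

theorem IsSkew.rotate (hX : IsSkew g X) (u v w : V) : g (X u v) w = g (X v w) u := by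
  rw [hX.swap u v]
  simp only [map_neg, neg_apply]
  rw [hX.skew v u w, neg_neg]

theorem IsSkew.self (hX : IsSkew g X) (u v : V) : g (X u v) v = 0 := by
  have := hX.skew u v v
  linarith

variable (g b) in
/-- The contraction `K(u, v) = ∑ₐ g(Y(u, bₐ), Z(v, bₐ))`. -/
def contr (Y Z : V →L[ℝ] V →L[ℝ] V) (u v : V) : ℝ := ∑ a, g (Y u (b a)) (Z v (b a))

theorem contr_comm (hsymm : ∀ v w, g v w = g w v) (Y Z : V →L[ℝ] V →L[ℝ] V) (u v : V) :
    contr g b Y Z u v = contr g b Z Y v u :=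
  Finset.sum_congr rfl fun _ _ => hsymm _ _

variable (g b) in
/-- The contraction `∑ g(X(v, bₐ), b_d) K(b_d, bₐ)` with the contraction `K` of `Y` and `Z`. -/
def contr₃ (X Y Z : V →L[ℝ] V →L[ℝ] V) (v : V) : ℝ :=
  ∑ a, ∑ d, g (X v (b a)) (b d) * contr g b Y Z (b d) (b a)

/-- `X v` is skew for `g`, while exchanging `Y` and `Z` transposes their contraction. The
contraction of a skew with a symmetric tensor then vanishes (`contr₃_self`), which is the source of
the cancellations below. -/
theorem contr₃_swap (hsymm : ∀ v w, g v w = g w v) (hX : IsSkew g X)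
    (Y Z : V →L[ℝ] V →L[ℝ] V) (v : V) : contr₃ g b X Y Z v = -contr₃ g b X Z Y v := by
  unfold contr₃
  rw [Finset.sum_comm, ← Finset.sum_neg_distrib]
  refine Finset.sum_congr rfl fun a _ => ?_
  rw [← Finset.sum_neg_distrib]
  refine Finset.sum_congr rfl fun d _ => ?_
  rw [hX.skew v, contr_comm hsymm Y Z]
  ring

theorem contr₃_self (hsymm : ∀ v w, g v w = g w v) (hX : IsSkew g X)
    (Y : V →L[ℝ] V →L[ℝ] V) (v : V) : contr₃ g b X Y Y v = 0 := by
  have := contr₃_swap (b := b) hsymm hX Y Y v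
  linarith

/-- The cyclic sum `X(Y(u, v), w) + X(Y(v, w), u) + X(Y(w, u), v)`. -/
def cyc (X Y : V →L[ℝ] V →L[ℝ] V) (u v w : V) : V :=
  X (Y u v) w + X (Y v w) u + X (Y w u) v

/-- Two of the three cyclic terms agree after relabelling the summation indices, and the one in
which `v` is the outer argument becomes the other contraction by rotating the three slots. -/
theorem sum_inner_cyc (hb : IsOrthonormal g b) (hX : IsSkew g X) (hY : IsSkew g Y) (hZ : IsSkew g Z) (v : V) :
    ∑ i, ∑ j, g (cyc X Y v (b i) (b j)) (Z (b i) (b j)) =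
      2 * contr₃ g b Y X Z v + contr₃ g b X Y Z v := by
  have e₁ : ∑ i, ∑ j, g (X (Y v (b i)) (b j)) (Z (b i) (b j)) = contr₃ g b Y X Z v := by
    unfold contr₃ contr
    refine Finset.sum_congr rfl fun i _ => ?_
    simp_rw [Finset.mul_sum]
    rw [Finset.sum_comm]
    refine Finset.sum_congr rfl fun j _ => ?_
    conv_lhs => rw [← hb.sum_smul (Y v (b i))]
    simp
  have e₃ : ∑ i, ∑ j, g (X (Y (b j) v) (b i)) (Z (b i) (b j)) = contr₃ g b Y X Z v := by
    rw [← e₁, Finset.sum_comm]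
    refine Finset.sum_congr rfl fun i _ => Finset.sum_congr rfl fun j _ => ?_
    rw [hY.swap (b i) v, hZ.swap (b j) (b i)]
    simp
  have e₂ : ∑ i, ∑ j, g (X (Y (b i) (b j)) v) (Z (b i) (b j)) = contr₃ g b X Y Z v := by
    have h : ∀ i j, g (X (Y (b i) (b j)) v) (Z (b i) (b j)) =
        ∑ c, ∑ d, g (X v (b c)) (b d) * (g (Y (b d) (b i)) (b j) * g (Z (b c) (b i)) (b j)) := by
      intro i j
      rw [hb.apply_eq_sum]
      refine Finset.sum_congr rfl fun c _ => ?_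
      have : g (X (Y (b i) (b j)) v) (b c) = g (X v (b c)) (Y (b i) (b j)) := hX.rotate _ _ _
      rw [this, hb.apply_eq_sum (X v (b c)), Finset.sum_mul]
      refine Finset.sum_congr rfl fun d _ => ?_
      rw [hY.rotate (b d) (b i), hZ.rotate (b c) (b i)]
      ring
    simp_rw [h]
    unfold contr₃ contr
    rw [Finset.sum_congr rfl fun i _ => Finset.sum_comm, Finset.sum_comm]
    refine Finset.sum_congr rfl fun c _ => ?_
    rw [Finset.sum_congr rfl fun i _ => Finset.sum_comm, Finset.sum_comm]
    refine Finset.sum_congr rfl fun d _ => ?_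
    simp_rw [← Finset.mul_sum]
    congr 1
    refine Finset.sum_congr rfl fun i _ => ?_
    rw [← hb.apply_eq_sum]
  simp only [cyc, map_add, add_apply, Finset.sum_add_distrib]
  rw [e₁, e₂, e₃]
  ring

theorem inner_cyc_self (hsymm : ∀ v w, g v w = g w v) (hX : IsSkew g X) (u v w z : V) :
    g (cyc X X u v w) z =
      g (X u v) (X w z) + g (X v w) (X u z) + g (X w u) (X v z) := by
  simp only [cyc, map_add, add_apply]
  rw [hX.rotate (X u v), hX.rotate (X v w), hX.rotate (X w u), hsymm (X w z), hsymm (X u z),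
    hsymm (X v z)]

end Skew

end BismutFlat

namespace BismutFlat

/-! ### Compatibility of skew-symmetric torsion with a complex structure -/

section Complex

variable {V : Type*} [NormedAddCommGroup V] [NormedSpace ℝ V]
  {ι : Type*} [Fintype ι] [DecidableEq ι]
  {g : V →L[ℝ] V →L[ℝ] ℝ} {b : Module.Basis ι ℝ V} {J : V →L[ℝ] V}
  {T X : V →L[ℝ] V →L[ℝ] V}

/-- The `(0,2)`-part of the vector-valued form `X` (its Nijenhuis-type obstruction) vanishes. -/
def IsIntegrable (J : V →L[ℝ] V) (X : V →L[ℝ] V →L[ℝ] V) : Prop :=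
  ∀ u v, X (J u) (J v) = J (X (J u) v) + J (X u (J v)) + X u v

theorem ext_basis {W : Type*} [NormedAddCommGroup W] [NormedSpace ℝ W] (b : Module.Basis ι ℝ V)
    {f : V →L[ℝ] W} (h : ∀ i, f (b i) = 0) : f = 0 := by
  have : (f : V →ₗ[ℝ] W) = 0 := b.ext fun i => by simpa using h i
  ext v
  simpa using congrArg (fun f : V →ₗ[ℝ] W => f v) this

theorem eq_of_inner_eq (hpos : ∀ v, v ≠ 0 → 0 < g v v) {v w : V} (h : ∀ z, g v z = g w z) :
    v = w := by
  by_contra hne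
  have h₂ := hpos _ (sub_ne_zero.mpr hne)
  rw [map_sub g, sub_apply, h] at h₂
  simp at h₂

theorem inner_add_left (g : V →L[ℝ] V →L[ℝ] ℝ) (u v w : V) : g (u + v) w = g u w + g v w := by
  rw [map_add g, add_apply]

theorem inner_sub_left (g : V →L[ℝ] V →L[ℝ] ℝ) (u v w : V) : g (u - v) w = g u w - g v w := by
  rw [map_sub g, sub_apply]

theorem inner_neg_left (g : V →L[ℝ] V →L[ℝ] ℝ) (v w : V) : g (-v) w = -g v w := by
  rw [map_neg g, neg_apply]

theorem inner_smul_left (g : V →L[ℝ] V →L[ℝ] ℝ) (r : ℝ) (v w : V) :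
    g (r • v) w = r * g v w := by
  rw [map_smul g, smul_apply, smul_eq_mul]

theorem cyc_add_left (X X' Y : V →L[ℝ] V →L[ℝ] V) (u v w : V) :
    cyc (X + X') Y u v w = cyc X Y u v w + cyc X' Y u v w := by
  simp only [cyc, add_apply X X', add_apply (X _) (X' _)]
  abel

theorem cyc_add_right (X Y Y' : V →L[ℝ] V →L[ℝ] V) (u v w : V) :
    cyc X (Y + Y') u v w = cyc X Y u v w + cyc X Y' u v w := by
  simp only [cyc, add_apply Y Y', add_apply (Y _) (Y' _), map_add X, add_apply (X _) (X _)]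
  abel

theorem cyc_smul_left (r : ℝ) (X Y : V →L[ℝ] V →L[ℝ] V) (u v w : V) :
    cyc (r • X) Y u v w = r • cyc X Y u v w := by
  simp only [cyc, smul_apply X r, smul_apply (X _) r, smul_add]

theorem cyc_smul_right (r : ℝ) (X Y : V →L[ℝ] V →L[ℝ] V) (u v w : V) :
    cyc X (r • Y) u v w = r • cyc X Y u v w := by
  simp only [cyc, smul_apply Y r, smul_apply (Y _) r, map_smul X, smul_apply (X _) r, smul_add]

theorem cyc_add_vec (X Y : V →L[ℝ] V →L[ℝ] V) (u u' v w : V) :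
    cyc X Y (u + u') v w = cyc X Y u v w + cyc X Y u' v w := by
  simp only [cyc, map_add Y, add_apply (Y _) (Y _), map_add (Y _), map_add X,
    add_apply (X _) (X _), map_add (X _)]
  abel

theorem cyc_smul_vec (r : ℝ) (X Y : V →L[ℝ] V →L[ℝ] V) (u v w : V) :
    cyc X Y (r • u) v w = r • cyc X Y u v w := by
  simp only [cyc, map_smul Y, smul_apply (Y _) r, map_smul (Y _), map_smul X, smul_apply (X _) r,
    map_smul (X _), smul_add]

theorem inner_J_left (hJ : ∀ v, J (J v) = -v) (hgJ : ∀ v w, g (J v) (J w) = g v w) (v w : V) :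
    g (J v) w = -g v (J w) := by
  rw [← hgJ v (J w), hJ]
  simp

theorem IsIntegrable.inner_eq (hX : IsIntegrable J X) (hJ : ∀ v, J (J v) = -v)
    (hgJ : ∀ v w, g (J v) (J w) = g v w) (u v w : V) :
    g (X u v) w = g (X (J u) (J v)) w + g (X (J u) v) (J w) + g (X u (J v)) (J w) := by
  rw [hX u v]
  simp only [inner_add_left g]
  rw [inner_J_left hJ hgJ, inner_J_left hJ hgJ]
  ring

/-- A 4-form all of whose contractions are of type `(2,1) + (1,2)` is of type `(2,2)`. -/
theorem J_left_of_isIntegrable {S : V → V →L[ℝ] V →L[ℝ] V}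
    (hpos : ∀ v, v ≠ 0 → 0 < g v v) (hJ : ∀ v, J (J v) = -v)
    (hgJ : ∀ v w, g (J v) (J w) = g v w) (hS : ∀ u, IsSkew g (S u))
    (hS' : ∀ u v w, S u v w = -S v u w) (hSJ : ∀ u, IsIntegrable J (S u)) (u v w : V) :
    S (J u) v w = J (S u (J v) (J w)) := by
  have key : ∀ u v w z, g (S (J u) (J v) (J w)) (J z) = g (S u v w) z := by
    intro u v w z
    have s₁₂ : ∀ u v w z, g (S u v w) z = -g (S v u w) z := fun u v w z => by
      rw [hS' u v w]; simp
    have s₂₃ : ∀ u v w z, g (S u v w) z = -g (S u w v) z := fun u v w z => by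
      rw [(hS u).swap v w]; simp
    have s₃₄ : ∀ u v w z, g (S u v w) z = -g (S u v z) w := fun u v w z => (hS u).skew v w z
    have P : ∀ u v w z, g (S u v w) z = g (S u (J v) (J w)) z + g (S u (J v) w) (J z) +
        g (S u v (J w)) (J z) := fun u v w z => (hSJ u).inner_eq hJ hgJ v w z
    have p₁ := P u v w z
    have p₂ := P v u w z
    rw [s₁₂ v u w z, s₁₂ v (J u) (J w) z, s₁₂ v (J u) w (J z), s₁₂ v u (J w) (J z)] at p₂
    have p₃ := P w u v z
    rw [s₁₂ w u v z, s₁₂ w (J u) (J v) z, s₁₂ w (J u) v (J z), s₁₂ w u (J v) (J z),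
      s₂₃ u w v z, s₂₃ (J u) w (J v) z, s₂₃ (J u) w v (J z), s₂₃ u w (J v) (J z)] at p₃
    have p₄ := P z u v w
    rw [s₁₂ z u v w, s₁₂ z (J u) (J v) w, s₁₂ z (J u) v (J w), s₁₂ z u (J v) (J w),
      s₂₃ u z v w, s₂₃ (J u) z (J v) w, s₂₃ (J u) z v (J w), s₂₃ u z (J v) (J w),
      s₃₄ u v z w, s₃₄ (J u) (J v) z w, s₃₄ (J u) v z (J w), s₃₄ u (J v) z (J w)] at p₄
    have p₅ := P (J u) (J v) w z
    simp only [hJ, map_neg, neg_apply] at p₅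
    -- Let `s` be the value at `u, v, w, z` and `e_ij` the value with `J` in slots `i, j`. The four
    -- instances `p₁`–`p₄` say that `s` is the sum of the `e_ij` avoiding one given slot, whence `s
    -- = e₁₂ + e₁₃ + e₁₄`. By `p₅` the value with `J` in all four slots is the same sum.
    linarith
  have h : ∀ z, g (S (J u) v w) z = g (J (S u (J v) (J w))) z := by
    intro z
    have h := key (J u) v w z
    rw [hJ, hS' (-u), inner_neg_left, map_neg (S (J v)), neg_apply, inner_neg_left, neg_neg,
      hS' (J v), inner_neg_left] at h
    rw [← h, inner_J_left hJ hgJ]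
  exact eq_of_inner_eq hpos h

/-- The algebraic core of the parallelism of the torsion of a Bismut flat metric: `S = ∇T` vanishes
as soon as it is the `(2,2)`-form `-1/3 cyc(T, T)` and its covariant derivative `M` satisfies the
Ricci identity of a flat connection with torsion `T`. -/
theorem covariantDeriv_torsion_eq_zero {S : V → V →L[ℝ] V →L[ℝ] V} {M : V → V → V → V → V}
    (hb : IsOrthonormal g b) (hsymm : ∀ v w, g v w = g w v)
    (hpos : ∀ v, v ≠ 0 → 0 < g v v) (hJ : ∀ v, J (J v) = -v)
    (hgJ : ∀ v w, g (J v) (J w) = g v w) (hT : IsSkew g T) (hS : ∀ u, IsSkew g (S u))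
    (hS' : ∀ u v w, S u v w = -(1 / 3 : ℝ) • cyc T T u v w)
    (hSJ : ∀ u v w, S (J u) v w = J (S u (J v) (J w)))
    (hM : ∀ u v a c, M u v a c = -(1 / 3 : ℝ) • (cyc (S u) T v a c + cyc T (S u) v a c))
    (hMJ : ∀ u v a c, M u (J v) a c = J (M u v (J a) (J c)))
    (hRicci : ∀ u v a c, M u v a c - M v u a c = -S (T u v) a c) (u v w : V) : S u v w = 0 := by
  have hSadd : ∀ u u', S (u + u') = S u + S u' := by
    intro u u'
    ext v w
    rw [hS', cyc_add_vec, add_apply, add_apply, hS', hS', smul_add]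
  have hSsmul : ∀ (r : ℝ) u, S (r • u) = r • S u := by
    intro r u
    ext v w
    rw [hS', cyc_smul_vec, smul_apply, smul_apply, hS', smul_comm]
  -- Both sides reduce to the contraction of `T` with `S u` and `T`: the factor 3 that `M` collects
  -- from its two cyclic sums matches the one from `cyc T T`, and both cancel `1/3`.
  have f₁ : ∀ u v, ∑ i, ∑ j, g (M u v (b i) (b j)) (T (b i) (b j)) =
      -∑ i, ∑ j, g (S v (b i) (b j)) (S u (b i) (b j)) := by
    intro u v
    simp_rw [hM, hS' v]
    simp only [inner_smul_left g, inner_add_left g, ← Finset.mul_sum, Finset.sum_add_distrib]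
    rw [sum_inner_cyc hb (hS u) hT hT, sum_inner_cyc hb hT (hS u) hT, sum_inner_cyc hb hT hT (hS u),
      contr₃_self hsymm (hS u), contr₃_swap hsymm hT T (S u)]
    ring
  -- This is ⟨∇_uT, T⟩ = 0, so that |T|² is constant.
  have f₂ : ∀ u, ∑ i, ∑ j, g (S u (b i) (b j)) (T (b i) (b j)) = 0 := by
    intro u
    simp_rw [hS' u]
    simp only [inner_smul_left g, ← Finset.mul_sum]
    rw [sum_inner_cyc hb hT hT hT, contr₃_self hsymm hT]
    ring
  -- The trace of ⟨∇²T, T⟩ vanishes. By `hMJ` it equals, up to sign, the trace of `F(u, Ju)`. Under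
  -- exchange of the arguments this trace is antisymmetric by `trace_J_left`, and symmetric by the
  -- Ricci identity.
  have f₃ : ∑ k, ∑ i, ∑ j, g (M (b k) (b k) (b i) (b j)) (T (b i) (b j)) = 0 := by
    set F : V → V → ℝ := fun u v =>
      ∑ i, ∑ j, g (J (M u v (J (b i)) (J (b j)))) (T (b i) (b j)) with hF
    have hM₁ : ∀ u u' v a c, M (u + u') v a c = M u v a c + M u' v a c := by
      intro u u' v a c
      simp only [hM, hSadd, cyc_add_left, cyc_add_right]
      module
    have hM₂ : ∀ (r : ℝ) u v a c, M (r • u) v a c = r • M u v a c := by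
      intro r u v a c
      simp only [hM, hSsmul, cyc_smul_left, cyc_smul_right]
      module
    have hM₃ : ∀ u v v' a c, M u (v + v') a c = M u v a c + M u v' a c := by
      intro u u' v a c
      simp only [hM, cyc_add_vec]
      module
    have hM₄ : ∀ (r : ℝ) u v a c, M u (r • v) a c = r • M u v a c := by
      intro r u v a c
      simp only [hM, cyc_smul_vec]
      module
    have hneg : ∀ k, ∑ i, ∑ j, g (M (b k) (b k) (b i) (b j)) (T (b i) (b j)) =
        -F (b k) (J (b k)) := by
      intro k
      rw [hF, ← Finset.sum_neg_distrib]
      refine Finset.sum_congr rfl fun i _ => ?_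
      rw [← Finset.sum_neg_distrib]
      refine Finset.sum_congr rfl fun j _ => ?_
      rw [← hMJ, hJ, ← neg_one_smul ℝ (b k), hM₄, inner_smul_left]
      ring
    have hsum := hb.trace_J_left hsymm hJ hgJ F
      (fun v => ⟨fun x y => by simp only [hF, hM₁, map_add J, inner_add_left g, Finset.sum_add_distrib],
        fun c x => by
          simp only [hF, hM₂, map_smul J, inner_smul_left g, ← Finset.mul_sum, smul_eq_mul]⟩)
      (fun u => ⟨fun x y => by simp only [hF, hM₃, map_add J, inner_add_left g, Finset.sum_add_distrib],
        fun c x => by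
          simp only [hF, hM₄, map_smul J, inner_smul_left g, ← Finset.mul_sum, smul_eq_mul]⟩)
    -- The Ricci identity leaves the term `J (S (T u v) (J ·) (J ·))`. By `hSJ` it is `S` evaluated
    -- at `J (T u v)`, which is orthogonal to `T` by `f₂`.
    have hdiff : ∀ k, F (b k) (J (b k)) - F (J (b k)) (b k) = 0 := by
      intro k
      rw [hF]
      simp only [← Finset.sum_sub_distrib, ← inner_sub_left g, ← map_sub J, hRicci]
      simp only [map_neg J, ← hSJ, inner_neg_left g, Finset.sum_neg_distrib, f₂, neg_zero]
    have hd := Finset.sum_congr (rfl : (Finset.univ : Finset ι) = _) fun k _ => hdiff k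
    rw [Finset.sum_sub_distrib, hsum, Finset.sum_const_zero] at hd
    simp_rw [hneg, Finset.sum_neg_distrib]
    linarith
  have nonneg : ∀ v, 0 ≤ g v v := fun v => by
    by_cases h : v = 0
    · simp [h]
    · exact (hpos v h).le
  have f₄ : ∑ k, ∑ i, ∑ j, g (S (b k) (b i) (b j)) (S (b k) (b i) (b j)) = 0 := by
    simp_rw [f₁, Finset.sum_neg_distrib] at f₃
    linarith
  rw [Finset.sum_eq_zero_iff_of_nonneg fun k _ =>
    Finset.sum_nonneg fun i _ => Finset.sum_nonneg fun j _ => nonneg _] at f₄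
  have zero : ∀ k i j, S (b k) (b i) (b j) = 0 := by
    intro k i j
    have h := f₄ k (Finset.mem_univ k)
    rw [Finset.sum_eq_zero_iff_of_nonneg fun i _ => Finset.sum_nonneg fun j _ => nonneg _] at h
    have h := h i (Finset.mem_univ i)
    rw [Finset.sum_eq_zero_iff_of_nonneg fun j _ => nonneg _] at h
    have h := h j (Finset.mem_univ j)
    by_contra hne
    exact (hpos _ hne).ne' h
  have hcyc : S u v w = S w u v := by
    rw [hS', hS']
    simp only [cyc]
    module
  have hSw : ∀ k, S (b k) = 0 := fun k => ext_basis b fun i => ext_basis b fun j => zero k i j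
  rw [hcyc, ← hb.sum_smul w]
  have : S (∑ i, g w (b i) • b i) = ∑ i, g w (b i) • S (b i) := by
    let L : V →ₗ[ℝ] V →L[ℝ] V →L[ℝ] V := ⟨⟨S, hSadd⟩, hSsmul⟩
    exact (map_sum L _ _).trans (Finset.sum_congr rfl fun i _ => hSsmul _ _)
  simp [this, hSw]

/-! ### The Chern torsion and its norm -/

/-- Two metric and complex connections differ by a tensor `A`; if the torsion of one of them is
skew-symmetric and the torsion `C = T + A - Aᵗ` of the other has no `(1,1)`-part, then `C` is
minus the `(2,0) + (0,2)`-part of `T`. -/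
theorem chern_torsion_eq (hpos : ∀ v, v ≠ 0 → 0 < g v v)
    (hJ : ∀ v, J (J v) = -v)
    (hgJ : ∀ v w, g (J v) (J w) = g v w) (hT : IsSkew g T) (hTJ : IsIntegrable J T)
    {A C : V →L[ℝ] V →L[ℝ] V} (hA : ∀ u v w, g (A u v) w = -g (A u w) v)
    (hAJ : ∀ u v, A u (J v) = J (A u v)) (hC : ∀ u v, C u v = T u v + A u v - A v u)
    (hCJ : ∀ u v, C (J u) (J v) = -C u v) (u v : V) :
    C u v = (1 / 2 : ℝ) • (T (J u) (J v) - T u v) := by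
  -- If `A` is the difference of the two connections, the expected value of `A` is `-1/2 (T u v - J
  -- T(u, Jv))`. The error `B` is complex linear in `v` and skew for `g`; the aim is to show that it
  -- vanishes.
  set B : V → V → V := fun u v => A u v + (1 / 2 : ℝ) • (T u v - J (T u (J v))) with hB
  have hBJ : ∀ u v, B u (J v) = J (B u v) := by
    intro u v
    simp only [hB, hAJ, hJ, map_add, map_smul, map_sub, map_neg]
    module
  have hBskew : ∀ u v w, g (B u v) w = -g (B u w) v := by
    intro u v w
    have h₁ := hA u v w
    have h₂ := hT.skew u v w
    have h₃ := hT.skew u (J v) (J w)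
    simp only [hB, map_add, map_smul, map_sub, add_apply, smul_apply, sub_apply, smul_eq_mul,
      inner_J_left hJ hgJ]
    linarith
  have hD : ∀ u v, B u v - B v u = C u v - (1 / 2 : ℝ) • (T (J u) (J v) - T u v) := by
    intro u v
    simp only [hB]
    rw [hTJ u v, hC u v, hT.swap v u, hT.swap v (J u), map_neg]
    module
  have hDJ : ∀ u v, J (B (J u) v) - J (B (J v) u) = -(B u v - B v u) := by
    intro u v
    rw [← hBJ, ← hBJ, hD, hD, hCJ, hJ, hJ]
    simp only [map_neg, neg_apply]
    module
  have hBneg : ∀ u v, B (-u) v = -B u v := by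
    intro u v
    simp only [hB, map_neg, neg_apply]
    module
  have hBneg' : ∀ u v, B u (-v) = -B u v := by
    intro u v
    simp only [hB, map_neg]
    module
  -- `B (Ju) v - J (B u v)` is conjugate linear in `u`, complex linear in `v`, and, as shown here,
  -- antisymmetric. Exchanging the arguments makes it linear and conjugate linear in the same slot,
  -- so it is zero.
  have hE : ∀ u v, B (J u) v - J (B u v) = -(B (J v) u - J (B v u)) := by
    intro u v
    have h := hDJ (J u) v
    rw [hJ, hBneg, hBJ (J v) u, hJ, hBJ v u, map_neg] at h
    rw [eq_neg_iff_add_eq_zero] at h ⊢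
    rw [← h]
    abel
  have hE₀ : ∀ u v, B (J u) v = J (B u v) := by
    intro u v
    have h₁ := hE (J u) v
    rw [hJ, hBneg, hBJ, hBJ] at h₁
    have h₂ := congrArg J (hE u v)
    simp only [map_sub, map_neg, hJ] at h₂ h₁
    have h₄ : -B u v - J (B (J u) v) = J (B (J u) v) + B u v := by
      rw [h₁, ← h₂, sub_neg_eq_add]
    have h₃ : B u v = -J (B (J u) v) := by
      rw [eq_neg_iff_add_eq_zero]
      have : (2 : ℝ) • (B u v + J (B (J u) v)) = 0 := by
        rw [two_smul]
        nth_rewrite 1 [add_comm (B u v), ← h₄]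
        abel
      exact (smul_eq_zero.mp this).resolve_left two_ne_zero
    rw [h₃, map_neg, hJ, neg_neg]
  -- Complex linearity in `u` is incompatible with values in skew-Hermitian endomorphisms, since
  -- multiplication by `i` turns these into Hermitian ones.
  have hB₀ : ∀ u v, B u v = 0 := by
    intro u v
    refine eq_of_inner_eq hpos fun z => ?_
    have h₁ := hBskew u v z
    have h₂ : g (B (J (J u)) v) z = g (J (B (J u) v)) z := by rw [hE₀]
    rw [inner_J_left hJ hgJ, hBskew (J u), hBJ, ← hE₀, hJ, hBneg, hBneg, inner_neg_left,
      inner_neg_left] at h₂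
    simp only [map_zero, zero_apply]
    linarith
  have h := hD u v
  rw [hB₀, hB₀, sub_zero] at h
  exact (sub_eq_zero.mp h.symm)

end Complex

end BismutFlat

namespace BismutFlat

/-! ### Quadratic identities for the Bismut torsion and its trace -/

section Norm

variable {V : Type*} [NormedAddCommGroup V] [NormedSpace ℝ V]
  {ι : Type*} [Fintype ι] [DecidableEq ι]
  {g : V →L[ℝ] V →L[ℝ] ℝ} {b : Module.Basis ι ℝ V} {J : V →L[ℝ] V} {T : V →L[ℝ] V →L[ℝ] V}

theorem IsOrthonormal.trace_linearMap (hb : IsOrthonormal g b) (f : V →ₗ[ℝ] V) :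
    LinearMap.trace ℝ V f = ∑ i, g (f (b i)) (b i) := by
  rw [LinearMap.trace_eq_matrix_trace ℝ b, Matrix.trace]
  refine Finset.sum_congr rfl fun i _ => ?_
  rw [Matrix.diag_apply, LinearMap.toMatrix_apply, hb.repr_apply]

variable (b J T) in
/-- The metric dual `1/2 ∑ₖ T(bₖ, J bₖ)` of the trace of the torsion. -/
def traceVec : V := (1 / 2 : ℝ) • ∑ k, T (b k) (J (b k))

theorem inner_traceVec_left (v : V) :
    g (traceVec b J T) v = 1 / 2 * ∑ k, g (T (b k) (J (b k))) v := by
  rw [traceVec, inner_smul_left, map_sum g, sum_apply]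

/-- By total skewness the slots of T are interchangeable, so contracting T with the copy having `J`
in two of its slots gives the same number whichever two slots are chosen. -/
theorem sum_inner_J_mixed (hb : IsOrthonormal g b) (hsymm : ∀ v w, g v w = g w v)
    (hJ : ∀ v, J (J v) = -v) (hgJ : ∀ v w, g (J v) (J w) = g v w) (hT : IsSkew g T) :
    ∑ i, ∑ j, g (T (J (b i)) (b j)) (J (T (b i) (b j))) =
      ∑ i, ∑ j, g (T (J (b i)) (J (b j))) (T (b i) (b j)) := by
  have h₁ : ∀ i j, g (T (J (b i)) (b j)) (J (T (b i) (b j))) =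
      ∑ k, g (T (J (b k)) (J (b i))) (b j) * g (T (b k) (b i)) (b j) := by
    intro i j
    rw [← neg_neg (g _ _), ← inner_J_left hJ hgJ, hsymm, hb.apply_eq_sum, ← Finset.sum_neg_distrib]
    refine Finset.sum_congr rfl fun k _ => ?_
    rw [inner_J_left hJ hgJ, hT.rotate (J (b k)), hT.rotate (b k)]
    ring
  simp_rw [h₁]
  rw [Finset.sum_congr rfl fun i _ => Finset.sum_comm, Finset.sum_comm]
  refine Finset.sum_congr rfl fun k _ => Finset.sum_congr rfl fun i _ => ?_
  rw [← hb.apply_eq_sum]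

/-- Integrability writes T as the sum of its three copies with `J` in two slots, and by
`sum_inner_J_mixed` these have equal contractions with T. -/
theorem sum_inner_self_eq (hb : IsOrthonormal g b) (hsymm : ∀ v w, g v w = g w v)
    (hJ : ∀ v, J (J v) = -v) (hgJ : ∀ v w, g (J v) (J w) = g v w) (hT : IsSkew g T)
    (hTJ : IsIntegrable J T) :
    ∑ i, ∑ j, g (T (b i) (b j)) (T (b i) (b j)) =
      3 * ∑ i, ∑ j, g (T (J (b i)) (J (b j))) (T (b i) (b j)) := by
  have h := sum_inner_J_mixed hb hsymm hJ hgJ hT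
  have h' : ∑ i, ∑ j, g (T (b i) (J (b j))) (J (T (b i) (b j))) =
      ∑ i, ∑ j, g (T (J (b i)) (J (b j))) (T (b i) (b j)) := by
    rw [← h, Finset.sum_comm]
    refine Finset.sum_congr rfl fun i _ => Finset.sum_congr rfl fun j _ => ?_
    rw [hT.swap (b j) (J (b i)), hT.swap (b j) (b i), inner_neg_left, map_neg J, map_neg, neg_neg]
  simp_rw [fun i j => hTJ.inner_eq hJ hgJ (b i) (b j) (T (b i) (b j)), Finset.sum_add_distrib]
  rw [h, h']
  ring

/-- With `A` the sum on the right without its factor, |T|² = 3A = |T(J·,J·)|², so the square of the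
difference is 3A - 2A + 3A = 4A. -/
theorem sum_inner_chern_torsion (hb : IsOrthonormal g b) (hsymm : ∀ v w, g v w = g w v)
    (hJ : ∀ v, J (J v) = -v) (hgJ : ∀ v w, g (J v) (J w) = g v w) (hT : IsSkew g T)
    (hTJ : IsIntegrable J T) :
    ∑ i, ∑ j, g (T (J (b i)) (J (b j)) - T (b i) (b j)) (T (J (b i)) (J (b j)) - T (b i) (b j)) =
      4 * ∑ i, ∑ j, g (T (J (b i)) (J (b j))) (T (b i) (b j)) := by
  have h₁ : ∑ i, ∑ j, g (T (J (b i)) (J (b j))) (T (J (b i)) (J (b j))) =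
      ∑ i, ∑ j, g (T (b i) (b j)) (T (b i) (b j)) := by
    rw [← hb.trace_comp_J hsymm hJ hgJ (fun u v => ∑ j, g (T u (b j)) (T v (b j)))
      (fun v => ⟨fun x y => by simp [Finset.sum_add_distrib],
        fun c x => by simp [Finset.mul_sum]⟩)
      (fun v => ⟨fun x y => by simp [Finset.sum_add_distrib],
        fun c x => by simp [Finset.mul_sum]⟩)]
    refine Finset.sum_congr rfl fun i _ => ?_
    exact hb.trace_comp_J hsymm hJ hgJ (fun u v => g (T (J (b i)) u) (T (J (b i)) v))
      (fun v => ⟨fun x y => by simp, fun c x => by simp⟩)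
      (fun v => ⟨fun x y => by simp, fun c x => by simp⟩)
  have h₂ := sum_inner_self_eq hb hsymm hJ hgJ hT hTJ
  have h₃ : ∀ i j, g (T (J (b i)) (J (b j)) - T (b i) (b j))
      (T (J (b i)) (J (b j)) - T (b i) (b j)) =
      g (T (J (b i)) (J (b j))) (T (J (b i)) (J (b j))) -
        2 * g (T (J (b i)) (J (b j))) (T (b i) (b j)) + g (T (b i) (b j)) (T (b i) (b j)) := by
    intro i j
    rw [inner_sub_left, map_sub, map_sub, hsymm (T (b i) (b j)) (T (J (b i)) (J (b j)))]
    ring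
  simp_rw [h₃, Finset.sum_add_distrib, Finset.sum_sub_distrib, ← Finset.mul_sum]
  rw [h₁, h₂]
  ring

/-- The Jacobi identity on `bᵢ, J bᵢ, bⱼ`, paired with `J bⱼ`, splits each term of |∑ T(bᵢ, J bᵢ)|²
into two. After summation both give the same value, the second through the sign of `trace_J_left`.
-/
theorem inner_traceVec_self (hb : IsOrthonormal g b) (hsymm : ∀ v w, g v w = g w v)
    (hJ : ∀ v, J (J v) = -v) (hgJ : ∀ v w, g (J v) (J w) = g v w) (hT : IsSkew g T)
    (hjac : ∀ u v w, cyc T T u v w = 0) :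
    2 * g (traceVec b J T) (traceVec b J T) =
      ∑ i, ∑ j, g (T (J (b i)) (J (b j))) (T (b i) (b j)) := by
  have h₁ : ∀ i j, g (T (b i) (J (b i))) (T (b j) (J (b j))) =
      g (T (J (b i)) (J (b j))) (T (b i) (b j)) - g (T (J (b i)) (b j)) (T (b i) (J (b j))) := by
    intro i j
    have h := inner_cyc_self hsymm hT (b i) (J (b i)) (b j) (J (b j))
    rw [hjac, map_zero, zero_apply, hT.swap (b j) (b i), inner_neg_left,
      hsymm (T (b i) (b j)) (T (J (b i)) (J (b j)))] at h
    linarith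
  have h₂ : ∑ i, ∑ j, g (T (J (b i)) (b j)) (T (b i) (J (b j))) =
      -∑ i, ∑ j, g (T (J (b i)) (J (b j))) (T (b i) (b j)) := by
    rw [hb.trace_J_left hsymm hJ hgJ (fun u v => ∑ j, g (T u (b j)) (T v (J (b j))))
      (fun v => ⟨fun x y => by simp [Finset.sum_add_distrib],
        fun c x => by simp [Finset.mul_sum]⟩)
      (fun v => ⟨fun x y => by simp [Finset.sum_add_distrib],
        fun c x => by simp [Finset.mul_sum]⟩)]
    congr 1
    exact Finset.sum_congr rfl fun i _ => Finset.sum_congr rfl fun j _ => hsymm _ _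
  have h₃ : g (traceVec b J T) (traceVec b J T) =
      1 / 4 * ∑ i, ∑ j, g (T (b i) (J (b i))) (T (b j) (J (b j))) := by
    rw [inner_traceVec_left, traceVec, Finset.mul_sum, Finset.mul_sum]
    refine Finset.sum_congr rfl fun i _ => ?_
    rw [map_smul, map_sum, smul_eq_mul]
    ring
  rw [h₃]
  simp_rw [h₁, Finset.sum_sub_distrib]
  rw [h₂]
  ring

/-- The part `T (b k) v` is traceless by skewness, so the trace of the Chern torsion comes only from
`T(J·, J·)`. -/
theorem sum_inner_chern_torsion_trace (hT : IsSkew g T) (v : V) :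
    ∑ k, g ((1 / 2 : ℝ) • (T (J (b k)) (J v) - T (b k) v)) (b k) = g (traceVec b J T) (J v) := by
  rw [inner_traceVec_left, Finset.mul_sum]
  refine Finset.sum_congr rfl fun k _ => ?_
  rw [inner_smul_left, inner_sub_left, hT.rotate (b k) v, hT.self, sub_zero,
    hT.rotate (b k) (J (b k))]

/-- The dual 1-form of `traceVec` as an endomorphism trace, free of any choice of basis, hence
globally defined and differentiable. -/
theorem trace_J_comp (hb : IsOrthonormal g b) (hJ : ∀ v, J (J v) = -v)
    (hgJ : ∀ v w, g (J v) (J w) = g v w) (hT : IsSkew g T) (v : V) :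
    -(1 / 2) * LinearMap.trace ℝ V (J ∘L T v : V →L[ℝ] V).toLinearMap = g (traceVec b J T) v := by
  rw [hb.trace_linearMap, inner_traceVec_left, Finset.mul_sum, Finset.mul_sum]
  refine Finset.sum_congr rfl fun k _ => ?_
  have : g (J (T v (b k))) (b k) = -g (T (b k) (J (b k))) v := by
    rw [inner_J_left hJ hgJ, hT.rotate]
  change -(1 / 2) * g (J (T v (b k))) (b k) = _
  rw [this]
  ring

/-- The two norm identities combine to |T|² = 6|ξ|², ξ being `traceVec`. -/
theorem eq_zero_of_traceVec_eq_zero (hb : IsOrthonormal g b) (hsymm : ∀ v w, g v w = g w v)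
    (hpos : ∀ v, v ≠ 0 → 0 < g v v)
    (hJ : ∀ v, J (J v) = -v) (hgJ : ∀ v w, g (J v) (J w) = g v w) (hT : IsSkew g T)
    (hTJ : IsIntegrable J T) (hjac : ∀ u v w, cyc T T u v w = 0) (h : traceVec b J T = 0) :
    T = 0 := by
  have h₁ := sum_inner_self_eq hb hsymm hJ hgJ hT hTJ
  rw [← inner_traceVec_self hb hsymm hJ hgJ hT hjac, h, map_zero, mul_zero, mul_zero] at h₁
  have nonneg : ∀ v, 0 ≤ g v v := fun v => by
    by_cases h : v = 0
    · simp [h]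
    · exact (hpos v h).le
  rw [Finset.sum_eq_zero_iff_of_nonneg fun i _ => Finset.sum_nonneg fun j _ => nonneg _] at h₁
  refine ext_basis b fun i => ext_basis b fun j => ?_
  have h := h₁ i (Finset.mem_univ i)
  rw [Finset.sum_eq_zero_iff_of_nonneg fun j _ => nonneg _] at h
  have h := h j (Finset.mem_univ j)
  by_contra hne
  exact (hpos _ hne).ne' h

end Norm

end BismutFlat

namespace BismutFlat

/-! ### Exterior multiplication and contraction -/

section Exterior

open ContinuousAlternatingMap

variable {E : Type*} [NormedAddCommGroup E] [NormedSpace ℝ E]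

/-- Exterior multiplication by a 1-form, as a continuous bilinear map. -/
def wedgeL (k : ℕ) : (E →L[ℝ] ℝ) →L[ℝ] (E [⋀^Fin k]→L[ℝ] ℝ) →L[ℝ] (E [⋀^Fin (k + 1)]→L[ℝ] ℝ) :=
  (ContinuousLinearMap.compL ℝ _ _ _ (alternatizeUncurryFinCLM ℝ E ℝ)) ∘L
    (ContinuousLinearMap.smulRightL ℝ E (E [⋀^Fin k]→L[ℝ] ℝ))

theorem wedgeL_eq {k : ℕ} (a : E →L[ℝ] ℝ) (α : E [⋀^Fin k]→L[ℝ] ℝ) :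
    wedgeL k a α = alternatizeUncurryFin (a.smulRight α) := rfl

theorem wedgeL_apply {k : ℕ} (a : E →L[ℝ] ℝ) (α : E [⋀^Fin k]→L[ℝ] ℝ) (v : Fin (k + 1) → E) :
    wedgeL k a α v = ∑ i : Fin (k + 1), (-1) ^ (i : ℕ) * (a (v i) * α (i.removeNth v)) := by
  rw [wedgeL_eq, alternatizeUncurryFin_apply]
  simp

theorem wedgeL_wedgeL_add {k : ℕ} (a c : E →L[ℝ] ℝ) (α : E [⋀^Fin k]→L[ℝ] ℝ) :
    wedgeL (k + 1) a (wedgeL k c α) + wedgeL (k + 1) c (wedgeL k a α) = 0 := by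
  have h : ∀ a c : E →L[ℝ] ℝ, wedgeL (k + 1) a (wedgeL k c α) =
      alternatizeUncurryFin (alternatizeUncurryFinCLM ℝ E ℝ ∘L a.smulRight (c.smulRight α)) := by
    intro a c
    rw [wedgeL_eq]
    congr 1
    ext x v
    simp [wedgeL_eq]
  ext v
  rw [h, h, ContinuousAlternatingMap.add_apply,
    alternatizeUncurryFin_alternatizeUncurryFinCLM_comp_apply,
    alternatizeUncurryFin_alternatizeUncurryFinCLM_comp_apply, ← Finset.sum_add_distrib]
  refine Finset.sum_eq_zero fun i _ => ?_
  rw [← Finset.sum_add_distrib]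
  refine Finset.sum_eq_zero fun j _ => ?_
  rw [← smul_add]
  simp only [ContinuousLinearMap.smulRight_apply, _root_.smul_apply,
    ContinuousAlternatingMap.smul_apply, smul_eq_mul]
  ring_nf

/-- Families of alternating forms of all degrees. -/
def AllForms (E : Type*) [NormedAddCommGroup E] [NormedSpace ℝ E] : Type _ :=
  ∀ k : ℕ, E [⋀^Fin k]→L[ℝ] ℝ

instance : AddCommGroup (AllForms E) := inferInstanceAs (AddCommGroup (∀ k : ℕ, E [⋀^Fin k]→L[ℝ] ℝ))

instance : Module ℝ (AllForms E) := inferInstanceAs (Module ℝ (∀ k : ℕ, E [⋀^Fin k]→L[ℝ] ℝ))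

/-- A form of degree `k` as an element of `AllForms`. -/
def single (k : ℕ) : (E [⋀^Fin k]→L[ℝ] ℝ) →ₗ[ℝ] AllForms E :=
  LinearMap.single ℝ (fun k => E [⋀^Fin k]→L[ℝ] ℝ) k

theorem single_self (k : ℕ) (α : E [⋀^Fin k]→L[ℝ] ℝ) : single k α k = α :=
  Pi.single_eq_same (M := fun k => E [⋀^Fin k]→L[ℝ] ℝ) k α

theorem single_of_ne {k j : ℕ} (h : j ≠ k) (α : E [⋀^Fin k]→L[ℝ] ℝ) : single k α j = 0 :=
  Pi.single_eq_of_ne (M := fun k => E [⋀^Fin k]→L[ℝ] ℝ) h α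

theorem single_injective (k : ℕ) : Function.Injective (single (E := E) k) :=
  Pi.single_injective (M := fun k => E [⋀^Fin k]→L[ℝ] ℝ) k

/-- The family `k ↦ a ∧ α (k - 1)`. -/
def epsAux (a : E →L[ℝ] ℝ) (α : AllForms E) : AllForms E
  | 0 => 0
  | k + 1 => wedgeL k a (α k)

/-- Exterior multiplication by a 1-form. -/
def eps : (E →L[ℝ] ℝ) →ₗ[ℝ] Module.End ℝ (AllForms E) :=
  LinearMap.mk₂ ℝ epsAux
    (fun a c α => by
      funext k
      cases k with
      | zero => exact (add_zero 0).symm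
      | succ k => exact DFunLike.congr_fun (map_add (wedgeL k) a c) (α k))
    (fun r a α => by
      funext k
      cases k with
      | zero => exact (smul_zero r).symm
      | succ k => exact DFunLike.congr_fun (map_smul (wedgeL k) r a) (α k))
    (fun a α β => by
      funext k
      cases k with
      | zero => exact (add_zero 0).symm
      | succ k => exact map_add (wedgeL k a) (α k) (β k))
    (fun r a α => by
      funext k
      cases k with
      | zero => exact (smul_zero r).symm
      | succ k => exact map_smul (wedgeL k a) r (α k))

/-- Contraction with a vector. -/
def iota : E →ₗ[ℝ] Module.End ℝ (AllForms E) :=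
  LinearMap.mk₂ ℝ (fun v (α : AllForms E) => (fun k => (α (k + 1)).curryLeft v : AllForms E))
    (fun v w α => by
      funext k
      exact map_add (α (k + 1)).curryLeft v w)
    (fun r v α => by
      funext k
      exact map_smul (α (k + 1)).curryLeft r v)
    (fun v α β => rfl)
    (fun r v α => rfl)

theorem eps_apply_zero (a : E →L[ℝ] ℝ) (α : AllForms E) : eps a α 0 = 0 := rfl

theorem eps_apply_succ (a : E →L[ℝ] ℝ) (α : AllForms E) (k : ℕ) :
    eps a α (k + 1) = wedgeL k a (α k) := rfl

theorem iota_apply (v : E) (α : AllForms E) (k : ℕ) : iota v α k = (α (k + 1)).curryLeft v := rfl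

theorem eps_single (a : E →L[ℝ] ℝ) (k : ℕ) (α : E [⋀^Fin k]→L[ℝ] ℝ) :
    eps a (single k α) = single (k + 1) (wedgeL k a α) := by
  funext j
  cases j with
  | zero => rw [eps_apply_zero, single_of_ne (by omega)]
  | succ j =>
    rw [eps_apply_succ]
    by_cases h : j = k
    · subst h
      rw [single_self, single_self]
    · rw [single_of_ne h, single_of_ne (by omega), _root_.map_zero]

theorem iota_single_zero (v : E) (α : E [⋀^Fin 0]→L[ℝ] ℝ) : iota v (single 0 α) = 0 := by
  funext j
  rw [iota_apply, single_of_ne (by omega)]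
  rfl

theorem iota_single_succ (v : E) (k : ℕ) (α : E [⋀^Fin (k + 1)]→L[ℝ] ℝ) :
    iota v (single (k + 1) α) = single k (α.curryLeft v) := by
  funext j
  rw [iota_apply]
  by_cases h : j = k
  · subst h
    rw [single_self, single_self]
  · rw [single_of_ne h, single_of_ne (by omega)]
    rfl

theorem eps_mul_eps (a c : E →L[ℝ] ℝ) : eps a * eps c = -(eps c * eps a) := by
  ext1 α
  funext k
  refine eq_neg_of_add_eq_zero_left ?_
  match k with
  | 0 => exact add_zero _
  | 1 => simp [eps_apply_zero, eps_apply_succ]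
  | k + 2 => exact wedgeL_wedgeL_add a c (α k)

/-- Together with `eps_mul_eps` this anticommutation relation is the source of the operator
identities that follow. Acting on all degrees at once makes `iota` and `eps` endomorphisms of one
module, with no degree casts. -/
theorem iota_mul_eps (v : E) (a : E →L[ℝ] ℝ) :
    iota v * eps a = a v • (1 : Module.End ℝ (AllForms E)) - eps a * iota v := by
  ext1 α
  funext k
  ext u
  have h : ∀ k (u : Fin k → E), wedgeL k a (α k) (Matrix.vecCons v u) =
      a v * α k u - (eps a (iota v α) k) u := by
    intro k u
    rw [wedgeL_apply, Fin.sum_univ_succ]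
    cases k with
    | zero => simp [eps_apply_zero, Subsingleton.elim u ![]]
    | succ k =>
      rw [eps_apply_succ, wedgeL_apply, sub_eq_add_neg, ← Finset.sum_neg_distrib]
      congr 1
      · simp
      · refine Finset.sum_congr rfl fun i _ => ?_
        rw [iota_apply]
        have : i.succ.removeNth (α := fun _ => E) (Matrix.vecCons v u) =
            Matrix.vecCons v (i.removeNth u) := by
          funext j
          refine Fin.cases ?_ (fun j => ?_) j <;> simp [Fin.removeNth]
        rw [this]
        simp [pow_succ]
  exact h k u

end Exterior

end BismutFlat

namespace BismutFlat

/-! ### The Lefschetz operator and derivations on forms -/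

section Operators

variable {E : Type*} [NormedAddCommGroup E] [NormedSpace ℝ E]
  {ι : Type*} [Fintype ι] [DecidableEq ι]
  {g : E →L[ℝ] E →L[ℝ] ℝ} {b : Module.Basis ι ℝ E}

theorem IsOrthonormal.sum_smul_dual (hb : IsOrthonormal g b) (hsymm : ∀ v w, g v w = g w v)
    (a : E →L[ℝ] ℝ) : ∑ i, a (b i) • g (b i) = a := by
  ext v
  rw [sum_apply]
  conv_rhs => rw [← hb.sum_smul v]
  simp [hsymm v, mul_comm]

theorem IsOrthonormal.sum_smul_eps (hb : IsOrthonormal g b) (hsymm : ∀ v w, g v w = g w v)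
    (a : E →L[ℝ] ℝ) : ∑ i, a (b i) • eps (g (b i)) = eps a := by
  conv_rhs => rw [← hb.sum_smul_dual hsymm a]
  simp

theorem IsOrthonormal.sum_smul_iota (hb : IsOrthonormal g b) (v : E) :
    ∑ i, g v (b i) • iota (b i) = iota v := by
  conv_rhs => rw [← hb.sum_smul v]
  simp

theorem IsOrthonormal.sum_eps_mul_eps_flip (hb : IsOrthonormal g b)
    (hsymm : ∀ v w, g v w = g w v) (C : E →L[ℝ] E →L[ℝ] ℝ) :
    ∑ i, eps (g (b i)) * eps (C.flip (b i)) = -∑ i, eps (g (b i)) * eps (C (b i)) := by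
  have h : ∀ i, eps (g (b i)) * eps (C.flip (b i)) =
      ∑ j, C (b j) (b i) • (eps (g (b i)) * eps (g (b j))) := by
    intro i
    rw [← hb.sum_smul_eps hsymm (C.flip (b i)), Finset.mul_sum]
    simp
  simp_rw [h]
  rw [Finset.sum_comm, ← Finset.sum_neg_distrib]
  refine Finset.sum_congr rfl fun j _ => ?_
  rw [eps_mul_eps, neg_neg, ← hb.sum_smul_eps hsymm (C (b j)), Finset.sum_mul]
  simp

variable (g b) in
/-- Exterior multiplication by the 2-form `(B - Bᵗ)/2`. -/
def lefschetz (B : E →L[ℝ] E →L[ℝ] ℝ) : Module.End ℝ (AllForms E) :=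
  (1 / 2 : ℝ) • ∑ i, eps (g (b i)) * eps (B (b i))

theorem eps_mul_lefschetz (a : E →L[ℝ] ℝ) (B : E →L[ℝ] E →L[ℝ] ℝ) :
    eps a * lefschetz g b B = lefschetz g b B * eps a := by
  rw [lefschetz, mul_smul_comm, smul_mul_assoc, Finset.mul_sum, Finset.sum_mul]
  congr 1
  refine Finset.sum_congr rfl fun i _ => ?_
  rw [← mul_assoc, eps_mul_eps a, neg_mul, mul_assoc, eps_mul_eps a, mul_neg, neg_neg, mul_assoc]

/-- Contraction is an antiderivation, so commuting it past a 2-form leaves the contracted 1-form;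
for skew `B` that is `B v`. -/
theorem iota_mul_lefschetz (hb : IsOrthonormal g b) (hsymm : ∀ v w, g v w = g w v) (v : E)
    (B : E →L[ℝ] E →L[ℝ] ℝ) :
    iota v * lefschetz g b B =
      lefschetz g b B * iota v + (1 / 2 : ℝ) • (eps (B v) - eps (B.flip v)) := by
  have h₁ : ∀ i, iota v * (eps (g (b i)) * eps (B (b i))) =
      eps (g (b i)) * eps (B (b i)) * iota v + g v (b i) • eps (B (b i)) -
        B.flip v (b i) • eps (g (b i)) := by
    intro i
    rw [← mul_assoc, iota_mul_eps, sub_mul, mul_assoc, iota_mul_eps, hsymm (b i) v]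
    simp only [smul_mul_assoc, one_mul, mul_sub, mul_smul_comm, mul_one, mul_assoc,
      ContinuousLinearMap.flip_apply]
    abel
  have h₂ : ∑ i, g v (b i) • eps (B (b i)) = eps (B v) := by
    conv_rhs => rw [← hb.sum_smul v]
    simp
  rw [lefschetz, mul_smul_comm, smul_mul_assoc, Finset.mul_sum, Finset.sum_mul]
  simp_rw [h₁]
  rw [Finset.sum_sub_distrib, Finset.sum_add_distrib, h₂, hb.sum_smul_eps hsymm, ← smul_add,
    add_sub_assoc]

variable (g b) in
/-- The derivation `α ↦ ∑ⱼ α(…, A vⱼ, …)` of the exterior algebra. -/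
def derivation (A : E →L[ℝ] E) : Module.End ℝ (AllForms E) :=
  ∑ l, eps (g (b l) ∘L A) * iota (b l)

theorem derivation_mul_eps (hb : IsOrthonormal g b) (hsymm : ∀ v w, g v w = g w v)
    (A : E →L[ℝ] E) (a : E →L[ℝ] ℝ) :
    derivation g b A * eps a = eps a * derivation g b A + eps (a ∘L A) := by
  have h : ∑ l, a (b l) • eps (g (b l) ∘L A) = eps (a ∘L A) := by
    conv_rhs => rw [← hb.sum_smul_dual hsymm a]
    rw [ContinuousLinearMap.finsetSum_comp, map_sum]
    refine Finset.sum_congr rfl fun l _ => ?_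
    rw [ContinuousLinearMap.smul_comp, map_smul]
  rw [derivation, Finset.sum_mul, Finset.mul_sum, ← h, ← Finset.sum_add_distrib]
  refine Finset.sum_congr rfl fun l _ => ?_
  rw [mul_assoc, iota_mul_eps, mul_sub, mul_smul_comm, mul_one, ← mul_assoc, eps_mul_eps _ a,
    neg_mul, mul_assoc]
  abel

theorem derivation_mul_lefschetz (hb : IsOrthonormal g b) (hsymm : ∀ v w, g v w = g w v)
    (A : E →L[ℝ] E) (B B' : E →L[ℝ] E →L[ℝ] ℝ)
    (hB' : ∀ u v, B' u v = B (A u) v + B u (A v)) :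
    derivation g b A * lefschetz g b B =
      lefschetz g b B * derivation g b A + lefschetz g b B' := by
  have h₁ : ∀ i, derivation g b A * (eps (g (b i)) * eps (B (b i))) =
      eps (g (b i)) * eps (B (b i)) * derivation g b A + (eps (g (b i) ∘L A) * eps (B (b i)) +
        eps (g (b i)) * eps (B (b i) ∘L A)) := by
    intro i
    rw [← mul_assoc, derivation_mul_eps hb hsymm, add_mul, mul_assoc, derivation_mul_eps hb hsymm,
      mul_add, mul_assoc]
    abel
  have h₂ : ∑ i, eps (g (b i) ∘L A) * eps (B (b i)) = ∑ j, eps (g (b j)) * eps (B (A (b j))) := by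
    have e₁ : ∀ i, eps (g (b i) ∘L A) * eps (B (b i)) =
        ∑ j, g (b i) (A (b j)) • (eps (g (b j)) * eps (B (b i))) := by
      intro i
      rw [← hb.sum_smul_eps hsymm (g (b i) ∘L A), Finset.sum_mul]
      simp
    have e₂ : ∀ j, eps (g (b j)) * eps (B (A (b j))) =
        ∑ i, g (b i) (A (b j)) • (eps (g (b j)) * eps (B (b i))) := by
      intro j
      conv_lhs => rw [← hb.sum_smul (A (b j))]
      simp [Finset.mul_sum, hsymm (A (b j))]
    simp_rw [e₁, e₂]
    exact Finset.sum_comm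
  have h₃ : ∀ i, B' (b i) = B (A (b i)) + B (b i) ∘L A := by
    intro i
    ext v
    simp [hB']
  rw [lefschetz, lefschetz, mul_smul_comm, smul_mul_assoc, Finset.mul_sum, Finset.sum_mul]
  simp_rw [h₁, h₃, map_add, mul_add]
  rw [Finset.sum_add_distrib, Finset.sum_add_distrib, Finset.sum_add_distrib, h₂, smul_add]

variable (g b) in
/-- The exterior derivative of a form which is parallel for a connection with connection form `Γ`. -/
def parallelExtDeriv (Γ : E →L[ℝ] E →L[ℝ] E) : Module.End ℝ (AllForms E) :=
  ∑ i, eps (g (b i)) * derivation g b (Γ (b i))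

/-- The exterior derivative of a parallel form only depends on the torsion of the connection. -/
theorem parallelExtDeriv_eq (hb : IsOrthonormal g b) (hsymm : ∀ v w, g v w = g w v)
    (Γ T : E →L[ℝ] E →L[ℝ] E) (hT : ∀ u v, T u v = Γ u v - Γ v u) :
    parallelExtDeriv g b Γ =
      ∑ l, lefschetz g b (ContinuousLinearMap.compL ℝ E E ℝ (g (b l)) ∘L T) * iota (b l) := by
  -- The factor 1/2 in `lefschetz` disappears because `T` is the antisymmetrization of `Γ`, and a
  -- bilinear form and minus its transpose have the same wedge.
  have h : ∀ l, lefschetz g b (ContinuousLinearMap.compL ℝ E E ℝ (g (b l)) ∘L T) =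
      ∑ i, eps (g (b i)) * eps (g (b l) ∘L Γ (b i)) := by
    intro l
    set C := ContinuousLinearMap.compL ℝ E E ℝ (g (b l)) ∘L Γ with hC
    have e : ∀ i, (ContinuousLinearMap.compL ℝ E E ℝ (g (b l)) ∘L T) (b i) =
        C (b i) - C.flip (b i) := by
      intro i
      ext v
      simp [hC, hT]
    have e₂ : ∀ i, C (b i) = g (b l) ∘L Γ (b i) := fun i => rfl
    rw [lefschetz]
    simp_rw [e, map_sub, mul_sub]
    rw [Finset.sum_sub_distrib, hb.sum_eps_mul_eps_flip hsymm]
    simp_rw [e₂]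
    module
  simp_rw [h, parallelExtDeriv, derivation, Finset.mul_sum, Finset.sum_mul]
  rw [Finset.sum_comm]
  simp_rw [mul_assoc]

end Operators

end BismutFlat

namespace BismutFlat

/-! ### Powers of a 2-form -/

section Powers

variable {E : Type*} [NormedAddCommGroup E] [NormedSpace ℝ E]
  {ι : Type*} [Fintype ι] [DecidableEq ι]
  {g : E →L[ℝ] E →L[ℝ] ℝ} {b : Module.Basis ι ℝ E}

theorem eq_zero_of_card_lt (b : Module.Basis ι ℝ E) {k : ℕ} (hk : Fintype.card ι < k)
    (α : E [⋀^Fin k]→L[ℝ] ℝ) : α = 0 := by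
  ext v
  refine α.toAlternatingMap.map_linearDependent v fun h => ?_
  have := b.finiteDimensional_of_finite
  have h₁ := h.fintype_card_le_finrank
  rw [Module.finrank_eq_card_basis b, Fintype.card_fin] at h₁
  omega

/-- Wedging after contracting, summed over a basis, counts the degree: it is `alternatizeUncurryFin`
of the curried form. -/
theorem IsOrthonormal.sum_eps_iota_single (hb : IsOrthonormal g b)
    (hsymm : ∀ v w, g v w = g w v) (k : ℕ) (α : E [⋀^Fin k]→L[ℝ] ℝ) :
    ∑ i, eps (g (b i)) (iota (b i) (single k α)) = (k : ℝ) • single k α := by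
  cases k with
  | zero => simp [iota_single_zero]
  | succ k =>
    simp_rw [iota_single_succ, eps_single]
    rw [← map_sum, ← map_smul]
    congr 1
    have h : ∑ i, wedgeL k (g (b i)) (α.curryLeft (b i)) =
        ContinuousAlternatingMap.alternatizeUncurryFin α.curryLeft := by
      simp_rw [wedgeL_eq, ← ContinuousAlternatingMap.alternatizeUncurryFinCLM_apply]
      rw [← map_sum]
      congr 1
      ext1 v
      rw [sum_apply]
      conv_rhs => rw [← hb.sum_smul v, map_sum]
      refine Finset.sum_congr rfl fun i _ => ?_
      rw [ContinuousLinearMap.smulRight_apply, map_smul, hsymm]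
    rw [h, ContinuousAlternatingMap.alternatizeUncurryFin_curryLeft, ← Nat.cast_smul_eq_nsmul ℝ]

theorem IsOrthonormal.sum_iota_eps_single (hb : IsOrthonormal g b)
    (hsymm : ∀ v w, g v w = g w v) (k : ℕ) (α : E [⋀^Fin k]→L[ℝ] ℝ) :
    ∑ i, iota (b i) (eps (g (b i)) (single k α)) = ((Fintype.card ι : ℝ) - k) • single k α := by
  have h : ∀ i, iota (b i) (eps (g (b i)) (single k α)) =
      single k α - eps (g (b i)) (iota (b i) (single k α)) := by
    intro i
    have := DFunLike.congr_fun (iota_mul_eps (b i) (g (b i))) (single k α)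
    rw [hb i i, if_pos rfl, one_smul] at this
    exact this
  simp_rw [h]
  rw [Finset.sum_sub_distrib, hb.sum_eps_iota_single hsymm, sub_smul, Finset.sum_const,
    Finset.card_univ, Nat.cast_smul_eq_nsmul, Nat.cast_smul_eq_nsmul]

/-- Summation over permutations of `Fin (k + 1)` by the value at `0`. -/
theorem sum_perm_fin_succ {k : ℕ} (F : Equiv.Perm (Fin (k + 1)) → ℝ) :
    ∑ σ, F σ = ∑ p, ∑ τ, F ((Fin.cycleRange p).symm * Equiv.Perm.decomposeFin.symm (0, τ)) := by
  rw [← Fintype.sum_prod_type' fun p τ =>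
    F ((Fin.cycleRange p).symm * Equiv.Perm.decomposeFin.symm (0, τ))]
  symm
  refine Fintype.sum_bijective (fun x : Fin (k + 1) × Equiv.Perm (Fin k) =>
    (Fin.cycleRange x.1).symm * Equiv.Perm.decomposeFin.symm (0, x.2)) ?_ _ _ fun _ => rfl
  rw [Fintype.bijective_iff_injective_and_card]
  constructor
  · rintro ⟨p, τ⟩ ⟨q, υ⟩ h
    have hp : p = q := by
      have := DFunLike.congr_fun h 0
      simpa using this
    subst hp
    simpa using h
  · simp [Fintype.card_perm, Nat.factorial_succ]

theorem sum_perm_sign_fin_succ {k : ℕ} (F : (Fin (k + 1) → E) → ℝ) (v : Fin (k + 1) → E) :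
    ∑ σ : Equiv.Perm (Fin (k + 1)), ((Equiv.Perm.sign σ : ℤ) : ℝ) * F (v ∘ σ) =
      ∑ p : Fin (k + 1), (-1) ^ (p : ℕ) * ∑ τ : Equiv.Perm (Fin k),
        ((Equiv.Perm.sign τ : ℤ) : ℝ) * F (Matrix.vecCons (v p) (p.removeNth v ∘ τ)) := by
  rw [sum_perm_fin_succ]
  refine Finset.sum_congr rfl fun p _ => ?_
  rw [Finset.mul_sum]
  refine Finset.sum_congr rfl fun τ _ => ?_
  have h : v ∘ ((Fin.cycleRange p).symm * Equiv.Perm.decomposeFin.symm (0, τ)) =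
      Matrix.vecCons (v p) (p.removeNth v ∘ τ) := by
    funext i
    refine Fin.cases ?_ (fun i => ?_) i
    · simp
    · simp [Fin.removeNth]
  rw [h, Equiv.Perm.sign_mul, Equiv.Perm.decomposeFin.symm_sign, Equiv.Perm.sign_symm,
    Fin.sign_cycleRange]
  simp [mul_assoc]

theorem alternatization_pairProd_apply (B : E →L[ℝ] E →L[ℝ] ℝ) (k : ℕ) (v : Fin (2 * k) → E) :
    (pairProd B k).alternatization v = ∑ σ : Equiv.Perm (Fin (2 * k)),
      ((Equiv.Perm.sign σ : ℤ) : ℝ) * pairProd B k (v ∘ σ) := by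
  rw [ContinuousMultilinearMap.alternatization_apply_apply]
  refine Finset.sum_congr rfl fun σ _ => ?_
  rw [Units.smul_def, zsmul_eq_mul]

/-- Expand along the first two positions, one at a time. The result has the shape of a wedge of a
2-form with the remaining alternatization, ready for comparison with `sum_wedgeL_wedgeL_apply`. -/
theorem alternatization_pairProd_succ (B : E →L[ℝ] E →L[ℝ] ℝ) (k : ℕ)
    (v : Fin (2 * k + 1 + 1) → E) :
    (pairProd B (k + 1)).alternatization v =
      ∑ p : Fin (2 * k + 1 + 1), (-1) ^ (p : ℕ) * ∑ q : Fin (2 * k + 1), (-1) ^ (q : ℕ) *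
        (B (v p) (p.removeNth v q) * (pairProd B k).alternatization (q.removeNth (p.removeNth v))) := by
  rw [alternatization_pairProd_apply]
  refine (sum_perm_sign_fin_succ (k := 2 * k + 1) (pairProd B (k + 1)) v).trans ?_
  refine Finset.sum_congr rfl fun p _ => ?_
  congr 1
  refine (sum_perm_sign_fin_succ (k := 2 * k)
    (fun w => pairProd B (k + 1) (Matrix.vecCons (v p) w)) (p.removeNth v)).trans ?_
  refine Finset.sum_congr rfl fun q _ => ?_
  congr 1
  rw [alternatization_pairProd_apply, Finset.mul_sum]
  refine Finset.sum_congr rfl fun τ _ => ?_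
  change _ * (B (v p) (p.removeNth v q) * pairProd B k (q.removeNth (p.removeNth v) ∘ τ)) = _
  ring

theorem sum_wedgeL_wedgeL_apply (hb : IsOrthonormal g b) (hsymm : ∀ v w, g v w = g w v)
    (B : E →L[ℝ] E →L[ℝ] ℝ) {k : ℕ} (α : E [⋀^Fin k]→L[ℝ] ℝ) (v : Fin (k + 1 + 1) → E) :
    (∑ i, wedgeL (k + 1) (g (b i)) (wedgeL k (B (b i)) α)) v =
      ∑ p : Fin (k + 1 + 1), (-1) ^ (p : ℕ) * ∑ q : Fin (k + 1), (-1) ^ (q : ℕ) *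
        (B (v p) (p.removeNth v q) * α (q.removeNth (p.removeNth v))) := by
  rw [ContinuousAlternatingMap.sum_apply]
  simp_rw [wedgeL_apply]
  rw [Finset.sum_comm]
  refine Finset.sum_congr rfl fun p _ => ?_
  rw [← Finset.mul_sum]
  congr 1
  simp_rw [Finset.mul_sum]
  rw [Finset.sum_comm]
  refine Finset.sum_congr rfl fun q _ => ?_
  conv_rhs => rw [← hb.sum_smul (v p), map_sum, sum_apply, Finset.sum_mul, Finset.mul_sum]
  refine Finset.sum_congr rfl fun i _ => ?_
  rw [map_smul, _root_.smul_apply, smul_eq_mul, hsymm]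
  ring

/-- `B^k` as a family of forms. -/
def powForm (B : E →L[ℝ] E →L[ℝ] ℝ) (k : ℕ) : AllForms E := single (2 * k) (wedgePow B k)

/-- The explicit permutation sum is an iterated wedge product. The factor 1/2 in `lefschetz`
accounts for the passage from `2^{-k}` to `2^{-(k+1)}`. -/
theorem powForm_succ (hb : IsOrthonormal g b) (hsymm : ∀ v w, g v w = g w v)
    (B : E →L[ℝ] E →L[ℝ] ℝ) (k : ℕ) :
    powForm B (k + 1) = lefschetz g b B (powForm B k) := by
  have h : lefschetz g b B (powForm B k) = single (2 * k + 1 + 1)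
      ((1 / 2 : ℝ) • ∑ i, wedgeL (2 * k + 1) (g (b i)) (wedgeL (2 * k) (B (b i)) (wedgePow B k))) := by
    rw [lefschetz, LinearMap.smul_apply, LinearMap.sum_apply, map_smul, map_sum]
    congr 1
    refine Finset.sum_congr rfl fun i _ => ?_
    rw [powForm, Module.End.mul_apply, eps_single, eps_single]
  rw [h, powForm]
  refine congrArg (single (2 * k + 1 + 1)) ?_
  ext v
  refine Eq.trans ?_ (congrArg ((1 / 2 : ℝ) * ·)
    (sum_wedgeL_wedgeL_apply hb hsymm B (wedgePow B k) v).symm)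
  change 1 / 2 ^ (k + 1) * (pairProd B (k + 1)).alternatization v = 1 / 2 * _
  rw [alternatization_pairProd_succ, Finset.mul_sum, Finset.mul_sum]
  refine Finset.sum_congr rfl fun p _ => ?_
  rw [mul_left_comm, mul_left_comm (1 / 2 : ℝ)]
  refine congrArg ((-1 : ℝ) ^ (p : ℕ) * ·) ?_
  rw [Finset.mul_sum, Finset.mul_sum]
  refine Finset.sum_congr rfl fun q _ => ?_
  rw [wedgePow, ContinuousAlternatingMap.smul_apply, smul_eq_mul, pow_succ]
  field_simp

theorem wedgePow_zero_ne_zero (B : E →L[ℝ] E →L[ℝ] ℝ) : wedgePow B 0 ≠ 0 := by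
  intro h
  have := congrArg (fun α => α 0) h
  rw [wedgePow_apply] at this
  simp at this

theorem iota_powForm_zero (B : E →L[ℝ] E →L[ℝ] ℝ) (v : E) : iota v (powForm B 0) = 0 :=
  iota_single_zero v _

theorem eps_lefschetz (a : E →L[ℝ] ℝ) (B : E →L[ℝ] E →L[ℝ] ℝ) (α : AllForms E) :
    eps a (lefschetz g b B α) = lefschetz g b B (eps a α) :=
  DFunLike.congr_fun (eps_mul_lefschetz a B) α

theorem iota_powForm_succ (hb : IsOrthonormal g b) (hsymm : ∀ v w, g v w = g w v)
    {B : E →L[ℝ] E →L[ℝ] ℝ} (hB : ∀ v w, B v w = -B w v) (v : E) (k : ℕ) :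
    iota v (powForm B (k + 1)) = ((k : ℝ) + 1) • eps (B v) (powForm B k) := by
  have hL : ∀ α, iota v (lefschetz g b B α) = lefschetz g b B (iota v α) + eps (B v) α := by
    intro α
    have h := DFunLike.congr_fun (iota_mul_lefschetz hb hsymm v B) α
    have h' : B.flip v = -B v := by
      ext w
      rw [ContinuousLinearMap.flip_apply, _root_.neg_apply, hB]
    rw [h', map_neg, sub_neg_eq_add, ← two_smul ℝ (eps (B v)), smul_smul] at h
    norm_num at h
    exact h
  induction k with
  | zero =>
    rw [powForm_succ hb hsymm, hL, iota_powForm_zero]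
    simp
  | succ k ih =>
    rw [powForm_succ hb hsymm, hL, ih, map_smul, ← eps_lefschetz, ← powForm_succ hb hsymm]
    push_cast
    module

/-- If `B^{k+1}` vanished, contracting it would give `a ∧ B^k = 0` for every 1-form `a`, as `B` is
nondegenerate. Then `sum_iota_eps_single` kills `B^k`, since its degree is below the dimension. -/
theorem powForm_ne_zero (hb : IsOrthonormal g b) (hsymm : ∀ v w, g v w = g w v)
    {B : E →L[ℝ] E →L[ℝ] ℝ} (hB : ∀ v w, B v w = -B w v) (hsurj : ∀ v, ∃ w, B w = g v)
    {k : ℕ} (hk : 2 * k ≤ Fintype.card ι) : powForm B k ≠ 0 := by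
  induction k with
  | zero =>
    intro h
    refine wedgePow_zero_ne_zero B (single_injective (2 * 0) ?_)
    rw [map_zero]
    exact h
  | succ k ih =>
    intro h
    refine ih (by omega) ?_
    have h₁ : ∀ v, eps (g v) (powForm B k) = 0 := by
      intro v
      obtain ⟨w, hw⟩ := hsurj v
      have := iota_powForm_succ hb hsymm hB w k
      rw [h, map_zero, hw] at this
      exact (smul_eq_zero.mp this.symm).resolve_left (by positivity)
    have h₂ := hb.sum_iota_eps_single hsymm (2 * k) (wedgePow B k)
    have h₃ : ((Fintype.card ι : ℝ) - (2 * k : ℕ)) ≠ 0 := by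
      rw [sub_ne_zero]
      exact_mod_cast (by omega : Fintype.card ι ≠ 2 * k)
    refine (smul_eq_zero.mp (h₂.symm.trans ?_)).resolve_left h₃
    refine Finset.sum_eq_zero fun i _ => ?_
    rw [show single (2 * k) (wedgePow B k) = powForm B k from rfl, h₁, map_zero]

theorem eps_powForm_top (b : Module.Basis ι ℝ E) {n : ℕ} (hn : Fintype.card ι = 2 * n)
    (a : E →L[ℝ] ℝ) (B : E →L[ℝ] E →L[ℝ] ℝ) : eps a (powForm B n) = 0 := by
  rw [powForm, eps_single, eq_zero_of_card_lt b (by omega) (wedgeL _ _ _), map_zero]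

/-- Contract `a ∧ B^n = 0`, which holds because its degree exceeds the dimension. -/
theorem eps_iota_powForm_top (b : Module.Basis ι ℝ E) {n : ℕ} (hn : Fintype.card ι = 2 * n)
    (a : E →L[ℝ] ℝ) (v : E) (B : E →L[ℝ] E →L[ℝ] ℝ) :
    eps a (iota v (powForm B n)) = a v • powForm B n := by
  have h := DFunLike.congr_fun (iota_mul_eps v a) (powForm B n)
  rw [Module.End.mul_apply, eps_powForm_top b hn, map_zero] at h
  exact (sub_eq_zero.mp h.symm).symm

theorem eq_zero_of_iota_powForm_top (hb : IsOrthonormal g b) (hsymm : ∀ v w, g v w = g w v)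
    (hpos : ∀ v, v ≠ 0 → 0 < g v v)
    {B : E →L[ℝ] E →L[ℝ] ℝ} (hB : ∀ v w, B v w = -B w v) (hsurj : ∀ v, ∃ w, B w = g v)
    {n : ℕ} (hn : Fintype.card ι = 2 * n) {v : E} (hv : iota v (powForm B n) = 0) : v = 0 := by
  by_contra h
  have h₁ := eps_iota_powForm_top b hn (g v) v B
  rw [hv, map_zero] at h₁
  exact (smul_ne_zero (hpos v h).ne' (powForm_ne_zero hb hsymm hB hsurj hn.ge)) h₁.symm

end Powers

/-! ### The exterior derivative of powers of the Kähler form -/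

section Hermitian

variable {E : Type*} [NormedAddCommGroup E] [NormedSpace ℝ E]
  {ι : Type*} [Fintype ι] [DecidableEq ι]
  {g : E →L[ℝ] E →L[ℝ] ℝ} {b : Module.Basis ι ℝ E}
  {J : E →L[ℝ] E} {T : E →L[ℝ] E →L[ℝ] E}

theorem kahler_swap (hsymm : ∀ v w, g v w = g w v) (hJ : ∀ v, J (J v) = -v)
    (hgJ : ∀ v w, g (J v) (J w) = g v w) (v w : E) : (g ∘L J) v w = -(g ∘L J) w v := by
  change g (J v) w = -g (J w) v
  rw [inner_J_left hJ hgJ, hsymm]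

theorem kahler_surjective (hJ : ∀ v, J (J v) = -v) (v : E) : ∃ w, (g ∘L J) w = g v :=
  ⟨-J v, by rw [ContinuousLinearMap.comp_apply, map_neg, hJ, neg_neg]⟩

/-- For totally skew T, contracting the 2-form `g(v, T(·,·))` with the same `v` gives zero. This is
where skew torsion matters for closedness: in the formula for d the contraction can be moved to the
outside. -/
theorem lefschetz_mul_iota (hb : IsOrthonormal g b) (hsymm : ∀ v w, g v w = g w v)
    (hT : IsSkew g T) (v : E) :
    lefschetz g b (ContinuousLinearMap.compL ℝ E E ℝ (g v) ∘L T) * iota v =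
      iota v * lefschetz g b (ContinuousLinearMap.compL ℝ E E ℝ (g v) ∘L T) := by
  set C := ContinuousLinearMap.compL ℝ E E ℝ (g v) ∘L T
  have hC : ∀ u w, C u w = g v (T u w) := fun u w => rfl
  have h₁ : C v = 0 := by
    ext w
    rw [hC, hsymm, hT.swap, map_neg, _root_.neg_apply, hT.self, neg_zero, zero_apply]
  have h₂ : C.flip v = 0 := by
    ext w
    rw [ContinuousLinearMap.flip_apply, hC, hsymm, hT.self, zero_apply]
  rw [iota_mul_lefschetz hb hsymm, h₁, h₂, sub_self, smul_zero, add_zero]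

/-- The exterior derivative of `ω^(n-1)` is the exterior product of `ω^(n-1)` with the trace of the
torsion. -/
theorem parallelExtDeriv_powForm (hb : IsOrthonormal g b) (hsymm : ∀ v w, g v w = g w v)
    (hJ : ∀ v, J (J v) = -v) (hgJ : ∀ v w, g (J v) (J w) = g v w) (hT : IsSkew g T)
    {Γ : E →L[ℝ] E →L[ℝ] E} (hΓ : ∀ u v, T u v = Γ u v - Γ v u)
    {k : ℕ} (hk : Fintype.card ι = 2 * (k + 1)) :
    parallelExtDeriv g b Γ (powForm (g ∘L J) k) =
      eps ((g ∘L J) (traceVec b J T)) (powForm (g ∘L J) k) := by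
  have hB := kahler_swap hsymm hJ hgJ
  have hk' : (k : ℝ) + 1 ≠ 0 := by positivity
  refine smul_right_injective _ hk' ?_
  change ((k : ℝ) + 1) • _ = ((k : ℝ) + 1) • _
  rw [← iota_powForm_succ hb hsymm hB, parallelExtDeriv_eq hb hsymm Γ T hΓ, LinearMap.sum_apply,
    ← hb.sum_smul_iota (traceVec b J T), LinearMap.sum_apply, Finset.smul_sum]
  refine Finset.sum_congr rfl fun l _ => ?_
  rw [lefschetz_mul_iota hb hsymm hT, Module.End.mul_apply, LinearMap.smul_apply]
  -- The 1-form `g(b l, T(b i, ·))` is `ω(w, ·)` with `w = -J T(b l, b i)`. Its wedge with `(k+1)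
  -- ω^k` is `ι_w ω^{k+1}`, and wedging with `g (b i)` returns a multiple of the top form.
  have h : ∀ i, ((k : ℝ) + 1) • (eps (g (b i)) * eps ((ContinuousLinearMap.compL ℝ E E ℝ (g (b l)) ∘L T)
      (b i))) (powForm (g ∘L J) k) =
        g (T (b i) (J (b i))) (b l) • powForm (g ∘L J) (k + 1) := by
    intro i
    have e : (ContinuousLinearMap.compL ℝ E E ℝ (g (b l)) ∘L T) (b i) =
        (g ∘L J) (-J (T (b l) (b i))) := by
      ext w
      change g (b l) (T (b i) w) = g (J (-J (T (b l) (b i)))) w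
      rw [map_neg J, hJ, neg_neg, hT.rotate, hsymm]
    rw [e, Module.End.mul_apply, ← map_smul, ← iota_powForm_succ hb hsymm hB,
      eps_iota_powForm_top b hk, map_neg, hsymm, inner_J_left hJ hgJ, neg_neg, hT.rotate]
  have h' : ((k : ℝ) + 1) • lefschetz g b (ContinuousLinearMap.compL ℝ E E ℝ (g (b l)) ∘L T)
      (powForm (g ∘L J) k) = g (traceVec b J T) (b l) • powForm (g ∘L J) (k + 1) := by
    rw [lefschetz, LinearMap.smul_apply, LinearMap.sum_apply, smul_comm, Finset.smul_sum,
      Finset.sum_congr rfl fun i _ => h i, ← Finset.sum_smul, smul_smul, inner_traceVec_left]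
  rw [← map_smul, h', map_smul]

end Hermitian

end BismutFlat

namespace BismutFlat

/-! ### Parallel differential forms -/

section Parallel

variable {E : Type*} [NormedAddCommGroup E] [NormedSpace ℝ E]
  {ι : Type*} [Fintype ι] [DecidableEq ι]
  {g : E →L[ℝ] E →L[ℝ] ℝ} {b : Module.Basis ι ℝ E}

theorem wedgePow_succ (hb : IsOrthonormal g b) (hsymm : ∀ v w, g v w = g w v)
    (B : E →L[ℝ] E →L[ℝ] ℝ) (k : ℕ) :
    (wedgePow B (k + 1) : E [⋀^Fin (2 * k + 1 + 1)]→L[ℝ] ℝ) =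
      (1 / 2 : ℝ) • ∑ i, wedgeL (2 * k + 1) (g (b i)) (wedgeL (2 * k) (B (b i)) (wedgePow B k)) := by
  refine single_injective (2 * k + 1 + 1) ((powForm_succ hb hsymm B k).trans ?_)
  rw [lefschetz, LinearMap.smul_apply, LinearMap.sum_apply, map_smul, map_sum]
  congr 1
  refine Finset.sum_congr rfl fun i _ => ?_
  rw [powForm, Module.End.mul_apply, eps_single, eps_single]

theorem lefschetz_single (B : E →L[ℝ] E →L[ℝ] ℝ) {k : ℕ} (α : E [⋀^Fin k]→L[ℝ] ℝ) :
    lefschetz g b B (single k α) = single (k + 1 + 1)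
      ((1 / 2 : ℝ) • ∑ i, wedgeL (k + 1) (g (b i)) (wedgeL k (B (b i)) α)) := by
  rw [lefschetz, LinearMap.smul_apply, LinearMap.sum_apply, map_smul, map_sum]
  congr 1
  refine Finset.sum_congr rfl fun i _ => ?_
  rw [Module.End.mul_apply, eps_single, eps_single]

variable (g b) in
/-- The form `α` is parallel at `y` for the connection with connection form `Γ`. -/
def IsParallelAt (Γ : E →L[ℝ] E →L[ℝ] E) {k : ℕ} (α : E → E [⋀^Fin k]→L[ℝ] ℝ) (y : E) : Prop :=
  ∃ D : E →L[ℝ] E [⋀^Fin k]→L[ℝ] ℝ, HasFDerivAt α D y ∧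
    ∀ u, single k (D u) = derivation g b (Γ u) (single k (α y))

variable {Γ : E →L[ℝ] E →L[ℝ] E} {y : E}

theorem exists_hasFDerivAt_wedgeL {a : E → E →L[ℝ] ℝ} {a' : E →L[ℝ] E →L[ℝ] ℝ}
    (ha : HasFDerivAt a a' y) {k : ℕ} {α : E → E [⋀^Fin k]→L[ℝ] ℝ}
    {D : E →L[ℝ] E [⋀^Fin k]→L[ℝ] ℝ} (hD : HasFDerivAt α D y) :
    ∃ D' : E →L[ℝ] E [⋀^Fin (k + 1)]→L[ℝ] ℝ, HasFDerivAt (fun z => wedgeL k (a z) (α z)) D' y ∧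
      ∀ u, D' u = wedgeL k (a y) (D u) + wedgeL k (a' u) (α y) :=
  ⟨_, (wedgeL k).hasFDerivAt_of_bilinear ha hD, fun _ => rfl⟩

variable (g b) in
theorem exists_hasFDerivAt_lefschetz
    {B : E → E →L[ℝ] E →L[ℝ] ℝ} {B' : E →L[ℝ] E →L[ℝ] E →L[ℝ] ℝ} (hB : HasFDerivAt B B' y)
    {k : ℕ} {α : E → E [⋀^Fin k]→L[ℝ] ℝ}
    {D : E →L[ℝ] E [⋀^Fin k]→L[ℝ] ℝ} (hD : HasFDerivAt α D y) :
    ∃ D' : E →L[ℝ] E [⋀^Fin (k + 1 + 1)]→L[ℝ] ℝ,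
      HasFDerivAt (fun z => (1 / 2 : ℝ) • ∑ i, wedgeL (k + 1) (g (b i)) (wedgeL k (B z (b i)) (α z)))
        D' y ∧
      ∀ u, single (k + 1 + 1) (D' u) =
        lefschetz g b (B y) (single k (D u)) + lefschetz g b (B' u) (single k (α y)) := by
  have h₁ : ∀ i, HasFDerivAt (fun z => B z (b i)) (B'.flip (b i)) y := fun i => by
    have := hB.clm_apply (hasFDerivAt_const (b i) y)
    rwa [ContinuousLinearMap.comp_zero, zero_add] at this
  choose D₁ hD₁ hD₁' using fun i => exists_hasFDerivAt_wedgeL (h₁ i) hD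
  choose D₂ hD₂ hD₂' using fun i => exists_hasFDerivAt_wedgeL (hasFDerivAt_const (g (b i)) y) (hD₁ i)
  refine ⟨(1 / 2 : ℝ) • ∑ i, D₂ i, (HasFDerivAt.fun_sum fun i _ => hD₂ i).fun_const_smul _, fun u => ?_⟩
  rw [lefschetz_single, lefschetz_single, ← map_add, ← smul_add, ← Finset.sum_add_distrib,
    _root_.smul_apply, sum_apply]
  congr 2
  refine Finset.sum_congr rfl fun i _ => ?_
  rw [hD₂', hD₁', zero_apply, map_zero, zero_apply, add_zero, map_add]
  rfl

/-- The connection acts on forms as a derivation, so parallelism passes from `B` to its powers by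
the product rule; `hB'` is the equation `∇B = 0`. -/
theorem isParallelAt_wedgePow (hb : IsOrthonormal g b) (hsymm : ∀ v w, g v w = g w v)
    {B : E → E →L[ℝ] E →L[ℝ] ℝ} {B' : E →L[ℝ] E →L[ℝ] E →L[ℝ] ℝ} (hB : HasFDerivAt B B' y)
    (hB' : ∀ u v w, B' u v w = B y (Γ u v) w + B y v (Γ u w)) (k : ℕ) :
    IsParallelAt g b Γ (fun z => wedgePow (B z) k) y := by
  induction k with
  | zero =>
    refine ⟨0, ?_, fun u => ?_⟩
    · have : (fun z => wedgePow (B z) 0) = fun _ => wedgePow (B y) 0 := by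
        funext z
        ext v
        rw [wedgePow_apply, wedgePow_apply]
        rfl
      rw [this]
      exact hasFDerivAt_const _ _
    · rw [derivation, LinearMap.sum_apply, zero_apply, map_zero]
      refine (Finset.sum_eq_zero fun l _ => ?_).symm
      rw [Module.End.mul_apply]
      exact (congrArg _ (iota_single_zero _ _)).trans (map_zero _)
  | succ k ih =>
    obtain ⟨D, hD, hD'⟩ := ih
    obtain ⟨D', h, h'⟩ := exists_hasFDerivAt_lefschetz g b hB hD
    have e : (fun z => wedgePow (B z) (k + 1)) = fun z => ((1 / 2 : ℝ) • ∑ i,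
        wedgeL (2 * k + 1) (g (b i)) (wedgeL (2 * k) (B z (b i)) (wedgePow (B z) k)) :
          E [⋀^Fin (2 * k + 1 + 1)]→L[ℝ] ℝ) :=
      funext fun z => wedgePow_succ hb hsymm (B z) k
    refine ⟨D', ?_, fun u => (h' u).trans ?_⟩
    · rw [e]
      exact h
    · have h₁ := DFunLike.congr_fun (derivation_mul_lefschetz hb hsymm (Γ u) (B y) (B' u) (hB' u))
        (single (2 * k) (wedgePow (B y) k))
      have h₂ : single (2 * (k + 1)) (wedgePow (B y) (k + 1)) = lefschetz g b (B y) (single (2 * k) (wedgePow (B y) k)) :=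
        powForm_succ hb hsymm (B y) k
      rw [h₂, hD']
      exact h₁.symm

theorem IsParallelAt.wedge {a : E → E →L[ℝ] ℝ} {a' : E →L[ℝ] E →L[ℝ] ℝ} (ha : HasFDerivAt a a' y)
    (hb : IsOrthonormal g b) (hsymm : ∀ v w, g v w = g w v)
    (ha' : ∀ u v, a' u v = a y (Γ u v)) {k : ℕ} {α : E → E [⋀^Fin k]→L[ℝ] ℝ}
    (hα : IsParallelAt g b Γ α y) : IsParallelAt g b Γ (fun z => wedgeL k (a z) (α z)) y := by
  obtain ⟨D, hD, hD'⟩ := hα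
  obtain ⟨D', h, h'⟩ := exists_hasFDerivAt_wedgeL ha hD
  refine ⟨D', h, fun u => ?_⟩
  have h₁ := DFunLike.congr_fun (derivation_mul_eps hb hsymm (Γ u) (a y)) (single k (α y))
  have e : a y ∘L Γ u = a' u := by
    ext v
    exact (ha' u v).symm
  rw [← eps_single, h', map_add, ← eps_single, ← eps_single, hD', ← e]
  exact h₁.symm

theorem extDeriv_eq_sum_wedgeL (hb : IsOrthonormal g b) (hsymm : ∀ v w, g v w = g w v) {k : ℕ}
    (α : E → E [⋀^Fin k]→L[ℝ] ℝ) :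
    extDeriv α y = ∑ i, wedgeL k (g (b i)) (fderiv ℝ α y (b i)) := by
  simp_rw [extDeriv, wedgeL_eq, ← ContinuousAlternatingMap.alternatizeUncurryFinCLM_apply]
  rw [← map_sum]
  congr 1
  ext1 v
  rw [sum_apply]
  conv_lhs => rw [← hb.sum_smul v, map_sum]
  refine Finset.sum_congr rfl fun i _ => ?_
  rw [ContinuousLinearMap.smulRight_apply, map_smul, hsymm]

theorem IsParallelAt.single_extDeriv (hb : IsOrthonormal g b) (hsymm : ∀ v w, g v w = g w v)
    {k : ℕ} {α : E → E [⋀^Fin k]→L[ℝ] ℝ} (hα : IsParallelAt g b Γ α y) :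
    single (k + 1) (extDeriv α y) = parallelExtDeriv g b Γ (single k (α y)) := by
  obtain ⟨D, hD, hD'⟩ := hα
  rw [extDeriv_eq_sum_wedgeL hb hsymm, hD.fderiv, parallelExtDeriv, LinearMap.sum_apply, map_sum]
  refine Finset.sum_congr rfl fun i _ => ?_
  rw [Module.End.mul_apply, ← hD', eps_single]

/-- A parallel form is closed if the torsion vanishes. -/
theorem IsParallelAt.extDeriv_eq_zero_of_torsion (hb : IsOrthonormal g b)
    (hsymm : ∀ v w, g v w = g w v) {k : ℕ} {α : E → E [⋀^Fin k]→L[ℝ] ℝ}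
    (hα : IsParallelAt g b Γ α y) (hΓ : ∀ u v, Γ u v = Γ v u) : extDeriv α y = 0 := by
  refine single_injective (k + 1) ?_
  rw [hα.single_extDeriv hb hsymm, parallelExtDeriv_eq hb hsymm Γ 0 (fun u v => by
    rw [hΓ u v, sub_self]; rfl), map_zero, LinearMap.sum_apply]
  refine Finset.sum_eq_zero fun l _ => ?_
  rw [ContinuousLinearMap.comp_zero, lefschetz]
  simp

/-- A parallel form of codegree one is closed if the torsion is totally skew-symmetric. -/
theorem IsParallelAt.extDeriv_eq_zero_of_card (hb : IsOrthonormal g b)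
    (hsymm : ∀ v w, g v w = g w v) {k : ℕ} {α : E → E [⋀^Fin k]→L[ℝ] ℝ}
    (hα : IsParallelAt g b Γ α y) {T : E →L[ℝ] E →L[ℝ] E} (hΓ : ∀ u v, T u v = Γ u v - Γ v u)
    (hT : IsSkew g T) (hk : Fintype.card ι = k + 1) : extDeriv α y = 0 := by
  refine single_injective (k + 1) ?_
  rw [hα.single_extDeriv hb hsymm, parallelExtDeriv_eq hb hsymm Γ T hΓ, map_zero,
    LinearMap.sum_apply]
  refine Finset.sum_eq_zero fun l _ => ?_
  -- With the contraction outside, the torsion 2-form is wedged first and raises the degree to one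
  -- more than the dimension.
  rw [lefschetz_mul_iota hb hsymm hT, Module.End.mul_apply, lefschetz_single,
    eq_zero_of_card_lt b (by omega) (_ • _), map_zero, map_zero]

end Parallel

end BismutFlat

namespace BismutFlat

/-! ### Metric connections with skew torsion in a chart -/

section Chart

variable {E : Type*} [NormedAddCommGroup E] [NormedSpace ℝ E]

theorem fderiv_clm_apply_apply {F H : Type*} [NormedAddCommGroup F] [NormedSpace ℝ F]
    [NormedAddCommGroup H] [NormedSpace ℝ H] {c : E → F →L[ℝ] H} {f : E → F} {y : E}
    (hc : DifferentiableAt ℝ c y) (hf : DifferentiableAt ℝ f y) (u : E) :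
    fderiv ℝ (fun z => c z (f z)) y u = fderiv ℝ c y u (f y) + c y (fderiv ℝ f y u) := by
  rw [fderiv_clm_apply hc hf, add_comm]
  rfl

theorem fderiv_clm_apply_const {F H : Type*} [NormedAddCommGroup F] [NormedSpace ℝ F]
    [NormedAddCommGroup H] [NormedSpace ℝ H] {c : E → F →L[ℝ] H} {y : E}
    (hc : DifferentiableAt ℝ c y) (v : F) (u : E) :
    fderiv ℝ (fun z => c z v) y u = fderiv ℝ c y u v := by
  rw [fderiv_clm_apply_apply hc (differentiableAt_const v)]
  simp

theorem fderiv_clm_apply_const₂ {F F' H : Type*} [NormedAddCommGroup F] [NormedSpace ℝ F]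
    [NormedAddCommGroup F'] [NormedSpace ℝ F']
    [NormedAddCommGroup H] [NormedSpace ℝ H] {c : E → F →L[ℝ] F' →L[ℝ] H} {y : E}
    (hc : DifferentiableAt ℝ c y) (v : F) (w : F') (u : E) :
    fderiv ℝ (fun z => c z v w) y u = fderiv ℝ c y u v w := by
  rw [fderiv_clm_apply_const (c := fun z => c z v) (hc.clm_apply (differentiableAt_const v)),
    fderiv_clm_apply_const hc]

/-- The torsion of a connection with connection form `Γ`. -/
def tors (Γ : E →L[ℝ] E →L[ℝ] E) : E →L[ℝ] E →L[ℝ] E := Γ - Γ.flip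

theorem tors_apply (Γ : E →L[ℝ] E →L[ℝ] E) (u v : E) : tors Γ u v = Γ u v - Γ v u := rfl

/-- `Γ` is the connection form of a Hermitian connection with totally skew-symmetric torsion. -/
structure IsBismutChart (U : Set E) (G : E → E →L[ℝ] E →L[ℝ] ℝ) (J : E →L[ℝ] E)
    (Γ : E → E →L[ℝ] E →L[ℝ] E) : Prop where
  isOpen : IsOpen U
  contDiffOn_metric : ContDiffOn ℝ ∞ G U
  symm : ∀ y ∈ U, ∀ v w, G y v w = G y w v
  pos : ∀ y ∈ U, ∀ v, v ≠ 0 → 0 < G y v v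
  sq : ∀ v, J (J v) = -v
  hermitian : ∀ y ∈ U, ∀ v w, G y (J v) (J w) = G y v w
  metric : ∀ y ∈ U, ∀ u v w, fderiv ℝ G y u v w = G y (Γ y u v) w + G y v (Γ y u w)
  complex : ∀ y ∈ U, ∀ u v, Γ y u (J v) = J (Γ y u v)
  skew : ∀ y ∈ U, IsSkew (G y) (tors (Γ y))

namespace IsBismutChart

variable {U : Set E} {G : E → E →L[ℝ] E →L[ℝ] ℝ} {J : E →L[ℝ] E} {Γ : E → E →L[ℝ] E →L[ℝ] E}
  {y : E}

theorem isIntegrable (h : IsBismutChart U G J Γ) (hy : y ∈ U) : IsIntegrable J (tors (Γ y)) := by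
  intro u v
  simp only [tors_apply, h.complex y hy, map_sub J, h.sq]
  abel

/-- The 3-form `g(T(u, v), w)` in terms of the derivatives of the metric. -/
theorem inner_tors (h : IsBismutChart U G J Γ) (hy : y ∈ U) (u v w : E) :
    G y (tors (Γ y) u v) w = fderiv ℝ G y (J u) (J (J v)) (J w) +
      fderiv ℝ G y (J v) (J (J w)) (J u) + fderiv ℝ G y (J w) (J (J u)) (J v) := by
  have hJ := inner_J_left h.sq (h.hermitian y hy)
  have hs := h.skew y hy
  -- Since `∇ω = 0`, the cyclic derivative that is dω is expressed by the torsion alone. At `Ju, Jv,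
  -- Jw`, integrability turns the right side into `g(T(u, v), w)`.
  have key : ∀ u v w, fderiv ℝ G y u (J v) w + fderiv ℝ G y v (J w) u + fderiv ℝ G y w (J u) v =
      -(G y (tors (Γ y) u v) (J w) + G y (tors (Γ y) v w) (J u) + G y (tors (Γ y) w u) (J v)) := by
    intro u v w
    simp only [h.metric y hy, h.complex y hy, hJ, tors_apply, inner_sub_left]
    rw [h.symm y hy v (J (Γ y u w)), h.symm y hy w (J (Γ y v u)), h.symm y hy u (J (Γ y w v)),
      hJ, hJ, hJ]
    ring
  have h₁ := (h.isIntegrable hy).inner_eq h.sq (h.hermitian y hy) u v w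
  have e₁ : G y (tors (Γ y) (J v) (J w)) u = G y (tors (Γ y) u (J v)) (J w) :=
    (hs.rotate u (J v) (J w)).symm
  have e₂ : G y (tors (Γ y) (J w) (J u)) v = G y (tors (Γ y) (J u) v) (J w) :=
    hs.rotate (J w) (J u) v
  rw [key]
  simp only [h.sq, map_neg, e₁, e₂]
  linarith

/-- Koszul's formula for a metric connection with totally skew torsion. -/
theorem two_mul_inner_apply (h : IsBismutChart U G J Γ) (hy : y ∈ U) (u v w : E) :
    G y (Γ y u v) w = 1 / 2 * (fderiv ℝ G y u v w + fderiv ℝ G y v w u - fderiv ℝ G y w u v +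
      G y (tors (Γ y) u v) w) := by
  have hs := h.skew y hy
  have h₁ := hs.skew u v w
  have h₂ := hs.rotate u v w
  have h₃ := hs.rotate v w u
  simp only [h.metric y hy, tors_apply, inner_sub_left] at *
  rw [h.symm y hy v (Γ y u w), h.symm y hy w (Γ y v u), h.symm y hy u (Γ y w v)]
  linarith

/-- No regularity of the connection is used. It is forced: `inner_tors` expresses the torsion by
first derivatives of the metric, Koszul's formula then gives all of `Γ`, and the inverse of the
metric is smooth. -/
theorem contDiffOn [FiniteDimensional ℝ E] (h : IsBismutChart U G J Γ) : ContDiffOn ℝ ∞ Γ U := by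
  have hd : ContDiffOn ℝ ∞ (fderiv ℝ G) U :=
    h.contDiffOn_metric.fderiv_of_isOpen h.isOpen (by simp)
  have hd' : ∀ u v w, ContDiffOn ℝ ∞ (fun y => fderiv ℝ G y u v w) U := fun u v w =>
    ((hd.clm_apply contDiffOn_const).clm_apply contDiffOn_const).clm_apply contDiffOn_const
  rw [contDiffOn_clm_apply]
  intro u
  rw [contDiffOn_clm_apply]
  intro v
  have h₁ : ContDiffOn ℝ ∞ (fun y => G y (Γ y u v)) U := by
    rw [contDiffOn_clm_apply]
    intro w
    refine ContDiffOn.congr (f := fun y => 1 / 2 * (fderiv ℝ G y u v w + fderiv ℝ G y v w u -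
      fderiv ℝ G y w u v + (fderiv ℝ G y (J u) (J (J v)) (J w) +
      fderiv ℝ G y (J v) (J (J w)) (J u) + fderiv ℝ G y (J w) (J (J u)) (J v)))) ?_ ?_
    · exact contDiffOn_const.mul ((((hd' u v w).add (hd' v w u)).sub (hd' w u v)).add
        (((hd' _ _ _).add (hd' _ _ _)).add (hd' _ _ _)))
    · intro y hy
      rw [h.two_mul_inner_apply hy, h.inner_tors hy]
  have hinv : ∀ y ∈ U, ∃ e : E ≃L[ℝ] (E →L[ℝ] ℝ), (e : E →L[ℝ] (E →L[ℝ] ℝ)) = G y := by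
    intro y hy
    have hinj : Function.Injective (G y) := by
      rw [injective_iff_map_eq_zero]
      intro v hv
      by_contra hne
      exact (h.pos y hy v hne).ne' (by rw [hv]; rfl)
    have hdim : Module.finrank ℝ E = Module.finrank ℝ (E →L[ℝ] ℝ) := by
      rw [← (LinearMap.toContinuousLinearMap (𝕜 := ℝ) (E := E) (F' := ℝ)).finrank_eq]
      exact (Subspace.dual_finrank_eq (K := ℝ) (V := E)).symm
    exact ⟨(LinearEquiv.ofInjectiveOfFinrankEq (G y : E →ₗ[ℝ] (E →L[ℝ] ℝ)) hinj hdim).toContinuousLinearEquiv,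
      by ext v; rfl⟩
  have : CompleteSpace E := FiniteDimensional.complete ℝ E
  have h₂ : ContDiffOn ℝ ∞ (fun y => (G y).inverse) U := by
    intro y hy
    obtain ⟨e, he⟩ := hinv y hy
    have := contDiffAt_map_inverse (𝕜 := ℝ) (n := ∞) e
    rw [he] at this
    exact this.comp_contDiffWithinAt y (h.contDiffOn_metric y hy)
  refine (h₂.clm_apply h₁).congr fun y hy => ?_
  obtain ⟨e, he⟩ := hinv y hy
  rw [← he, ContinuousLinearMap.inverse_equiv]
  simp

end IsBismutChart

end Chart

end BismutFlat

namespace BismutFlat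

/-! ### First Bianchi identity and the covariant derivative of the torsion -/

section FlatChart

variable {E : Type*} [NormedAddCommGroup E] [NormedSpace ℝ E]

/-- The covariant derivative of the torsion of the connection with connection form `Γ`. -/
def covTors (Γ : E → E →L[ℝ] E →L[ℝ] E) (y u : E) : E →L[ℝ] E →L[ℝ] E :=
  fderiv ℝ (fun z => tors (Γ z)) y u + ContinuousLinearMap.compL ℝ E E E (Γ y u) ∘L tors (Γ y) -
    tors (Γ y) ∘L Γ y u - ((tors (Γ y)).flip ∘L Γ y u).flip

theorem covTors_apply (Γ : E → E →L[ℝ] E →L[ℝ] E) (y u v w : E) :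
    covTors Γ y u v w = fderiv ℝ (fun z => tors (Γ z)) y u v w + Γ y u (tors (Γ y) v w) -
      tors (Γ y) (Γ y u v) w - tors (Γ y) v (Γ y u w) := rfl

/-- The connection with connection form `Γ` is flat on `U`. -/
def IsFlatChart (U : Set E) (Γ : E → E →L[ℝ] E →L[ℝ] E) : Prop :=
  ∀ y ∈ U, ∀ u v w, fderiv ℝ Γ y u v w + Γ y u (Γ y v w) = fderiv ℝ Γ y v u w + Γ y v (Γ y u w)

namespace IsBismutChart

variable {U : Set E} {G : E → E →L[ℝ] E →L[ℝ] ℝ} {J : E →L[ℝ] E} {Γ : E → E →L[ℝ] E →L[ℝ] E}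
  {y : E} [FiniteDimensional ℝ E]

theorem differentiableAt_metric (h : IsBismutChart U G J Γ) (hy : y ∈ U) :
    DifferentiableAt ℝ G y :=
  (h.contDiffOn_metric.contDiffAt (h.isOpen.mem_nhds hy)).differentiableAt (by simp)

theorem differentiableAt (h : IsBismutChart U G J Γ) (hy : y ∈ U) : DifferentiableAt ℝ Γ y :=
  (h.contDiffOn.contDiffAt (h.isOpen.mem_nhds hy)).differentiableAt (by simp)

theorem contDiffOn_tors (h : IsBismutChart U G J Γ) : ContDiffOn ℝ ∞ (fun z => tors (Γ z)) U :=
  h.contDiffOn.sub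
    ((ContinuousLinearMap.flipₗᵢ ℝ E E E).toContinuousLinearEquiv.contDiff.comp_contDiffOn
      h.contDiffOn)

theorem differentiableAt_tors (h : IsBismutChart U G J Γ) (hy : y ∈ U) :
    DifferentiableAt ℝ (fun z => tors (Γ z)) y :=
  (h.contDiffOn_tors.contDiffAt (h.isOpen.mem_nhds hy)).differentiableAt (by simp)

theorem fderiv_tors_apply (h : IsBismutChart U G J Γ) (hy : y ∈ U) (u v w : E) :
    fderiv ℝ (fun z => tors (Γ z)) y u v w = fderiv ℝ Γ y u v w - fderiv ℝ Γ y u w v := by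
  have hd := h.differentiableAt hy
  rw [← fderiv_clm_apply_const₂ (h.differentiableAt_tors hy)]
  simp only [tors_apply]
  rw [fderiv_fun_sub ((hd.clm_apply (differentiableAt_const v)).clm_apply (differentiableAt_const w))
    ((hd.clm_apply (differentiableAt_const w)).clm_apply (differentiableAt_const v)),
    sub_apply, fderiv_clm_apply_const₂ hd, fderiv_clm_apply_const₂ hd]

/-- The first Bianchi identity. -/
theorem bianchi (h : IsBismutChart U G J Γ) (hflat : IsFlatChart U Γ) (hy : y ∈ U) (u v w : E) :
    covTors Γ y u v w + covTors Γ y v w u + covTors Γ y w u v =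
      -cyc (tors (Γ y)) (tors (Γ y)) u v w := by
  have h₁ := hflat y hy u v w
  have h₂ := hflat y hy v w u
  have h₃ := hflat y hy w u v
  simp only [covTors_apply, h.fderiv_tors_apply hy, cyc, tors_apply, map_sub (Γ y), sub_apply,
    map_sub (Γ y _)]
  rw [← sub_eq_zero] at h₁ h₂ h₃ ⊢
  rw [← add_zero (0 : E), ← add_zero (0 + 0 : E)]
  nth_rewrite 1 [← h₁]
  nth_rewrite 1 [← h₂]
  nth_rewrite 1 [← h₃]
  abel

theorem covTors_swap (h : IsBismutChart U G J Γ) (hy : y ∈ U) (u v w : E) :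
    covTors Γ y u v w = -covTors Γ y u w v := by
  simp only [covTors_apply, h.fderiv_tors_apply hy]
  rw [(h.skew y hy).swap v w, (h.skew y hy).swap (Γ y u v) w, (h.skew y hy).swap v (Γ y u w), map_neg]
  abel

/-- A function on `U` constructed from parallel data is parallel. -/
theorem fderiv_inner_apply (h : IsBismutChart U G J Γ) (hy : y ∈ U) {a c : E → E}
    (ha : DifferentiableAt ℝ a y) (hc : DifferentiableAt ℝ c y) (u : E) :
    fderiv ℝ (fun z => G z (a z) (c z)) y u =
      G y (fderiv ℝ a y u + Γ y u (a y)) (c y) + G y (a y) (fderiv ℝ c y u + Γ y u (c y)) := by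
  have hd := h.differentiableAt_metric hy
  rw [fderiv_clm_apply_apply (hd.clm_apply ha) hc, fderiv_clm_apply_apply hd ha, add_apply,
    h.metric y hy, inner_add_left, map_add]
  ring

theorem inner_covTors (h : IsBismutChart U G J Γ) (hy : y ∈ U) (u v w z : E) :
    G y (covTors Γ y u v w) z = fderiv ℝ (fun x => G x (tors (Γ x) v w) z) y u -
      G y (tors (Γ y) (Γ y u v) w) z - G y (tors (Γ y) v (Γ y u w)) z -
      G y (tors (Γ y) v w) (Γ y u z) := by
  have hd := h.differentiableAt_tors hy
  rw [h.fderiv_inner_apply hy ((hd.clm_apply (differentiableAt_const v)).clm_apply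
    (differentiableAt_const w)) (differentiableAt_const z), fderiv_clm_apply_const₂ hd,
    covTors_apply, inner_sub_left, inner_sub_left, fderiv_fun_const]
  simp only [Pi.zero_apply, zero_apply, zero_add]
  ring

/-- The metric is parallel, so total skewness of T survives covariant differentiation. -/
theorem isSkew_covTors (h : IsBismutChart U G J Γ) (hy : y ∈ U) (u : E) :
    IsSkew (G y) (covTors Γ y u) where
  swap := h.covTors_swap hy u
  skew v w z := by
    have hs := h.skew y hy
    have e : (fun x => G x (tors (Γ x) v w) z) =ᶠ[nhds y] fun x => -G x (tors (Γ x) v z) w := by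
      filter_upwards [h.isOpen.mem_nhds hy] with x hx using (h.skew x hx).skew v w z
    rw [h.inner_covTors hy, h.inner_covTors hy, e.fderiv_eq, fderiv_fun_neg, neg_apply,
      hs.skew (Γ y u v), hs.skew v (Γ y u w), hs.skew v w (Γ y u z)]
    ring

/-- The covariant derivative of the torsion of a flat connection with skew torsion. -/
theorem covTors_eq (h : IsBismutChart U G J Γ) (hflat : IsFlatChart U Γ) (hy : y ∈ U) (u v w : E) :
    covTors Γ y u v w = -(1 / 3 : ℝ) • cyc (tors (Γ y)) (tors (Γ y)) u v w := by
  have hT := h.skew y hy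
  have hS := h.isSkew_covTors hy
  refine eq_of_inner_eq (h.pos y hy) fun z => ?_
  have hB : ∀ u v w z, G y (covTors Γ y u v w) z + G y (covTors Γ y v w u) z +
      G y (covTors Γ y w u v) z = -(G y (tors (Γ y) u v) (tors (Γ y) w z) +
        G y (tors (Γ y) v w) (tors (Γ y) u z) + G y (tors (Γ y) w u) (tors (Γ y) v z)) := by
    intro u v w z
    have := congrArg (fun x => G y x z) (h.bianchi hflat hy u v w)
    simp only [cyc, inner_neg_left, inner_add_left, fun a c => hT.rotate a c z] at this
    rw [this, h.symm y hy (tors (Γ y) w z), h.symm y hy (tors (Γ y) u z),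
      h.symm y hy (tors (Γ y) v z)]
  have sw : ∀ a b c d, G y (covTors Γ y a b c) d = -G y (covTors Γ y a c b) d := fun a b c d => by
    rw [h.covTors_swap hy, inner_neg_left]
  have sk : ∀ a b c d, G y (covTors Γ y a b c) d = -G y (covTors Γ y a b d) c := fun a b c d =>
    (hS a).skew b c d
  have tl : ∀ a b c d, G y (tors (Γ y) a b) (tors (Γ y) c d) =
      -G y (tors (Γ y) b a) (tors (Γ y) c d) := fun a b c d => by
    rw [hT.swap a b, inner_neg_left]
  have ts : ∀ a b c d, G y (tors (Γ y) a b) (tors (Γ y) c d) =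
      G y (tors (Γ y) c d) (tors (Γ y) a b) := fun a b c d => h.symm y hy _ _
  -- By skewness in the last three slots there are, up to sign, four unknowns, one for each choice
  -- of derivative direction. Each Bianchi equation omits one of them, and the right sides agree up
  -- to sign because the quadratic term is totally skew. So all four are equal up to sign, whence
  -- `1/3`.
  have h₁ := hB u v w z
  have h₂ := hB u v z w
  have h₃ := hB u w z v
  have h₄ := hB v w z u
  have hc : G y (cyc (tors (Γ y)) (tors (Γ y)) u v w) z = G y (tors (Γ y) u v) (tors (Γ y) w z) +
      G y (tors (Γ y) v w) (tors (Γ y) u z) + G y (tors (Γ y) w u) (tors (Γ y) v z) := by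
    simp only [cyc, inner_add_left, fun a c => hT.rotate a c z, ts _ _ _ z]
  rw [inner_smul_left, hc]
  linarith [sw v w u z, sk u v z w, sw v z u w, sk v u z w, sk u w z v, sw u w v z, sw w z u v,
    sk w u z v, sk z u w v, sk v w z u, sw w z v u, sk w v z u, sw w v u z, sk z v w u, sw z v u w,
    ts u v z w, tl z w u v, ts w z u v, ts v z u w, tl u w v z, tl z u v w, ts u z v w, tl u w z v,
    ts w u z v, tl z v w u, ts v z w u, tl z u w v, ts u z w v, tl w v u z, ts v w z u, ts w z v u,
    tl v u w z]

end IsBismutChart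

end FlatChart

end BismutFlat

namespace BismutFlat

/-! ### Ricci identity and parallelism of the torsion -/

section FlatChart

variable {E : Type*} [NormedAddCommGroup E] [NormedSpace ℝ E]

/-- The second covariant derivative of the torsion of the connection with connection form `Γ`. -/
def cov2Tors (Γ : E → E →L[ℝ] E →L[ℝ] E) (y u v a c : E) : E :=
  fderiv ℝ (fun z => covTors Γ z v a c) y u + Γ y u (covTors Γ y v a c) -
    covTors Γ y (Γ y u v) a c - covTors Γ y v (Γ y u a) c - covTors Γ y v a (Γ y u c)

theorem covTors_sub (Γ : E → E →L[ℝ] E →L[ℝ] E) (y u v a c : E) :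
    covTors Γ y (u - v) a c = covTors Γ y u a c - covTors Γ y v a c := by
  simp only [covTors_apply, map_sub (fderiv ℝ (fun z => tors (Γ z)) y), map_sub (Γ y),
    map_sub (tors (Γ y)), map_sub (tors (Γ y) a), sub_apply]
  abel

namespace IsBismutChart

variable {U : Set E} {G : E → E →L[ℝ] E →L[ℝ] ℝ} {J : E →L[ℝ] E} {Γ : E → E →L[ℝ] E →L[ℝ] E}
  {y : E} [FiniteDimensional ℝ E]

/-- Differentiate the relation for T, which holds near `y`; the connection terms match because `J`
is constant and parallel. -/
theorem isIntegrable_covTors (h : IsBismutChart U G J Γ) (hy : y ∈ U) (u : E) :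
    IsIntegrable J (covTors Γ y u) := by
  intro v w
  have hT := h.isIntegrable hy
  have hd := h.differentiableAt_tors hy
  have e : (fun z => tors (Γ z) (J v) (J w)) =ᶠ[nhds y] fun z =>
      J (tors (Γ z) (J v) w) + J (tors (Γ z) v (J w)) + tors (Γ z) v w := by
    filter_upwards [h.isOpen.mem_nhds hy] with z hz using h.isIntegrable hz v w
  have hd' : ∀ v w, DifferentiableAt ℝ (fun z => tors (Γ z) v w) y := fun v w =>
    (hd.clm_apply (differentiableAt_const v)).clm_apply (differentiableAt_const w)
  have hJ' : ∀ v w, fderiv ℝ (fun z => J (tors (Γ z) v w)) y u =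
      J (fderiv ℝ (fun z => tors (Γ z)) y u v w) := by
    intro v w
    rw [fderiv_clm_apply_apply (c := fun _ => J) (differentiableAt_const J) (hd' v w),
      fderiv_clm_apply_const₂ hd]
    simp
  have e' := congrArg (fun L : E →L[ℝ] E => L u) (e.fderiv_eq (𝕜 := ℝ))
  have hJd : ∀ v w, DifferentiableAt ℝ (fun z => J (tors (Γ z) v w)) y := fun v w =>
    DifferentiableAt.clm_apply (c := fun _ => J) (differentiableAt_const J) (hd' v w)
  simp only [fderiv_clm_apply_const₂ hd] at e'
  rw [fderiv_fun_add ((hJd _ _).fun_add (hJd _ _)) (hd' _ _), fderiv_fun_add (hJd _ _) (hJd _ _),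
    add_apply, add_apply, hJ', hJ', fderiv_clm_apply_const₂ hd] at e'
  simp only [covTors_apply, e', h.complex y hy, hT (Γ y u v), hT v, map_add J, map_sub J,
    map_add (Γ y u)]
  abel

/-- The covariant product rule applied to `-1/3 cyc(T, T)`; the neighbourhood version of
`covTors_eq` is what may be differentiated. -/
theorem cov2Tors_eq (h : IsBismutChart U G J Γ) (hflat : IsFlatChart U Γ) (hy : y ∈ U)
    (u v a c : E) :
    cov2Tors Γ y u v a c = -(1 / 3 : ℝ) • (cyc (covTors Γ y u) (tors (Γ y)) v a c +
      cyc (tors (Γ y)) (covTors Γ y u) v a c) := by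
  have hd := h.differentiableAt_tors hy
  have e : (fun z => covTors Γ z v a c) =ᶠ[nhds y] fun z =>
      -(1 / 3 : ℝ) • cyc (tors (Γ z)) (tors (Γ z)) v a c := by
    filter_upwards [h.isOpen.mem_nhds hy] with z hz using h.covTors_eq hflat hz v a c
  have hd' : ∀ v w, DifferentiableAt ℝ (fun z => tors (Γ z) v w) y := fun v w =>
    (hd.clm_apply (differentiableAt_const v)).clm_apply (differentiableAt_const w)
  have hd₂ : ∀ v a c, DifferentiableAt ℝ (fun z => tors (Γ z) (tors (Γ z) v a) c) y := fun v a c =>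
    (hd.clm_apply (hd' v a)).clm_apply (differentiableAt_const c)
  have e₂ : ∀ v a c, fderiv ℝ (fun z => tors (Γ z) (tors (Γ z) v a) c) y u =
      fderiv ℝ (fun z => tors (Γ z)) y u (tors (Γ y) v a) c +
        tors (Γ y) (fderiv ℝ (fun z => tors (Γ z)) y u v a) c := by
    intro v a c
    rw [fderiv_clm_apply_const (hd.clm_apply (hd' v a)), fderiv_clm_apply_apply hd (hd' v a),
      fderiv_clm_apply_const₂ hd, add_apply]
  have e₃ : fderiv ℝ (fun z => covTors Γ z v a c) y u = -(1 / 3 : ℝ) •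
      (fderiv ℝ (fun z => tors (Γ z) (tors (Γ z) v a) c) y u +
        fderiv ℝ (fun z => tors (Γ z) (tors (Γ z) a c) v) y u +
        fderiv ℝ (fun z => tors (Γ z) (tors (Γ z) c v) a) y u) := by
    rw [e.fderiv_eq]
    simp only [cyc]
    rw [fderiv_fun_const_smul (((hd₂ _ _ _).fun_add (hd₂ _ _ _)).fun_add (hd₂ _ _ _)), smul_apply,
      fderiv_fun_add ((hd₂ _ _ _).fun_add (hd₂ _ _ _)) (hd₂ _ _ _),
      fderiv_fun_add (hd₂ _ _ _) (hd₂ _ _ _), add_apply, add_apply]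
  rw [cov2Tors, e₃, h.covTors_eq hflat hy v a c, h.covTors_eq hflat hy (Γ y u v) a c,
    h.covTors_eq hflat hy v (Γ y u a) c, h.covTors_eq hflat hy v a (Γ y u c),
    map_smul (Γ y u), ← smul_add, ← smul_sub, ← smul_sub, ← smul_sub]
  congr 1
  simp only [e₂, cyc, covTors_apply, map_add (Γ y u), map_add (tors (Γ y)), map_sub (tors (Γ y)),
    add_apply, sub_apply]
  abel

theorem cov2Tors_J (h : IsBismutChart U G J Γ) (hy : y ∈ U)
    (hSJ : ∀ z ∈ U, ∀ u v w, covTors Γ z (J u) v w = J (covTors Γ z u (J v) (J w)))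
    (hd : ∀ v a c, DifferentiableAt ℝ (fun z => covTors Γ z v a c) y) (u v a c : E) :
    cov2Tors Γ y u (J v) a c = J (cov2Tors Γ y u v (J a) (J c)) := by
  have e : (fun z => covTors Γ z (J v) a c) =ᶠ[nhds y] fun z => J (covTors Γ z v (J a) (J c)) := by
    filter_upwards [h.isOpen.mem_nhds hy] with z hz using hSJ z hz v a c
  have e' : fderiv ℝ (fun z => covTors Γ z (J v) a c) y u =
      J (fderiv ℝ (fun z => covTors Γ z v (J a) (J c)) y u) := by
    rw [e.fderiv_eq, fderiv_clm_apply_apply (c := fun _ => J) (differentiableAt_const J) (hd _ _ _)]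
    simp
  simp only [cov2Tors, e', hSJ y hy, h.complex y hy, map_add J, map_sub J]

theorem contDiffOn_fderiv_tors (h : IsBismutChart U G J Γ) :
    ContDiffOn ℝ ∞ (fderiv ℝ (fun z => tors (Γ z))) U :=
  h.contDiffOn_tors.fderiv_of_isOpen h.isOpen (by simp)

theorem fderiv_covTors (h : IsBismutChart U G J Γ) (hy : y ∈ U) (v a c : E) :
    DifferentiableAt ℝ (fun z => covTors Γ z v a c) y ∧ ∀ u,
    fderiv ℝ (fun z => covTors Γ z v a c) y u =
      fderiv ℝ (fderiv ℝ (fun z => tors (Γ z))) y u v a c +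
      (fderiv ℝ Γ y u v (tors (Γ y) a c) + Γ y v (fderiv ℝ (fun z => tors (Γ z)) y u a c)) -
      (fderiv ℝ (fun z => tors (Γ z)) y u (Γ y v a) c + tors (Γ y) (fderiv ℝ Γ y u v a) c) -
      (fderiv ℝ (fun z => tors (Γ z)) y u a (Γ y v c) + tors (Γ y) a (fderiv ℝ Γ y u v c)) := by
  have hΓ := h.differentiableAt hy
  have hT := h.differentiableAt_tors hy
  have hT' : DifferentiableAt ℝ (fderiv ℝ (fun z => tors (Γ z))) y :=
    (h.contDiffOn_fderiv_tors.contDiffAt (h.isOpen.mem_nhds hy)).differentiableAt (by simp)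
  have c₀ : ∀ x : E, DifferentiableAt ℝ (fun _ : E => x) y := fun x => differentiableAt_const x
  have hΓv := hΓ.clm_apply (c₀ v)
  have d₁ := ((hT'.clm_apply (c₀ v)).clm_apply (c₀ a)).clm_apply (c₀ c)
  have d₂ := hΓv.clm_apply ((hT.clm_apply (c₀ a)).clm_apply (c₀ c))
  have d₃ := (hT.clm_apply (hΓv.clm_apply (c₀ a))).clm_apply (c₀ c)
  have d₄ := (hT.clm_apply (c₀ a)).clm_apply (hΓv.clm_apply (c₀ c))
  simp only [covTors_apply]
  refine ⟨((d₁.fun_add d₂).fun_sub d₃).fun_sub d₄, fun u => ?_⟩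
  rw [fderiv_fun_sub ((d₁.fun_add d₂).fun_sub d₃) d₄, fderiv_fun_sub (d₁.fun_add d₂) d₃, fderiv_fun_add d₁ d₂,
    sub_apply, sub_apply, add_apply,
    fderiv_clm_apply_const₂ (hT'.clm_apply (c₀ v)), fderiv_clm_apply_const hT',
    fderiv_clm_apply_apply hΓv ((hT.clm_apply (c₀ a)).clm_apply (c₀ c)), fderiv_clm_apply_const hΓ,
    fderiv_clm_apply_const₂ hT,
    fderiv_clm_apply_const (hT.clm_apply (hΓv.clm_apply (c₀ a))),
    fderiv_clm_apply_apply hT (hΓv.clm_apply (c₀ a)), fderiv_clm_apply_const₂ hΓ,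
    fderiv_clm_apply_apply (hT.clm_apply (c₀ a)) (hΓv.clm_apply (c₀ c)),
    fderiv_clm_apply_const hT, fderiv_clm_apply_const₂ hΓ, add_apply]

/-- The Ricci identity for a flat connection. -/
theorem cov2Tors_sub (h : IsBismutChart U G J Γ) (hflat : IsFlatChart U Γ) (hy : y ∈ U)
    (u v a c : E) :
    cov2Tors Γ y u v a c - cov2Tors Γ y v u a c = -covTors Γ y (tors (Γ y) u v) a c := by
  -- Symmetry of the second derivatives of T. Together with flatness, used to exchange the
  -- derivatives of `Γ`, it leaves only the torsion term.
  have hsym : IsSymmSndFDerivAt ℝ (fun z => tors (Γ z)) y :=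
    (h.contDiffOn_tors.contDiffAt (h.isOpen.mem_nhds hy)).isSymmSndFDerivAt
      (by
        rw [minSmoothness_of_isRCLikeNormedField]
        exact WithTop.coe_le_coe.mpr le_top)
  have hf : ∀ w, fderiv ℝ Γ y u v w = fderiv ℝ Γ y v u w + Γ y v (Γ y u w) - Γ y u (Γ y v w) :=
    fun w => eq_sub_of_add_eq (hflat y hy u v w)
  rw [tors_apply, covTors_sub, cov2Tors, cov2Tors, (h.fderiv_covTors hy v a c).2,
    (h.fderiv_covTors hy u a c).2, hsym.eq u v, hf, hf, hf,
    covTors_apply Γ y v a c, covTors_apply Γ y u a c, covTors_apply Γ y v (Γ y u a) c,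
    covTors_apply Γ y u (Γ y v a) c, covTors_apply Γ y v a (Γ y u c),
    covTors_apply Γ y u a (Γ y v c)]
  simp only [map_add (Γ y u), map_add (Γ y v), map_sub (Γ y u), map_sub (Γ y v),
    map_add (tors (Γ y)), map_sub (tors (Γ y)), map_add (tors (Γ y) a), map_sub (tors (Γ y) a),
    add_apply, sub_apply]
  abel

/-- The torsion of a flat Bismut connection is parallel. -/
theorem covTors_eq_zero (h : IsBismutChart U G J Γ) (hflat : IsFlatChart U Γ) (hy : y ∈ U)
    (u v w : E) : covTors Γ y u v w = 0 := by
  obtain ⟨b, hb⟩ := exists_isOrthonormal (h.symm y hy) (h.pos y hy)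
  have hSJ : ∀ z ∈ U, ∀ u v w, covTors Γ z (J u) v w = J (covTors Γ z u (J v) (J w)) := by
    intro z hz
    refine J_left_of_isIntegrable (h.pos z hz) h.sq (h.hermitian z hz) (h.isSkew_covTors hz) ?_
      (h.isIntegrable_covTors hz)
    intro u v w
    rw [h.covTors_eq hflat hz, h.covTors_eq hflat hz, ← smul_neg]
    congr 1
    have hs := (h.skew z hz).swap
    rw [cyc, cyc, hs v u, hs u w, hs w v, map_neg, neg_apply, map_neg, neg_apply, map_neg,
      neg_apply]
    abel
  exact covariantDeriv_torsion_eq_zero hb (h.symm y hy) (h.pos y hy) h.sq (h.hermitian y hy)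
    (h.skew y hy) (h.isSkew_covTors hy) (h.covTors_eq hflat hy) (hSJ y hy)
    (h.cov2Tors_eq hflat hy)
    (h.cov2Tors_J hy hSJ fun v a c => (h.fderiv_covTors hy v a c).1)
    (h.cov2Tors_sub hflat hy) u v w

/-- The torsion of a flat Bismut connection satisfies the Jacobi identity. -/
theorem cyc_tors_eq_zero (h : IsBismutChart U G J Γ) (hflat : IsFlatChart U Γ) (hy : y ∈ U)
    (u v w : E) : cyc (tors (Γ y)) (tors (Γ y)) u v w = 0 := by
  have := h.covTors_eq hflat hy u v w
  rw [h.covTors_eq_zero hflat hy] at this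
  exact (smul_eq_zero.mp this.symm).resolve_left (by norm_num)

end IsBismutChart

end FlatChart

end BismutFlat

namespace BismutFlat

/-! ### Vector fields and connections in charts -/

section Bridge

variable {n : ℕ} {M : Type*} [TopologicalSpace M] [ChartedSpace (Cn n) M]
  [IsManifold 𝓘(ℂ, Cn n) ω M]

/-- Multiplication by `i` on `ℂⁿ`. -/
def mulI (n : ℕ) : Cn n →L[ℝ] Cn n := Complex.I • ContinuousLinearMap.id ℝ (Cn n)

theorem mulI_apply (v : Cn n) : mulI n v = Complex.I • v := rfl

theorem mulI_mulI (v : Cn n) : mulI n (mulI n v) = -v := by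
  rw [mulI_apply, mulI_apply, smul_smul, Complex.I_mul_I, neg_one_smul]

/-- The derivative of the inverse of the chart around `x₀`. -/
def dsymm (x₀ : M) (y : Cn n) : Cn n →L[ℝ] Cn n :=
  mfderiv 𝓘(ℝ, Cn n) 𝓘(ℝ, Cn n) (extChartAt 𝓘(ℝ, Cn n) x₀).symm y

/-- The derivative of the chart around `x₀`. -/
def dchart (x₀ x : M) : Cn n →L[ℝ] Cn n :=
  mfderiv 𝓘(ℝ, Cn n) 𝓘(ℝ, Cn n) (extChartAt 𝓘(ℝ, Cn n) x₀) x

theorem hasMFDerivAt_real {M' : Type*} [TopologicalSpace M'] [ChartedSpace (Cn n) M'] {N : Type*} [TopologicalSpace N]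
    [ChartedSpace (Cn n) N] {f : M' → N} {x : M'} {f' : Cn n →L[ℂ] Cn n}
    (h : HasMFDerivAt 𝓘(ℂ, Cn n) 𝓘(ℂ, Cn n) f x f') :
    HasMFDerivAt 𝓘(ℝ, Cn n) 𝓘(ℝ, Cn n) f x (f'.restrictScalars ℝ) :=
  ⟨h.1, h.2.restrictScalars ℝ⟩

/-- Charts are holomorphic, so the real derivative is the restriction of scalars of a complex linear
map. -/
theorem dsymm_mulI {x₀ : M} {y : Cn n} (hy : y ∈ (extChartAt 𝓘(ℝ, Cn n) x₀).target) (v : Cn n) :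
    dsymm x₀ y (mulI n v) = mulI n (dsymm x₀ y v) := by
  have h := (mdifferentiableWithinAt_extChartAt_symm (I := 𝓘(ℂ, Cn n)) (x := x₀) (z := y) hy)
  rw [modelWithCornersSelf_coe, Set.range_id, mdifferentiableWithinAt_univ] at h
  have h' := (hasMFDerivAt_real h.hasMFDerivAt).mfderiv
  have : dsymm x₀ y = (mfderiv 𝓘(ℂ, Cn n) 𝓘(ℂ, Cn n) (extChartAt 𝓘(ℂ, Cn n) x₀).symm y :
    Cn n →L[ℂ] Cn n).restrictScalars ℝ := h'
  rw [this]
  exact map_smul (mfderiv 𝓘(ℂ, Cn n) 𝓘(ℂ, Cn n) (extChartAt 𝓘(ℂ, Cn n) x₀).symm y :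
    Cn n →L[ℂ] Cn n) Complex.I v

theorem mfderiv_comp_dsymm {x₀ : M} {y : Cn n} (hy : y ∈ (extChartAt 𝓘(ℝ, Cn n) x₀).target) :
    dchart x₀ ((extChartAt 𝓘(ℝ, Cn n) x₀).symm y) ∘L dsymm x₀ y = ContinuousLinearMap.id ℝ (Cn n) := by
  have h := mfderiv_extChartAt_comp_mfderivWithin_extChartAt_symm (I := 𝓘(ℝ, Cn n)) hy
  rw [modelWithCornersSelf_coe, Set.range_id, mfderivWithin_univ] at h
  exact h

theorem dsymm_comp_mfderiv {x₀ : M} {y : Cn n} (hy : y ∈ (extChartAt 𝓘(ℝ, Cn n) x₀).target) :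
    dsymm x₀ y ∘L dchart x₀ ((extChartAt 𝓘(ℝ, Cn n) x₀).symm y) = ContinuousLinearMap.id ℝ (Cn n) := by
  have h := mfderivWithin_extChartAt_symm_comp_mfderiv_extChartAt (I := 𝓘(ℝ, Cn n)) hy
  rw [modelWithCornersSelf_coe, Set.range_id, mfderivWithin_univ] at h
  exact h

theorem dsymm_injective {x₀ : M} {y : Cn n} (hy : y ∈ (extChartAt 𝓘(ℝ, Cn n) x₀).target) :
    Function.Injective (dsymm x₀ y) :=
  Function.LeftInverse.injective (DFunLike.congr_fun (mfderiv_comp_dsymm hy))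

/-- The tangent space at a point is identified with `ℂⁿ` through the preferred chart there, so at
the centre of that chart, chart expressions and pointwise tensors agree literally. -/
theorem dsymm_self (x₀ : M) :
    dsymm x₀ (extChartAt 𝓘(ℝ, Cn n) x₀ x₀) = ContinuousLinearMap.id ℝ (Cn n) := by
  have h := mfderivWithin_range_extChartAt_symm (I := 𝓘(ℝ, Cn n)) (x := x₀)
  rw [modelWithCornersSelf_coe, Set.range_id, mfderivWithin_univ] at h
  exact h

/-- A constant vector field on `ℂⁿ`. -/
def constField (v : Cn n) (y : Cn n) : TangentSpace 𝓘(ℝ, Cn n) y := v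

/-- The vector field given by `c` in the chart around `x₀`. -/
def liftField (x₀ : M) (c : Cn n → Cn n) : VField n M :=
  VectorField.mpullback 𝓘(ℝ, Cn n) 𝓘(ℝ, Cn n) (extChartAt 𝓘(ℝ, Cn n) x₀) c

theorem liftField_symm {x₀ : M} {y : Cn n} (hy : y ∈ (extChartAt 𝓘(ℝ, Cn n) x₀).target)
    (c : Cn n → Cn n) :
    liftField x₀ c ((extChartAt 𝓘(ℝ, Cn n) x₀).symm y) = dsymm x₀ y (c y) := by
  change (dchart x₀ ((extChartAt 𝓘(ℝ, Cn n) x₀).symm y)).inverse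
    (c (extChartAt 𝓘(ℝ, Cn n) x₀ ((extChartAt 𝓘(ℝ, Cn n) x₀).symm y))) = _
  rw [ContinuousLinearMap.inverse_eq (mfderiv_comp_dsymm hy) (dsymm_comp_mfderiv hy),
    (extChartAt 𝓘(ℝ, Cn n) x₀).right_inv hy]

theorem liftField_add (x₀ : M) (c c' : Cn n → Cn n) :
    liftField x₀ (c + c') = liftField x₀ c + liftField x₀ c' :=
  VectorField.mpullback_add

theorem liftField_smul (x₀ : M) (f : Cn n → ℝ) (c : Cn n → Cn n) :
    liftField x₀ (f • c) = (f ∘ extChartAt 𝓘(ℝ, Cn n) x₀) • liftField x₀ c :=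
  VectorField.mpullback_smul

theorem isInvertible_mfderiv_chart {x₀ : M} {y : Cn n}
    (hy : y ∈ (extChartAt 𝓘(ℝ, Cn n) x₀).target) :
    (mfderiv 𝓘(ℝ, Cn n) 𝓘(ℝ, Cn n) (extChartAt 𝓘(ℝ, Cn n) x₀)
      ((extChartAt 𝓘(ℝ, Cn n) x₀).symm y)).IsInvertible :=
  isInvertible_mfderiv_extChartAt ((extChartAt 𝓘(ℝ, Cn n) x₀).map_target hy)

theorem contMDiffAt_chart {x₀ : M} {y : Cn n}
    (hy : y ∈ (extChartAt 𝓘(ℝ, Cn n) x₀).target) :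
    ContMDiffAt 𝓘(ℝ, Cn n) 𝓘(ℝ, Cn n) ω (extChartAt 𝓘(ℝ, Cn n) x₀)
      ((extChartAt 𝓘(ℝ, Cn n) x₀).symm y) :=
  contMDiffAt_extChartAt' (by
    rw [← extChartAt_source 𝓘(ℝ, Cn n)]
    exact (extChartAt 𝓘(ℝ, Cn n) x₀).map_target hy)

theorem contMDiffAt_liftField {x₀ : M} {y : Cn n}
    (hy : y ∈ (extChartAt 𝓘(ℝ, Cn n) x₀).target) {c : Cn n → Cn n} (hc : ContDiffAt ℝ ∞ c y) :
    ContMDiffAt 𝓘(ℝ, Cn n) (𝓘(ℝ, Cn n).prod 𝓘(ℝ, Cn n)) ∞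
      (fun x => (⟨x, liftField x₀ c x⟩ : TangentBundle 𝓘(ℝ, Cn n) M))
      ((extChartAt 𝓘(ℝ, Cn n) x₀).symm y) := by
  refine ContMDiffAt.mpullback_vectorField_preimage (n := ω) ?_ (contMDiffAt_chart hy)
    (isInvertible_mfderiv_chart hy) le_top
  rw [(extChartAt 𝓘(ℝ, Cn n) x₀).right_inv hy]
  exact contMDiffAt_vectorSpace_iff_contDiffAt.mpr hc

theorem diffAt_liftField {x₀ : M} {y : Cn n} (hy : y ∈ (extChartAt 𝓘(ℝ, Cn n) x₀).target)
    {c : Cn n → Cn n} (hc : ContDiffAt ℝ ∞ c y) :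
    (liftField x₀ c).DiffAt ((extChartAt 𝓘(ℝ, Cn n) x₀).symm y) :=
  (contMDiffAt_liftField hy hc).mdifferentiableAt (by simp)

/-- These are coordinate fields: pull-backs of constant fields, whose bracket vanishes. -/
theorem mlieBracket_liftField_const {x₀ : M} {y : Cn n}
    (hy : y ∈ (extChartAt 𝓘(ℝ, Cn n) x₀).target) (v w : Cn n) :
    VectorField.mlieBracket 𝓘(ℝ, Cn n) (liftField x₀ fun _ => v) (liftField x₀ fun _ => w)
      ((extChartAt 𝓘(ℝ, Cn n) x₀).symm y) = 0 := by
  have hc : ∀ v : Cn n, MDifferentiableAt 𝓘(ℝ, Cn n) (𝓘(ℝ, Cn n).prod 𝓘(ℝ, Cn n))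
      (fun y => (⟨y, v⟩ : TangentBundle 𝓘(ℝ, Cn n) (Cn n)))
        (extChartAt 𝓘(ℝ, Cn n) x₀ ((extChartAt 𝓘(ℝ, Cn n) x₀).symm y)) := fun v =>
    (contMDiffAt_vectorSpace_iff_contDiffAt (n := ω).mpr contDiffAt_const).mdifferentiableAt
      (by simp)
  have h := VectorField.mpullback_mlieBracket (n := ω) (hc v) (hc w) (contMDiffAt_chart hy) le_top
  refine h.symm.trans ?_
  have h0 : VectorField.mlieBracket 𝓘(ℝ, Cn n) (constField v) (constField w) = 0 := by
    rw [← VectorField.mlieBracketWithin_univ]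
    refine (VectorField.mlieBracketWithin_eq_lieBracketWithin (V := constField v)
      (W := constField w) (s := Set.univ)).trans ?_
    funext z
    change fderivWithin ℝ (fun _ => w) Set.univ z v - fderivWithin ℝ (fun _ => v) Set.univ z w = 0
    simp
  refine (congrArg (fun W => VectorField.mpullback 𝓘(ℝ, Cn n) 𝓘(ℝ, Cn n)
    (extChartAt 𝓘(ℝ, Cn n) x₀) W _) h0).trans ?_
  rw [VectorField.mpullback_zero]
  rfl

end Bridge

end BismutFlat

namespace BismutFlat

/-! ### Connection forms in a chart -/

section Christoffel

variable {n : ℕ} {M : Type*} [TopologicalSpace M] [ChartedSpace (Cn n) M]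
  [IsManifold 𝓘(ℂ, Cn n) ω M]

theorem cov_congr (D : AffineConnection n M) {Y Y' : VField n M} {x : M} (hY : Y.DiffAt x)
    (hY' : Y'.DiffAt x) (h : ∀ᶠ z in nhds x, Y z = Y' z) : D Y x = D Y' x :=
  D.isCovariantDerivativeOnUniv.congr_of_eventuallyEq hY hY' Filter.univ_mem h

theorem mfderiv_comp_chart {x₀ : M} {y : Cn n} (hy : y ∈ (extChartAt 𝓘(ℝ, Cn n) x₀).target)
    {f : Cn n → ℝ} (hf : DifferentiableAt ℝ f y) :
    MDifferentiableAt 𝓘(ℝ, Cn n) 𝓘(ℝ, ℝ) (f ∘ extChartAt 𝓘(ℝ, Cn n) x₀)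
      ((extChartAt 𝓘(ℝ, Cn n) x₀).symm y) ∧ ∀ u : Cn n,
    (mfderiv 𝓘(ℝ, Cn n) 𝓘(ℝ, ℝ) (f ∘ extChartAt 𝓘(ℝ, Cn n) x₀)
      ((extChartAt 𝓘(ℝ, Cn n) x₀).symm y) : Cn n →L[ℝ] ℝ) (dsymm x₀ y u) = fderiv ℝ f y u := by
  have h₁ : HasMFDerivAt 𝓘(ℝ, Cn n) 𝓘(ℝ, Cn n) (extChartAt 𝓘(ℝ, Cn n) x₀)
      ((extChartAt 𝓘(ℝ, Cn n) x₀).symm y) (dchart x₀ ((extChartAt 𝓘(ℝ, Cn n) x₀).symm y)) :=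
    ((contMDiffAt_chart hy).mdifferentiableAt (by simp)).hasMFDerivAt
  have h₂ : HasMFDerivAt 𝓘(ℝ, Cn n) 𝓘(ℝ, ℝ) f
      (extChartAt 𝓘(ℝ, Cn n) x₀ ((extChartAt 𝓘(ℝ, Cn n) x₀).symm y)) (fderiv ℝ f y) := by
    rw [(extChartAt 𝓘(ℝ, Cn n) x₀).right_inv hy]
    exact hf.hasFDerivAt.hasMFDerivAt
  have h₃ := h₂.comp _ h₁
  refine ⟨h₃.mdifferentiableAt, fun u => ?_⟩
  rw [h₃.mfderiv]
  exact congrArg (fderiv ℝ f y) (DFunLike.congr_fun (mfderiv_comp_dsymm hy) u)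

/-- Chosen point by point, with junk value 0 off the chart and no regularity. The connection is
evaluated on locally defined coordinate fields, which only need to be differentiable at the point.
-/
theorem exists_christoffel (D : AffineConnection n M) (x₀ : M) :
    ∃ Γ : Cn n → Cn n →L[ℝ] Cn n →L[ℝ] Cn n, ∀ y ∈ (extChartAt 𝓘(ℝ, Cn n) x₀).target,
      ∀ u v : Cn n, dsymm x₀ y (Γ y u v) =
        D (liftField x₀ fun _ => v) ((extChartAt 𝓘(ℝ, Cn n) x₀).symm y) (dsymm x₀ y u) := by
  suffices h : ∀ y, ∃ Γ : Cn n →L[ℝ] Cn n →L[ℝ] Cn n, y ∈ (extChartAt 𝓘(ℝ, Cn n) x₀).target →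
      ∀ u v : Cn n, dsymm x₀ y (Γ u v) =
        D (liftField x₀ fun _ => v) ((extChartAt 𝓘(ℝ, Cn n) x₀).symm y) (dsymm x₀ y u) by
    choose Γ hΓ using h
    exact ⟨Γ, hΓ⟩
  intro y
  by_cases hy : y ∈ (extChartAt 𝓘(ℝ, Cn n) x₀).target
  swap
  · exact ⟨0, fun h => absurd h hy⟩
  set x := (extChartAt 𝓘(ℝ, Cn n) x₀).symm y
  have hd : ∀ v : Cn n, (liftField x₀ fun _ => v).DiffAt x := fun v =>
    diffAt_liftField hy contDiffAt_const
  let A : Cn n → Cn n →L[ℝ] Cn n := fun v => D (liftField x₀ fun _ => v) x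
  have hadd : ∀ v w, A (v + w) = A v + A w := fun v w => by
    have := D.isCovariantDerivativeOnUniv.add (hd v) (hd w)
    rw [← liftField_add] at this
    exact this
  have hsmul : ∀ (r : ℝ) v, A (r • v) = r • A v := fun r v => by
    have := D.isCovariantDerivativeOnUniv.smul_const r (hd v)
    have e : liftField x₀ (fun _ : Cn n => r • v) = r • liftField x₀ (fun _ : Cn n => v) :=
      liftField_smul x₀ (fun _ => r) (fun _ => v)
    change D (liftField x₀ fun _ => r • v) x = _
    rw [e]
    exact this
  let B : Cn n →ₗ[ℝ] Cn n →ₗ[ℝ] Cn n := LinearMap.mk₂ ℝ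
    (fun u v => dchart x₀ x (A v (dsymm x₀ y u)))
    (fun u u' v => by rw [map_add, map_add, map_add])
    (fun r u v => by rw [map_smul, map_smul, map_smul])
    (fun u v w => by rw [hadd, add_apply, map_add])
    (fun r u v => by rw [hsmul, smul_apply, map_smul])
  refine ⟨LinearMap.toContinuousLinearMap
    ((LinearMap.toContinuousLinearMap (𝕜 := ℝ) (E := Cn n) (F' := Cn n)).toLinearMap ∘ₗ B),
    fun _ u v => ?_⟩
  exact DFunLike.congr_fun (dsymm_comp_mfderiv hy) (A v (dsymm x₀ y u))

/-- `Γ` is the connection form of `D` in the chart around `x₀`. -/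
def IsChristoffel (D : AffineConnection n M) (x₀ : M) (Γ : Cn n → Cn n →L[ℝ] Cn n →L[ℝ] Cn n) :
    Prop :=
  ∀ y ∈ (extChartAt 𝓘(ℝ, Cn n) x₀).target, ∀ u v : Cn n, dsymm x₀ y (Γ y u v) =
    D (liftField x₀ fun _ => v) ((extChartAt 𝓘(ℝ, Cn n) x₀).symm y) (dsymm x₀ y u)

namespace IsChristoffel

variable {D : AffineConnection n M} {x₀ : M} {Γ : Cn n → Cn n →L[ℝ] Cn n →L[ℝ] Cn n} {y : Cn n}

theorem cov_smul_const (h : IsChristoffel D x₀ Γ)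
    (hy : y ∈ (extChartAt 𝓘(ℝ, Cn n) x₀).target) {f : Cn n → ℝ} (hf : ContDiffAt ℝ ∞ f y)
    (u v : Cn n) :
    (D (liftField x₀ (fun z => f z • v)) ((extChartAt 𝓘(ℝ, Cn n) x₀).symm y) : Cn n →L[ℝ] Cn n)
      (dsymm x₀ y u) = dsymm x₀ y (fderiv ℝ f y u • v + Γ y u (f y • v)) := by
  have hf' := mfderiv_comp_chart hy (hf.differentiableAt (by simp))
  have e : liftField x₀ (fun z => f z • v) =
      (f ∘ extChartAt 𝓘(ℝ, Cn n) x₀) • liftField x₀ (fun _ => v) := liftField_smul x₀ f fun _ => v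
  have := D.isCovariantDerivativeOnUniv.leibniz
    (diffAt_liftField (c := fun _ => v) hy contDiffAt_const) hf'.1
  rw [e]
  refine (DFunLike.congr_fun this (dsymm x₀ y u)).trans ?_
  rw [map_add, map_smul, map_smul, map_smul, h y hy, ← hf'.2 u]
  have e₂ : f y = f (extChartAt 𝓘(ℝ, Cn n) x₀ ((extChartAt 𝓘(ℝ, Cn n) x₀).symm y)) := by
    rw [(extChartAt 𝓘(ℝ, Cn n) x₀).right_inv hy]
  rw [e₂, add_comm]
  have e₃ : dsymm x₀ y v = liftField x₀ (fun _ => v) ((extChartAt 𝓘(ℝ, Cn n) x₀).symm y) :=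
    (liftField_symm hy fun _ => v).symm
  rw [e₃]
  rfl

/-- Additivity and the Leibniz rule are available only for differentiable fields, so the coordinate
expansion of `c` is summed by induction over finite sets, with smoothness of the partial sums
carried along. -/
theorem cov_liftField (h : IsChristoffel D x₀ Γ)
    (hy : y ∈ (extChartAt 𝓘(ℝ, Cn n) x₀).target) {c : Cn n → Cn n} (hc : ContDiffAt ℝ ∞ c y)
    (u : Cn n) :
    (D (liftField x₀ c) ((extChartAt 𝓘(ℝ, Cn n) x₀).symm y) : Cn n →L[ℝ] Cn n)
      (dsymm x₀ y u) = dsymm x₀ y (fderiv ℝ c y u + Γ y u (c y)) := by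
  let b := Module.finBasis ℝ (Cn n)
  have hcoord : ∀ i, ContDiffAt ℝ ∞ (fun z => b.coord i (c z)) y := fun i =>
    (LinearMap.toContinuousLinearMap (b.coord i)).contDiff.contDiffAt.comp y hc
  have key : ∀ s : Finset (Fin (Module.finrank ℝ (Cn n))),
      ContDiffAt ℝ ∞ (fun z => ∑ i ∈ s, b.coord i (c z) • b i) y ∧
      (D (liftField x₀ (fun z => ∑ i ∈ s, b.coord i (c z) • b i))
        ((extChartAt 𝓘(ℝ, Cn n) x₀).symm y) : Cn n →L[ℝ] Cn n) (dsymm x₀ y u) =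
      dsymm x₀ y (fderiv ℝ (fun z => ∑ i ∈ s, b.coord i (c z) • b i) y u +
        Γ y u (∑ i ∈ s, b.coord i (c y) • b i)) := by
    intro s
    induction s using Finset.induction_on with
    | empty =>
      refine ⟨by simpa using contDiffAt_const, ?_⟩
      have := h.cov_smul_const hy (f := fun _ => (0 : ℝ)) contDiffAt_const u 0
      simpa using this
    | insert i s hi ih =>
      obtain ⟨ih₁, ih₂⟩ := ih
      have e : (fun z => ∑ i ∈ insert i s, b.coord i (c z) • b i) =
          (fun z => b.coord i (c z) • b i) + fun z => ∑ i ∈ s, b.coord i (c z) • b i := by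
        funext z
        rw [Finset.sum_insert hi]
        rfl
      have h₁ : ContDiffAt ℝ ∞ (fun z => b.coord i (c z) • b i) y := (hcoord i).smul contDiffAt_const
      have h₂ := D.isCovariantDerivativeOnUniv.add (diffAt_liftField hy h₁) (diffAt_liftField hy ih₁)
      rw [e]
      refine ⟨h₁.add ih₁, ?_⟩
      rw [liftField_add]
      refine (DFunLike.congr_fun h₂ (dsymm x₀ y u)).trans ?_
      rw [Finset.sum_insert hi, fderiv_add (h₁.differentiableAt (by simp))
        (ih₁.differentiableAt (by simp)), map_add (Γ y u), add_apply]
      refine (congrArg₂ (· + ·) (h.cov_smul_const hy (hcoord i) u (b i)) ih₂).trans ?_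
      have e₂ : fderiv ℝ (fun z => b.coord i (c z) • b i) y u =
          fderiv ℝ (fun z => b.coord i (c z)) y u • b i := by
        rw [fderiv_smul_const ((hcoord i).differentiableAt (by simp))]
        rfl
      simp only [e₂, map_add]
      abel
  have hs : (fun z => ∑ i, b.coord i (c z) • b i) = c := by
    funext z
    exact b.sum_repr (c z)
  have := (key Finset.univ).2
  rw [hs] at this
  rw [this]
  congr 3
  exact b.sum_repr (c y)

end IsChristoffel

end Christoffel

end BismutFlat

namespace BismutFlat

/-! ### The metric, the torsion and flatness read in a chart -/

section ChartMetric

variable {n : ℕ} {M : Type*} [TopologicalSpace M] [ChartedSpace (Cn n) M]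
  [IsManifold 𝓘(ℂ, Cn n) ω M] (g : HermitianMetric n M)

/-- The metric at a point, as a bilinear form on `ℂⁿ`. -/
def metricAt (x : M) : Cn n →L[ℝ] Cn n →L[ℝ] ℝ := g.inner x

/-- The metric in the chart around `x₀`. -/
def chartMetric (x₀ : M) (y : Cn n) : Cn n →L[ℝ] Cn n →L[ℝ] ℝ :=
  (metricAt g ((extChartAt 𝓘(ℝ, Cn n) x₀).symm y)).bilinearComp (dsymm x₀ y) (dsymm x₀ y)

theorem chartMetric_apply (x₀ : M) (y v w : Cn n) : chartMetric g x₀ y v w =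
    metricAt g ((extChartAt 𝓘(ℝ, Cn n) x₀).symm y) (dsymm x₀ y v) (dsymm x₀ y w) := rfl

theorem contMDiffAt_inner {Y Z : VField n M} {x : M}
    (hY : ContMDiffAt 𝓘(ℝ, Cn n) (𝓘(ℝ, Cn n).prod 𝓘(ℝ, Cn n)) ∞
      (fun y => (⟨y, Y y⟩ : TangentBundle 𝓘(ℝ, Cn n) M)) x)
    (hZ : ContMDiffAt 𝓘(ℝ, Cn n) (𝓘(ℝ, Cn n).prod 𝓘(ℝ, Cn n)) ∞
      (fun y => (⟨y, Z y⟩ : TangentBundle 𝓘(ℝ, Cn n) M)) x) :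
    ContMDiffAt 𝓘(ℝ, Cn n) 𝓘(ℝ, ℝ) ∞ (fun y => g.inner y (Y y) (Z y)) x := by
  have h := ContMDiffAt.clm_bundle_apply₂ (F₁ := Cn n) (F₂ := Cn n) (F₃ := ℝ)
    (E₁ := fun x : M => TangentSpace 𝓘(ℝ, Cn n) x) (E₂ := fun x : M => TangentSpace 𝓘(ℝ, Cn n) x)
    (E₃ := Bundle.Trivial M ℝ) (b := fun m : M => m) (g.contMDiff x) hY hZ
  simp only [Bundle.contMDiffAt_totalSpace] at h
  exact h.2

theorem contDiffOn_chartMetric (x₀ : M) :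
    ContDiffOn ℝ ∞ (chartMetric g x₀) (extChartAt 𝓘(ℝ, Cn n) x₀).target := by
  refine contDiffOn_clm_apply.mpr fun v => contDiffOn_clm_apply.mpr fun w => ?_
  refine ContMDiffOn.contDiffOn (E := Cn n) (E' := ℝ) fun y hy => ?_
  have h := contMDiffAt_inner g (contMDiffAt_liftField (c := fun _ => v) hy contDiffAt_const)
    (contMDiffAt_liftField (c := fun _ => w) hy contDiffAt_const)
  have h₂ := h.comp_contMDiffWithinAt y
    ((contMDiffOn_extChartAt_symm (I := 𝓘(ℝ, Cn n)) (n := ∞) x₀) y hy)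
  refine h₂.congr (fun z hz => ?_) ?_
  · exact (congrArg₂ (fun a b => metricAt g ((extChartAt 𝓘(ℝ, Cn n) x₀).symm z) a b)
      (liftField_symm hz fun _ => v) (liftField_symm hz fun _ => w)).symm
  · exact (congrArg₂ (fun a b => metricAt g ((extChartAt 𝓘(ℝ, Cn n) x₀).symm y) a b)
      (liftField_symm hy fun _ => v) (liftField_symm hy fun _ => w)).symm

theorem metricAt_J (x : M) (v w : Cn n) :
    metricAt g x (mulI n v) (mulI n w) = metricAt g x v w := g.hermitian x v w

theorem metricAt_symm (x : M) (v w : Cn n) : metricAt g x v w = metricAt g x w v := g.symm x v w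

theorem metricAt_pos (x : M) (v : Cn n) (hv : v ≠ 0) : 0 < metricAt g x v v := g.pos x v hv

/-- The torsion of `D` at a point. -/
def torsAt (D : AffineConnection n M) (x : M) : Cn n →L[ℝ] Cn n →L[ℝ] Cn n := D.torsion x

theorem eventually_symm {x₀ : M} {y : Cn n} (hy : y ∈ (extChartAt 𝓘(ℝ, Cn n) x₀).target)
    {p : M → Prop}
    (h : ∀ z ∈ (extChartAt 𝓘(ℝ, Cn n) x₀).target, p ((extChartAt 𝓘(ℝ, Cn n) x₀).symm z)) :
    ∀ᶠ x in nhds ((extChartAt 𝓘(ℝ, Cn n) x₀).symm y), p x := by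
  filter_upwards [(isOpen_extChartAt_source x₀).mem_nhds
    ((extChartAt 𝓘(ℝ, Cn n) x₀).map_target hy)] with x hx
  have := h _ ((extChartAt 𝓘(ℝ, Cn n) x₀).map_source hx)
  rwa [(extChartAt 𝓘(ℝ, Cn n) x₀).left_inv hx] at this

variable {g} {D : AffineConnection n M} {x₀ : M} {Γ : Cn n → Cn n →L[ℝ] Cn n →L[ℝ] Cn n} {y : Cn n}

/-- Evaluate the torsion on coordinate fields, for which the bracket term drops. -/
theorem IsChristoffel.torsAt_eq (h : IsChristoffel D x₀ Γ)
    (hy : y ∈ (extChartAt 𝓘(ℝ, Cn n) x₀).target) (u v : Cn n) :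
    torsAt D ((extChartAt 𝓘(ℝ, Cn n) x₀).symm y) (dsymm x₀ y u) (dsymm x₀ y v) =
      dsymm x₀ y (tors (Γ y) u v) := by
  have h₁ := D.torsion_apply (diffAt_liftField (c := fun _ => u) hy contDiffAt_const)
    (diffAt_liftField (c := fun _ => v) hy contDiffAt_const)
  rw [liftField_symm hy, liftField_symm hy, mlieBracket_liftField_const hy] at h₁
  refine h₁.trans ?_
  rw [tors_apply, map_sub, h y hy, h y hy]
  exact sub_zero _

theorem IsChristoffel.metric (h : IsChristoffel D x₀ Γ) (hD : PreservesMetric g D)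
    (hy : y ∈ (extChartAt 𝓘(ℝ, Cn n) x₀).target) (u v w : Cn n) :
    fderiv ℝ (chartMetric g x₀) y u v w =
      chartMetric g x₀ y (Γ y u v) w + chartMetric g x₀ y v (Γ y u w) := by
  have hd : DifferentiableAt ℝ (chartMetric g x₀) y :=
    ((contDiffOn_chartMetric g x₀).contDiffAt
      ((isOpen_extChartAt_target x₀).mem_nhds hy)).differentiableAt (by simp)
  have hd' : DifferentiableAt ℝ (fun z => chartMetric g x₀ z v w) y :=
    (hd.clm_apply (differentiableAt_const v)).clm_apply (differentiableAt_const w)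
  have h₁ := hD _ _ _ (diffAt_liftField (c := fun _ => v) hy contDiffAt_const)
    (diffAt_liftField (c := fun _ => w) hy contDiffAt_const) (dsymm x₀ y u)
  rw [← fderiv_clm_apply_const₂ hd, ← (mfderiv_comp_chart hy hd').2 u]
  have e : (fun x => g.inner x (liftField x₀ (fun _ => v) x) (liftField x₀ (fun _ => w) x)) =ᶠ[
      nhds ((extChartAt 𝓘(ℝ, Cn n) x₀).symm y)]
      (fun z => chartMetric g x₀ z v w) ∘ extChartAt 𝓘(ℝ, Cn n) x₀ := by
    refine eventually_symm hy fun z hz => ?_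
    change metricAt g _ _ _ = chartMetric g x₀ (extChartAt 𝓘(ℝ, Cn n) x₀
      ((extChartAt 𝓘(ℝ, Cn n) x₀).symm z)) v w
    rw [(extChartAt 𝓘(ℝ, Cn n) x₀).right_inv hz, liftField_symm hz, liftField_symm hz]
    rfl
  rw [e.mfderiv_eq, liftField_symm hy, liftField_symm hy] at h₁
  refine h₁.trans ?_
  rw [chartMetric_apply, chartMetric_apply, h y hy, h y hy]
  rfl

theorem IsChristoffel.complex (h : IsChristoffel D x₀ Γ) (hD : PreservesComplexStructure D)
    (hy : y ∈ (extChartAt 𝓘(ℝ, Cn n) x₀).target) (u v : Cn n) :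
    Γ y u (mulI n v) = mulI n (Γ y u v) := by
  apply dsymm_injective hy
  rw [dsymm_mulI hy, h y hy, h y hy]
  have hd := diffAt_liftField (c := fun _ => v) hy contDiffAt_const
  have hd' := diffAt_liftField (c := fun _ => mulI n v) hy contDiffAt_const
  have e : (fun x => complexStructure n x (liftField x₀ (fun _ => v) x)) =ᶠ[
      nhds ((extChartAt 𝓘(ℝ, Cn n) x₀).symm y)] liftField x₀ (fun _ => mulI n v) := by
    refine eventually_symm hy fun z hz => ?_
    change mulI n _ = _
    rw [liftField_symm hz, liftField_symm hz, dsymm_mulI hz]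
  have hd₂ : VField.DiffAt (fun x => complexStructure n x (liftField x₀ (fun _ => v) x))
      ((extChartAt 𝓘(ℝ, Cn n) x₀).symm y) := by
    refine MDifferentiableAt.congr_of_eventuallyEq hd' ?_
    filter_upwards [e] with x hx
    rw [hx]
  have h₁ := hD _ _ hd (dsymm x₀ y u)
  rw [cov_congr D hd₂ hd' e] at h₁
  exact h₁

theorem IsChristoffel.isBismutChart (h : IsChristoffel D x₀ Γ) (hD : IsBismutConnection g D) :
    IsBismutChart (extChartAt 𝓘(ℝ, Cn n) x₀).target (chartMetric g x₀) (mulI n) Γ where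
  isOpen := isOpen_extChartAt_target x₀
  contDiffOn_metric := contDiffOn_chartMetric g x₀
  symm := fun y _ v w => metricAt_symm g _ _ _
  pos := fun y hy v hv => metricAt_pos g _ _ fun h0 => hv (dsymm_injective hy (h0.trans (map_zero (dsymm x₀ y)).symm))
  sq := mulI_mulI
  hermitian := fun y hy v w => by
    rw [chartMetric_apply, dsymm_mulI hy, dsymm_mulI hy, metricAt_J]
    rfl
  metric := fun y hy => h.metric hD.metric hy
  complex := fun y hy => h.complex hD.complex hy
  skew := fun y hy => by
    constructor
    · intro u v
      rw [tors_apply, tors_apply, neg_sub]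
    · intro u v w
      rw [chartMetric_apply, chartMetric_apply, ← h.torsAt_eq hy, ← h.torsAt_eq hy]
      exact hD.torsion _ _ _ _

/-- Flatness is stated for globally smooth fields, so coordinate fields are cut off by a bump
function equal to 1 near the point. -/
theorem exists_smooth_eventuallyEq [T2Space M] {x₀ : M} {y : Cn n}
    (hy : y ∈ (extChartAt 𝓘(ℝ, Cn n) x₀).target) (v : Cn n) :
    ∃ Y : VField n M, Y.Smooth ∧
      ∀ᶠ z in nhds ((extChartAt 𝓘(ℝ, Cn n) x₀).symm y), Y z = liftField x₀ (fun _ => v) z := by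
  set x := (extChartAt 𝓘(ℝ, Cn n) x₀).symm y
  have hx : (extChartAt 𝓘(ℝ, Cn n) x₀).source ∈ nhds x :=
    (isOpen_extChartAt_source x₀).mem_nhds ((extChartAt 𝓘(ℝ, Cn n) x₀).map_target hy)
  obtain ⟨f, -, hf⟩ := (SmoothBumpFunction.nhds_basis_tsupport (I := 𝓘(ℝ, Cn n)) x).mem_iff.mp hx
  refine ⟨(f : M → ℝ) • liftField x₀ (fun _ => v), ?_, ?_⟩
  · refine ContMDiffOn.smul_section_of_tsupport (u := (extChartAt 𝓘(ℝ, Cn n) x₀).source)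
      (V := fun x : M => TangentSpace 𝓘(ℝ, Cn n) x) (n := ∞)
      f.contMDiff.contMDiffOn (isOpen_extChartAt_source x₀) hf fun z hz => ?_
    have := contMDiffAt_liftField (c := fun _ => v)
      ((extChartAt 𝓘(ℝ, Cn n) x₀).map_source hz) contDiffAt_const
    rw [(extChartAt 𝓘(ℝ, Cn n) x₀).left_inv hz] at this
    exact this.contMDiffWithinAt
  · filter_upwards [f.eventuallyEq_one] with z hz
    change f z • liftField x₀ (fun _ => v) z = liftField x₀ (fun _ => v) z
    rw [hz]
    exact one_smul ℝ (liftField x₀ (fun _ => v) z)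

theorem diffAt_of_smooth {Y : VField n M} (hY : Y.Smooth) (x : M) : Y.DiffAt x :=
  (hY x).mdifferentiableAt (by simp)

theorem IsChristoffel.isFlatChart [T2Space M] (h : IsChristoffel D x₀ Γ)
    (hΓ : ContDiffOn ℝ ∞ Γ (extChartAt 𝓘(ℝ, Cn n) x₀).target) (hD : IsFlatConnection D) :
    IsFlatChart (extChartAt 𝓘(ℝ, Cn n) x₀).target Γ := by
  intro y hy u v w
  have hΓd : DifferentiableAt ℝ Γ y :=
    (hΓ.contDiffAt ((isOpen_extChartAt_target x₀).mem_nhds hy)).differentiableAt (by simp)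
  obtain ⟨X, hX, hXe⟩ := exists_smooth_eventuallyEq hy u
  obtain ⟨Y, hY, hYe⟩ := exists_smooth_eventuallyEq hy v
  obtain ⟨Z, hZ, hZe⟩ := exists_smooth_eventuallyEq hy w
  set x := (extChartAt 𝓘(ℝ, Cn n) x₀).symm y
  have hl : ∀ v : Cn n, (liftField x₀ fun _ => v).DiffAt x := fun v =>
    diffAt_liftField hy contDiffAt_const
  have key : ∀ {Y : VField n M} {u v : Cn n}, Y.Smooth →
      (∀ᶠ z in nhds x, Y z = liftField x₀ (fun _ => v) z) →
      (D (fun z => D Z z (Y z)) x : Cn n →L[ℝ] Cn n) (dsymm x₀ y u) =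
        dsymm x₀ y (fderiv ℝ Γ y u v w + Γ y u (Γ y v w)) := by
    intro Y u v hY hYe
    have hc : ContDiffAt ℝ ∞ (fun z => Γ z v w) y :=
      ((hΓ.contDiffAt ((isOpen_extChartAt_target x₀).mem_nhds hy)).clm_apply
        contDiffAt_const).clm_apply contDiffAt_const
    have hd' := diffAt_liftField hy hc
    -- The inner derivative must be known on a whole neighbourhood, because the outer one
    -- differentiates it.
    have e : ∀ᶠ z in nhds x, D Z z (Y z) = liftField x₀ (fun z => Γ z v w) z := by
      have e₀ : ∀ᶠ z in nhds x, D (liftField x₀ fun _ => w) z (liftField x₀ (fun _ => v) z) =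
          liftField x₀ (fun z => Γ z v w) z := by
        refine eventually_symm hy fun z hz => ?_
        rw [liftField_symm hz, liftField_symm hz, h z hz]
      have e₁ : ∀ᶠ z in nhds x, (liftField x₀ fun _ => w).DiffAt z :=
        eventually_symm hy fun z hz => diffAt_liftField hz contDiffAt_const
      filter_upwards [e₀, e₁, hYe, hZe.eventually_nhds] with z h₀ h₁ h₂ h₃
      rw [cov_congr D (diffAt_of_smooth hZ z) h₁ h₃, h₂, h₀]
    have hd : VField.DiffAt (fun z => D Z z (Y z)) x := by
      refine MDifferentiableAt.congr_of_eventuallyEq hd' ?_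
      filter_upwards [e] with z hz
      rw [hz]
    rw [cov_congr D hd hd' e]
    rw [h.cov_liftField hy hc, fderiv_clm_apply_const₂ hΓd]
  have hR := hD X Y Z hX hY hZ x
  have hb : VectorField.mlieBracket 𝓘(ℝ, Cn n) X Y x = 0 := by
    rw [Filter.EventuallyEq.mlieBracket_vectorField_eq hXe hYe]
    exact mlieBracket_liftField_const hy u v
  rw [curvature, hb, map_zero, sub_zero, sub_eq_zero, hXe.self_of_nhds, hYe.self_of_nhds,
    liftField_symm hy, liftField_symm hy] at hR
  exact dsymm_injective hy ((key hY hYe).symm.trans (hR.trans (key hX hXe)))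

end ChartMetric

end BismutFlat

namespace BismutFlat

/-! ### The exterior derivative of powers of the Kähler form in a chart -/

section LeeForm

variable {E : Type*} [NormedAddCommGroup E] [NormedSpace ℝ E] [FiniteDimensional ℝ E]

variable (E) in
/-- The trace as a continuous linear map. -/
def traceL : (E →L[ℝ] E) →L[ℝ] ℝ :=
  LinearMap.toContinuousLinearMap
    (LinearMap.trace ℝ E ∘ₗ ContinuousLinearMap.coeLM ℝ)

theorem traceL_comp_comm (f f' : E →L[ℝ] E) : traceL E (f ∘L f') = traceL E (f' ∘L f) :=
  LinearMap.trace_mul_comm ℝ f.toLinearMap f'.toLinearMap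

/-- The 1-form `-1/2 tr(J ∘ T(v, ·))`. -/
def rhoForm (J : E →L[ℝ] E) : (E →L[ℝ] E →L[ℝ] E) →L[ℝ] E →L[ℝ] ℝ :=
  ContinuousLinearMap.compL ℝ E (E →L[ℝ] E) ℝ
    ((-(1 / 2) : ℝ) • (traceL E ∘L ContinuousLinearMap.compL ℝ E E E J))

theorem rhoForm_apply (J : E →L[ℝ] E) (T : E →L[ℝ] E →L[ℝ] E) (v : E) :
    rhoForm J T v = -(1 / 2) * traceL E (J ∘L T v) := rfl

/-- The 1-form `1/2 tr(J ∘ T(Jv, ·))`. -/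
def lambdaForm (J : E →L[ℝ] E) : (E →L[ℝ] E →L[ℝ] E) →L[ℝ] E →L[ℝ] ℝ :=
  -(ContinuousLinearMap.compL ℝ E E ℝ).flip J ∘L rhoForm J

theorem lambdaForm_apply (J : E →L[ℝ] E) (T : E →L[ℝ] E →L[ℝ] E) (v : E) :
    lambdaForm J T v = -rhoForm J T (J v) := rfl

namespace IsBismutChart

variable {U : Set E} {G : E → E →L[ℝ] E →L[ℝ] ℝ} {J : E →L[ℝ] E} {Γ : E → E →L[ℝ] E →L[ℝ] E}
  {y : E} {ι : Type*} [Fintype ι] [DecidableEq ι] {b : Module.Basis ι ℝ E}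

theorem rhoForm_eq (h : IsBismutChart U G J Γ) (hy : y ∈ U) (hb : IsOrthonormal (G y) b) :
    rhoForm J (tors (Γ y)) = G y (traceVec b J (tors (Γ y))) := by
  ext v
  exact trace_J_comp hb h.sq (h.hermitian y hy) (h.skew y hy) v

theorem lambdaForm_eq (h : IsBismutChart U G J Γ) (hy : y ∈ U) (hb : IsOrthonormal (G y) b) :
    lambdaForm J (tors (Γ y)) = (G y ∘L J) (traceVec b J (tors (Γ y))) := by
  ext v
  rw [lambdaForm_apply, h.rhoForm_eq hy hb]
  exact (inner_J_left h.sq (h.hermitian y hy) _ _).symm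

theorem isParallelAt_kahler (h : IsBismutChart U G J Γ) (hy : y ∈ U)
    (hb : IsOrthonormal (G y) b) (k : ℕ) :
    IsParallelAt (G y) b (Γ y) (fun z => wedgePow (G z ∘L J) k) y := by
  refine isParallelAt_wedgePow (B := fun z => G z ∘L J)
    (B' := (ContinuousLinearMap.compL ℝ E E (E →L[ℝ] ℝ)).flip J ∘L fderiv ℝ G y) hb (h.symm y hy)
    ((((ContinuousLinearMap.compL ℝ E E (E →L[ℝ] ℝ)).flip J).hasFDerivAt).comp y
      (h.differentiableAt_metric hy).hasFDerivAt) (fun u v w => ?_) k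
  change fderiv ℝ G y u (J v) w = G y (J (Γ y u v)) w + G y (J v) (Γ y u w)
  rw [h.metric y hy, h.complex y hy]

theorem fderiv_tors (h : IsBismutChart U G J Γ) (hflat : IsFlatChart U Γ) (hy : y ∈ U) (u v w : E) :
    fderiv ℝ (fun z => tors (Γ z)) y u v w =
      tors (Γ y) (Γ y u v) w + tors (Γ y) v (Γ y u w) - Γ y u (tors (Γ y) v w) := by
  have := h.covTors_eq_zero hflat hy u v w
  rw [covTors_apply] at this
  rw [← sub_eq_zero, ← this]
  abel

/-- Since ∇T = 0 and `J` is parallel, the derivative of `J ∘ T(v, ·)` differs from the expected term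
by a commutator with `Γ y u`, which is traceless. So `ρ` is parallel. -/
theorem rhoForm_fderiv (h : IsBismutChart U G J Γ) (hflat : IsFlatChart U Γ) (hy : y ∈ U) (u v : E) :
    rhoForm J (fderiv ℝ (fun z => tors (Γ z)) y u) v = rhoForm J (tors (Γ y)) (Γ y u v) := by
  have e : J ∘L fderiv ℝ (fun z => tors (Γ z)) y u v =
      J ∘L tors (Γ y) (Γ y u v) + ((J ∘L tors (Γ y) v) ∘L Γ y u - Γ y u ∘L (J ∘L tors (Γ y) v)) := by
    ext w
    change J (fderiv ℝ (fun z => tors (Γ z)) y u v w) = J (tors (Γ y) (Γ y u v) w) +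
      (J (tors (Γ y) v (Γ y u w)) - Γ y u (J (tors (Γ y) v w)))
    rw [h.fderiv_tors hflat hy, map_sub, map_add, h.complex y hy]
    abel
  rw [rhoForm_apply, rhoForm_apply, e, map_add, map_sub, traceL_comp_comm (Γ y u), sub_self, add_zero]

theorem hasFDerivAt_rhoForm (h : IsBismutChart U G J Γ) (hy : y ∈ U) :
    HasFDerivAt (fun z => rhoForm J (tors (Γ z)))
      (rhoForm J ∘L fderiv ℝ (fun z => tors (Γ z)) y) y :=
  (rhoForm J).hasFDerivAt.comp y (h.differentiableAt_tors hy).hasFDerivAt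

theorem hasFDerivAt_lambdaForm (h : IsBismutChart U G J Γ) (hy : y ∈ U) :
    HasFDerivAt (fun z => lambdaForm J (tors (Γ z)))
      (lambdaForm J ∘L fderiv ℝ (fun z => tors (Γ z)) y) y :=
  (lambdaForm J).hasFDerivAt.comp y (h.differentiableAt_tors hy).hasFDerivAt

theorem isParallelAt_rho_wedge (h : IsBismutChart U G J Γ) (hflat : IsFlatChart U Γ) (hy : y ∈ U)
    (hb : IsOrthonormal (G y) b) (k : ℕ) : IsParallelAt (G y) b (Γ y)
      (fun z => wedgeL (2 * k) (rhoForm J (tors (Γ z))) (wedgePow (G z ∘L J) k)) y :=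
  IsParallelAt.wedge (h.hasFDerivAt_rhoForm hy) hb (h.symm y hy) (h.rhoForm_fderiv hflat hy)
    (h.isParallelAt_kahler hy hb k)

theorem isParallelAt_lambda_wedge (h : IsBismutChart U G J Γ) (hflat : IsFlatChart U Γ) (hy : y ∈ U)
    (hb : IsOrthonormal (G y) b) (k : ℕ) : IsParallelAt (G y) b (Γ y)
      (fun z => wedgeL (2 * k) (lambdaForm J (tors (Γ z))) (wedgePow (G z ∘L J) k)) y := by
  refine IsParallelAt.wedge (h.hasFDerivAt_lambdaForm hy) hb (h.symm y hy) (fun u v => ?_)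
    (h.isParallelAt_kahler hy hb k)
  rw [lambdaForm_apply, ← h.complex y hy, ← h.rhoForm_fderiv hflat hy]
  rfl

/-- Only metric compatibility, `∇J = 0` and skew torsion enter; flatness is not needed here. In the
application `k + 1 = n`. -/
theorem extDeriv_kahlerPow (h : IsBismutChart U G J Γ) (hy : y ∈ U) {k : ℕ}
    (hk : Module.finrank ℝ E = 2 * (k + 1)) :
    extDeriv (fun z => wedgePow (G z ∘L J) k) y =
      wedgeL (2 * k) (lambdaForm J (tors (Γ y))) (wedgePow (G y ∘L J) k) := by
  obtain ⟨b, hb⟩ := exists_isOrthonormal (h.symm y hy) (h.pos y hy)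
  refine single_injective (2 * k + 1) ?_
  rw [(h.isParallelAt_kahler hy hb k).single_extDeriv hb (h.symm y hy)]
  refine (parallelExtDeriv_powForm hb (h.symm y hy) h.sq (h.hermitian y hy) (h.skew y hy)
    (tors_apply (Γ y)) (by rw [Fintype.card_fin, hk])).trans ?_
  rw [← h.lambdaForm_eq hy hb, powForm, eps_single]

theorem extDeriv_rho_wedge (h : IsBismutChart U G J Γ) (hflat : IsFlatChart U Γ) (hy : y ∈ U) {k : ℕ}
    (hk : Module.finrank ℝ E = 2 * (k + 1)) : extDeriv
      (fun z => wedgeL (2 * k) (rhoForm J (tors (Γ z))) (wedgePow (G z ∘L J) k)) y = 0 := by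
  obtain ⟨b, hb⟩ := exists_isOrthonormal (h.symm y hy) (h.pos y hy)
  exact (h.isParallelAt_rho_wedge hflat hy hb k).extDeriv_eq_zero_of_card hb (h.symm y hy)
    (tors_apply (Γ y)) (h.skew y hy) (by rw [Fintype.card_fin, hk]; ring)

theorem extDeriv_lambda_wedge (h : IsBismutChart U G J Γ) (hflat : IsFlatChart U Γ) (hy : y ∈ U)
    {k : ℕ} (hk : Module.finrank ℝ E = 2 * (k + 1)) : extDeriv
      (fun z => wedgeL (2 * k) (lambdaForm J (tors (Γ z))) (wedgePow (G z ∘L J) k)) y = 0 := by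
  obtain ⟨b, hb⟩ := exists_isOrthonormal (h.symm y hy) (h.pos y hy)
  exact (h.isParallelAt_lambda_wedge hflat hy hb k).extDeriv_eq_zero_of_card hb (h.symm y hy)
    (tors_apply (Γ y)) (h.skew y hy) (by rw [Fintype.card_fin, hk]; ring)

theorem differentiableAt_kahlerPow (h : IsBismutChart U G J Γ) (hy : y ∈ U) (k : ℕ) :
    DifferentiableAt ℝ (fun z => wedgePow (G z ∘L J) k) y := by
  obtain ⟨b, hb⟩ := exists_isOrthonormal (h.symm y hy) (h.pos y hy)
  obtain ⟨D, hD, -⟩ := h.isParallelAt_kahler hy hb k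
  exact hD.differentiableAt

theorem differentiableAt_rho_wedge (h : IsBismutChart U G J Γ) (hy : y ∈ U) (k : ℕ) :
    DifferentiableAt ℝ
      (fun z => wedgeL (2 * k) (rhoForm J (tors (Γ z))) (wedgePow (G z ∘L J) k)) y := by
  obtain ⟨D, hD, -⟩ := exists_hasFDerivAt_wedgeL (h.hasFDerivAt_rhoForm hy)
    (h.differentiableAt_kahlerPow hy k).hasFDerivAt
  exact hD.differentiableAt

theorem differentiableAt_lambda_wedge (h : IsBismutChart U G J Γ) (hy : y ∈ U) (k : ℕ) :
    DifferentiableAt ℝ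
      (fun z => wedgeL (2 * k) (lambdaForm J (tors (Γ z))) (wedgePow (G z ∘L J) k)) y := by
  obtain ⟨D, hD, -⟩ := exists_hasFDerivAt_wedgeL (h.hasFDerivAt_lambdaForm hy)
    (h.differentiableAt_kahlerPow hy k).hasFDerivAt
  exact hD.differentiableAt

/-- The torsion vanishes where the Lee form does. -/
theorem tors_eq_zero (h : IsBismutChart U G J Γ) (hflat : IsFlatChart U Γ) (hy : y ∈ U) {k : ℕ}
    (hk : Module.finrank ℝ E = 2 * (k + 1))
    (h0 : extDeriv (fun z => wedgePow (G z ∘L J) k) y = 0) : tors (Γ y) = 0 := by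
  obtain ⟨b, hb⟩ := exists_isOrthonormal (h.symm y hy) (h.pos y hy)
  have hB := kahler_swap (h.symm y hy) h.sq (h.hermitian y hy)
  have hcard : Fintype.card (Fin (Module.finrank ℝ E)) = 2 * (k + 1) := by
    rw [Fintype.card_fin, hk]
  refine eq_zero_of_traceVec_eq_zero hb (h.symm y hy) (h.pos y hy) h.sq (h.hermitian y hy)
    (h.skew y hy) (h.isIntegrable hy) (h.cyc_tors_eq_zero hflat hy) ?_
  refine eq_zero_of_iota_powForm_top hb (h.symm y hy) (h.pos y hy) hB
    (kahler_surjective h.sq) hcard ?_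
  rw [iota_powForm_succ hb (h.symm y hy) hB, ← h.lambdaForm_eq hy hb, powForm, eps_single,
    ← h.extDeriv_kahlerPow hy hk, h0, map_zero, smul_zero]

theorem extDeriv_kahlerPow_eq_zero (h : IsBismutChart U G J Γ) (hy : y ∈ U)
    (hT : tors (Γ y) = 0) (k : ℕ) : extDeriv (fun z => wedgePow (G z ∘L J) k) y = 0 := by
  obtain ⟨b, hb⟩ := exists_isOrthonormal (h.symm y hy) (h.pos y hy)
  refine (h.isParallelAt_kahler hy hb k).extDeriv_eq_zero_of_torsion hb (h.symm y hy) fun u v => ?_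
  rw [← sub_eq_zero, ← tors_apply, hT]
  rfl

end IsBismutChart

end LeeForm

end BismutFlat

namespace BismutFlat

/-! ### The torsions of the Chern and the Bismut connection -/

section Pointwise

variable {n : ℕ} {M : Type*} [TopologicalSpace M] [ChartedSpace (Cn n) M]
  [IsManifold 𝓘(ℂ, Cn n) ω M] {g : HermitianMetric n M} {D Dc : AffineConnection n M}

theorem symm_extChartAt_self (x : M) :
    (extChartAt 𝓘(ℝ, Cn n) x).symm (extChartAt 𝓘(ℝ, Cn n) x x) = x := extChartAt_to_inv x

theorem chartMetric_self (x : M) :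
    chartMetric g x (extChartAt 𝓘(ℝ, Cn n) x x) = metricAt g x := by
  ext v w
  rw [chartMetric_apply, dsymm_self, symm_extChartAt_self]
  rfl

theorem IsChristoffel.tors_self {x : M} {Γ : Cn n → Cn n →L[ℝ] Cn n →L[ℝ] Cn n}
    (h : IsChristoffel D x Γ) : tors (Γ (extChartAt 𝓘(ℝ, Cn n) x x)) = torsAt D x := by
  refine ContinuousLinearMap.ext fun u => ContinuousLinearMap.ext fun v => ?_
  have := h.torsAt_eq (mem_extChartAt_target x) u v
  rw [dsymm_self, symm_extChartAt_self] at this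
  exact this.symm

theorem isSkew_torsAt (hD : IsBismutConnection g D) (x : M) :
    IsSkew (metricAt g x) (torsAt D x) := by
  obtain ⟨Γ, hΓ : IsChristoffel D x Γ⟩ := exists_christoffel D x
  have := (hΓ.isBismutChart hD).skew _ (mem_extChartAt_target x)
  rwa [chartMetric_self, hΓ.tors_self] at this

theorem isIntegrable_torsAt (hD : IsBismutConnection g D) (x : M) :
    IsIntegrable (mulI n) (torsAt D x) := by
  obtain ⟨Γ, hΓ : IsChristoffel D x Γ⟩ := exists_christoffel D x
  have := (hΓ.isBismutChart hD).isIntegrable (mem_extChartAt_target x)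
  rwa [hΓ.tors_self] at this

theorem cyc_torsAt [T2Space M] (hD : IsBismutConnection g D) (hflat : IsFlatConnection D) (x : M)
    (u v w : Cn n) : cyc (torsAt D x) (torsAt D x) u v w = 0 := by
  obtain ⟨Γ, hΓ : IsChristoffel D x Γ⟩ := exists_christoffel D x
  have h := hΓ.isBismutChart hD
  have := h.cyc_tors_eq_zero (hΓ.isFlatChart h.contDiffOn hflat) (mem_extChartAt_target x) u v w
  rwa [hΓ.tors_self] at this

/-- Two connections preserving `g` and `J` differ by a tensor skew for `g` and commuting with `J`,
read off as a difference of connection forms at the centre of the chart. -/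
theorem chern_torsAt (hD : IsBismutConnection g D) (hDc : IsChernConnection g Dc) (x : M)
    (u v : Cn n) : torsAt Dc x u v =
      (1 / 2 : ℝ) • (torsAt D x (mulI n u) (mulI n v) - torsAt D x u v) := by
  obtain ⟨Γ, hΓ : IsChristoffel D x Γ⟩ := exists_christoffel D x
  obtain ⟨Γc, hΓc : IsChristoffel Dc x Γc⟩ := exists_christoffel Dc x
  have hy := mem_extChartAt_target (I := 𝓘(ℝ, Cn n)) x
  refine chern_torsion_eq (g := metricAt g x) (T := torsAt D x) (C := torsAt Dc x)
    (A := Γc (extChartAt 𝓘(ℝ, Cn n) x x) - Γ (extChartAt 𝓘(ℝ, Cn n) x x)) (metricAt_pos g x)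
    mulI_mulI (metricAt_J g x) (isSkew_torsAt hD x) (isIntegrable_torsAt hD x) (fun u v w => ?_)
    (fun u v => ?_) (fun u v => ?_) (fun u v => hDc.torsion x u v) u v
  · have h₁ := hΓ.metric hD.metric hy u v w
    have h₂ := hΓc.metric hDc.metric hy u v w
    rw [chartMetric_self] at h₁ h₂
    rw [sub_apply, sub_apply, sub_apply, inner_sub_left, inner_sub_left,
      metricAt_symm g x _ v, metricAt_symm g x _ v]
    linarith
  · rw [sub_apply, sub_apply, sub_apply, map_sub (mulI n),
      hΓ.complex hD.complex hy, hΓc.complex hDc.complex hy]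
  · rw [← hΓ.tors_self, ← hΓc.tors_self, tors_apply, tors_apply, sub_apply, sub_apply, sub_apply,
      sub_apply]
    abel

end Pointwise

/-! ### Norms in terms of the Gram matrix -/

section Gram

variable {V : Type*} [NormedAddCommGroup V] [NormedSpace ℝ V]
  {ι : Type*} [Fintype ι] [DecidableEq ι] {κ : Type*} [Fintype κ] [DecidableEq κ]
  {g : V →L[ℝ] V →L[ℝ] ℝ} {b : Module.Basis ι ℝ V}

/-- If `Q` expresses `e` in the orthonormal basis, the Gram matrix is `Qᵗ Q`. Its inverse is `P Pᵗ`
with `P = Q⁻¹`. -/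
theorem IsOrthonormal.gram_inv (hb : IsOrthonormal g b) (e : Module.Basis κ ℝ V) :
    (Matrix.of fun a c => g (e a) (e c))⁻¹ = e.toMatrix b * (e.toMatrix b).transpose := by
  have hG : (Matrix.of fun a c => g (e a) (e c)) = (b.toMatrix e).transpose * b.toMatrix e := by
    ext a c
    rw [Matrix.of_apply, hb.apply_eq_sum, Matrix.mul_apply]
    simp only [Matrix.transpose_apply, Module.Basis.toMatrix_apply, hb.repr_apply]
  refine Matrix.inv_eq_right_inv ?_
  rw [hG, Matrix.mul_assoc, ← Matrix.mul_assoc (b.toMatrix e), b.toMatrix_mul_toMatrix_flip e,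
    Matrix.one_mul, ← Matrix.transpose_mul, e.toMatrix_mul_toMatrix_flip b, Matrix.transpose_one]

/-- Contraction with the inverse Gram matrix is the trace over an orthonormal basis; this links the
coordinate definitions of the norms to the preceding identities. -/
theorem IsOrthonormal.sum_gram_inv (hb : IsOrthonormal g b) (e : Module.Basis κ ℝ V) (F : V → V → ℝ)
    (h₁ : ∀ v, IsLinearMap ℝ fun u => F u v) (h₂ : ∀ u, IsLinearMap ℝ (F u)) :
    ∑ a, ∑ c, (Matrix.of fun a c => g (e a) (e c))⁻¹ a c * F (e a) (e c) =
      ∑ i, F (b i) (b i) := by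
  have expand : ∀ i, F (b i) (b i) =
      ∑ a, ∑ c, (e.toMatrix b a i * e.toMatrix b c i) * F (e a) (e c) := by
    intro i
    have l₁ : ∀ v, F (b i) v = ∑ a, e.toMatrix b a i * F (e a) v := fun v => by
      conv_lhs => rw [← e.sum_repr (b i)]
      simpa [Module.Basis.toMatrix_apply] using
        map_sum (h₁ v).mk' (fun a => e.repr (b i) a • e a) Finset.univ
    have l₂ : ∀ u, F u (b i) = ∑ c, e.toMatrix b c i * F u (e c) := fun u => by
      conv_lhs => rw [← e.sum_repr (b i)]
      simpa [Module.Basis.toMatrix_apply] using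
        map_sum (h₂ u).mk' (fun a => e.repr (b i) a • e a) Finset.univ
    rw [l₁]
    refine Finset.sum_congr rfl fun a _ => ?_
    rw [l₂, Finset.mul_sum]
    exact Finset.sum_congr rfl fun c _ => (mul_assoc _ _ _).symm
  simp_rw [expand, hb.gram_inv e, Matrix.mul_apply, Matrix.transpose_apply, Finset.sum_mul]
  rw [Finset.sum_comm]
  rw [Finset.sum_comm]
  conv_rhs => rw [Finset.sum_comm]
  refine Finset.sum_congr rfl fun a _ => ?_
  rw [Finset.sum_comm]

theorem finrank_Cn (n : ℕ) : Module.finrank ℝ (Cn n) = 2 * n := by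
  rw [finrank_real_of_complex, finrank_euclideanSpace, Fintype.card_fin]

theorem exists_basis_orientedBasis (n : ℕ) :
    ∃ e : Module.Basis (Fin (2 * n)) ℝ (Cn n), ⇑e = orientedBasis n := by
  have hspan : ⊤ ≤ Submodule.span ℝ (Set.range (orientedBasis n)) := by
    intro v _
    rw [← (EuclideanSpace.basisFun (Fin n) ℂ).sum_repr v]
    refine Submodule.sum_mem _ fun j _ => ?_
    have e₀ : orientedBasis n ⟨2 * j, by omega⟩ = EuclideanSpace.single j 1 := by
      simp [orientedBasis]
    have e₁ : orientedBasis n ⟨2 * j + 1, by omega⟩ = EuclideanSpace.single j Complex.I := by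
      have : (2 * (j : ℕ) + 1) / 2 = j := by omega
      simp [orientedBasis, this, Nat.add_mod]
    have key : (EuclideanSpace.basisFun (Fin n) ℂ).repr v j • EuclideanSpace.basisFun (Fin n) ℂ j =
        (v j).re • orientedBasis n ⟨2 * j, by omega⟩ +
          (v j).im • orientedBasis n ⟨2 * j + 1, by omega⟩ := by
      rw [e₀, e₁]
      ext i
      by_cases hi : i = j
      · subst hi
        simp [Complex.re_add_im]
      · simp [hi]
    rw [key]
    exact Submodule.add_mem _
      (Submodule.smul_mem _ _ (Submodule.subset_span ⟨_, rfl⟩))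
      (Submodule.smul_mem _ _ (Submodule.subset_span ⟨_, rfl⟩))
  exact ⟨basisOfTopLeSpanOfCardEqFinrank (orientedBasis n) hspan
    (by rw [Fintype.card_fin, finrank_Cn]), coe_basisOfTopLeSpanOfCardEqFinrank _ _ _⟩

end Gram

/-! ### The pointwise identity between |Tᶜ|² and |η|² -/

section Norms

variable {n : ℕ} {M : Type*} [TopologicalSpace M] [ChartedSpace (Cn n) M]
  [IsManifold 𝓘(ℂ, Cn n) ω M] {g : HermitianMetric n M} {D Dc : AffineConnection n M}
  {ι : Type*} [Fintype ι] [DecidableEq ι] {b : Module.Basis ι ℝ (Cn n)} {x : M}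

theorem torsionNormSq_eq_sum (hb : IsOrthonormal (metricAt g x) b) :
    torsionNormSq g Dc x =
      ∑ i, ∑ j, metricAt g x (torsAt Dc x (b i) (b j)) (torsAt Dc x (b i) (b j)) := by
  obtain ⟨e, he⟩ := exists_basis_orientedBasis n
  set T := torsAt Dc x
  have h₁ : torsionNormSq g Dc x = ∑ a, ∑ c, (Matrix.of fun a c => metricAt g x (e a) (e c))⁻¹ a c *
      ∑ a', ∑ c', (Matrix.of fun a c => metricAt g x (e a) (e c))⁻¹ a' c' *
        metricAt g x (T (e a) (e a')) (T (e c) (e c')) := by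
    rw [he]
    change ∑ a, ∑ b, ∑ c, ∑ d, (g.gram x)⁻¹ a c * (g.gram x)⁻¹ b d * metricAt g x
      (T (orientedBasis n a) (orientedBasis n b)) (T (orientedBasis n c) (orientedBasis n d)) =
      ∑ a, ∑ c, (g.gram x)⁻¹ a c * ∑ b, ∑ d, (g.gram x)⁻¹ b d * metricAt g x
      (T (orientedBasis n a) (orientedBasis n b)) (T (orientedBasis n c) (orientedBasis n d))
    refine Finset.sum_congr rfl fun a _ => ?_
    rw [Finset.sum_comm]
    simp_rw [Finset.mul_sum, mul_assoc]
  rw [h₁]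
  have h₂ : ∀ u v : Cn n, ∑ a', ∑ c', (Matrix.of fun a c => metricAt g x (e a) (e c))⁻¹ a' c' *
        metricAt g x (T u (e a')) (T v (e c')) =
      ∑ j, metricAt g x (T u (b j)) (T v (b j)) := fun u v =>
    hb.sum_gram_inv e (fun z w => metricAt g x (T u z) (T v w))
      (fun w => ⟨fun z z' => by rw [map_add (T u), inner_add_left],
        fun r z => by rw [map_smul (T u), inner_smul_left, smul_eq_mul]⟩)
      (fun z => ⟨fun w w' => by rw [map_add (T v), map_add],
        fun r w => by rw [map_smul (T v), map_smul]⟩)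
  simp_rw [h₂]
  refine hb.sum_gram_inv e (fun z w => ∑ j, metricAt g x (T z (b j)) (T w (b j)))
      (fun w => ⟨fun z z' => ?_, fun r z => ?_⟩) (fun z => ⟨fun w w' => ?_, fun r w => ?_⟩)
  · rw [← Finset.sum_add_distrib]
    refine Finset.sum_congr rfl fun j _ => ?_
    rw [map_add T, add_apply, inner_add_left]
  · rw [Finset.smul_sum]
    refine Finset.sum_congr rfl fun j _ => ?_
    rw [map_smul T, smul_apply, inner_smul_left, smul_eq_mul]
  · rw [← Finset.sum_add_distrib]
    refine Finset.sum_congr rfl fun j _ => ?_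
    rw [map_add T, add_apply, map_add]
  · rw [Finset.smul_sum]
    refine Finset.sum_congr rfl fun j _ => ?_
    rw [map_smul T, smul_apply, map_smul]

theorem torsionNormSq_eq [T2Space M] (hb : IsOrthonormal (metricAt g x) b)
    (hD : IsBismutConnection g D) (hflat : IsFlatConnection D) (hDc : IsChernConnection g Dc) :
    torsionNormSq g Dc x = 2 * metricAt g x (traceVec b (mulI n) (torsAt D x))
      (traceVec b (mulI n) (torsAt D x)) := by
  rw [torsionNormSq_eq_sum hb, inner_traceVec_self hb (metricAt_symm g x) mulI_mulI (metricAt_J g x)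
    (isSkew_torsAt hD x) (cyc_torsAt hD hflat x)]
  have h := sum_inner_chern_torsion hb (metricAt_symm g x) mulI_mulI (metricAt_J g x)
    (isSkew_torsAt hD x) (isIntegrable_torsAt hD x)
  simp_rw [chern_torsAt hD hDc, inner_smul_left, map_smul, smul_eq_mul, ← Finset.mul_sum, h]
  ring

theorem torsionTrace_eq (hb : IsOrthonormal (metricAt g x) b)
    (hD : IsBismutConnection g D) (hDc : IsChernConnection g Dc) (v : Cn n) :
    torsionTrace Dc x v = metricAt g x (traceVec b (mulI n) (torsAt D x)) (mulI n v) := by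
  rw [← sum_inner_chern_torsion_trace (isSkew_torsAt hD x)]
  simp_rw [← chern_torsAt hD hDc]
  refine (hb.trace_linearMap (((torsAt Dc x).flip v : Cn n →L[ℝ] Cn n) : Cn n →ₗ[ℝ] Cn n))

/-- With `f = g(ξ, ·)` one has `η(v) = (f(Jv) + i f(v))/4`. Both real parts have norm |ξ|, so |η|² =
2|ξ|²/16. -/
theorem gauduchonNormSq_eq (hb : IsOrthonormal (metricAt g x) b)
    (hD : IsBismutConnection g D) (hDc : IsChernConnection g Dc) :
    gauduchonNormSq g Dc x = 1 / 8 * metricAt g x (traceVec b (mulI n) (torsAt D x))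
      (traceVec b (mulI n) (torsAt D x)) := by
  obtain ⟨e, he⟩ := exists_basis_orientedBasis n
  set ξ := traceVec b (mulI n) (torsAt D x)
  set f : Cn n →L[ℝ] ℝ := metricAt g x ξ
  have hη : ∀ u v : Cn n, (gauduchonForm Dc x u * (starRingEnd ℂ) (gauduchonForm Dc x v)).re =
      1 / 16 * (f (mulI n u) * f (mulI n v) + f u * f v) := by
    intro u v
    have h₁ : ∀ v : Cn n, torsionTrace Dc x v = f (mulI n v) := torsionTrace_eq hb hD hDc
    have h₂ : ∀ v : Cn n, torsionTrace Dc x (complexStructure n x v) = -f v := fun v => by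
      refine (h₁ (mulI n v)).trans ?_
      rw [mulI_mulI, map_neg]
    have h₃ : ∀ v : Cn n, gauduchonForm Dc x v =
        ((1 / 4 * f (mulI n v) : ℝ) : ℂ) + ((1 / 4 * f v : ℝ) : ℂ) * Complex.I := fun v => by
      change (1 / 4 : ℂ) * ((torsionTrace Dc x v : ℂ) -
        Complex.I * (torsionTrace Dc x (complexStructure n x v) : ℂ)) = _
      rw [h₁, h₂]
      push_cast
      ring
    have h₅ : ∀ r s : ℝ, ((r : ℂ) + (s : ℂ) * Complex.I).re = r ∧
        ((r : ℂ) + (s : ℂ) * Complex.I).im = s := fun r s => by simp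
    rw [h₃, h₃, Complex.mul_re, Complex.conj_re, Complex.conj_im, (h₅ _ _).1, (h₅ _ _).1,
      (h₅ _ _).2, (h₅ _ _).2]
    ring
  have h₁ : gauduchonNormSq g Dc x = ∑ a, ∑ c,
      (Matrix.of fun a c => metricAt g x (e a) (e c))⁻¹ a c *
        (1 / 16 * (f (mulI n (e a)) * f (mulI n (e c)) + f (e a) * f (e c))) := by
    rw [he]
    simp_rw [← hη]
    rfl
  rw [h₁, hb.sum_gram_inv e (fun u v => 1 / 16 * (f (mulI n u) * f (mulI n v) + f u * f v))
    (fun v => ⟨fun u u' => by simp only [map_add]; ring,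
      fun r u => by simp only [map_smul, smul_eq_mul]; ring⟩)
    (fun v => ⟨fun u u' => by simp only [map_add]; ring,
      fun r u => by simp only [map_smul, smul_eq_mul]; ring⟩)]
  rw [← Finset.mul_sum, Finset.sum_add_distrib]
  have e₁ : ∑ i, f (b i) * f (b i) = metricAt g x ξ ξ := (hb.apply_eq_sum ξ ξ).symm
  have e₂ : ∑ i, f (mulI n (b i)) * f (mulI n (b i)) = metricAt g x ξ ξ := by
    rw [← metricAt_J g x ξ ξ, hb.apply_eq_sum (mulI n ξ)]
    refine Finset.sum_congr rfl fun i _ => ?_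
    rw [inner_J_left mulI_mulI (metricAt_J g x), neg_mul_neg]
  rw [e₁, e₂]
  ring

/-- The pointwise identity `|Tᶜ|² = 16 |η|²`. -/
theorem torsionNormSq_eq_gauduchonNormSq [T2Space M] (hD : IsBismutConnection g D)
    (hflat : IsFlatConnection D) (hDc : IsChernConnection g Dc) (x : M) :
    torsionNormSq g Dc x = 16 * gauduchonNormSq g Dc x := by
  obtain ⟨b, hb⟩ := exists_isOrthonormal (metricAt_symm g x) (metricAt_pos g x)
  rw [torsionNormSq_eq hb hD hflat hDc, gauduchonNormSq_eq hb hD hDc]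
  ring

end Norms

end BismutFlat

namespace BismutFlat

/-! ### Differential forms on the manifold -/

section Postcomp

variable {E : Type*} [NormedAddCommGroup E] [NormedSpace ℝ E]

/-- Composition of a real form with a real linear map `ℝ → ℂ`. -/
def postcomp (L : ℝ →L[ℝ] ℂ) (k : ℕ) : (E [⋀^Fin k]→L[ℝ] ℝ) →L[ℝ] E [⋀^Fin k]→L[ℝ] ℂ :=
  ContinuousLinearMap.compContinuousAlternatingMapCLM ℝ E ℝ ℂ (Fin k) L

theorem postcomp_apply (L : ℝ →L[ℝ] ℂ) {k : ℕ} (α : E [⋀^Fin k]→L[ℝ] ℝ) (v : Fin k → E) :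
    postcomp L k α v = L (α v) := rfl

theorem extDeriv_postcomp (L : ℝ →L[ℝ] ℂ) {k : ℕ} {α : E → E [⋀^Fin k]→L[ℝ] ℝ} {y : E}
    (hα : DifferentiableAt ℝ α y) :
    extDeriv (fun z => postcomp L k (α z)) y = postcomp L (k + 1) (extDeriv α y) := by
  have h := ((postcomp L k).hasFDerivAt.comp y hα.hasFDerivAt).fderiv
  ext v
  rw [postcomp_apply, extDeriv, extDeriv, ContinuousAlternatingMap.alternatizeUncurryFin_apply,
    ContinuousAlternatingMap.alternatizeUncurryFin_apply, map_sum]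
  refine Finset.sum_congr rfl fun i _ => ?_
  refine (congrArg (fun f : E →L[ℝ] E [⋀^Fin k]→L[ℝ] ℂ => (-1) ^ (i : ℕ) • f (v i) (i.removeNth v))
    h).trans ?_
  change (-1) ^ (i : ℕ) • L (fderiv ℝ α y (v i) (i.removeNth v)) = _
  rcases neg_one_pow_eq_or ℤ (i : ℕ) with h | h <;> rw [h] <;> simp

theorem wedgePow_comp (B : E →L[ℝ] E →L[ℝ] ℝ) (k : ℕ) (A : E →L[ℝ] E) :
    (wedgePow B k).compContinuousLinearMap A = wedgePow (B.bilinearComp A A) k := by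
  ext v
  rw [ContinuousAlternatingMap.compContinuousLinearMap_apply, wedgePow_apply, wedgePow_apply]
  rfl

theorem wedgeL_comp {k : ℕ} (a : E →L[ℝ] ℝ) (α : E [⋀^Fin k]→L[ℝ] ℝ) (A : E →L[ℝ] E) :
    (wedgeL k a α).compContinuousLinearMap A =
      wedgeL k (a ∘L A) (α.compContinuousLinearMap A) := by
  ext v
  rw [ContinuousAlternatingMap.compContinuousLinearMap_apply, wedgeL_apply, wedgeL_apply]
  rfl

end Postcomp

/-! ### Transfer of the chart computations to forms on M -/

section FormsOnM

variable {n : ℕ} {M : Type*} [TopologicalSpace M] [ChartedSpace (Cn n) M]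
  [IsManifold 𝓘(ℂ, Cn n) ω M] {F : Type*} [NormedAddCommGroup F] [NormedSpace ℝ F]

theorem dchart_self (x : M) : dchart x x = ContinuousLinearMap.id ℝ (Cn n) := by
  have h := mfderiv_comp_dsymm (mem_extChartAt_target (I := 𝓘(ℝ, Cn n)) x)
  rw [dsymm_self, symm_extChartAt_self] at h
  exact h

/-- A form at a point, as a form on `ℂⁿ`. -/
def formAt {k : ℕ} (α : MForm n M F k) (x : M) : Cn n [⋀^Fin k]→L[ℝ] F := α x

theorem formAt_extDeriv {k : ℕ} (α : MForm n M F k) (x : M) :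
    formAt α.extDeriv x = extDeriv (α.inChart x) (extChartAt 𝓘(ℝ, Cn n) x x) := by
  change (extDeriv (α.inChart x) (extChartAt 𝓘(ℝ, Cn n) x x)).compContinuousLinearMap
    (dchart x x) = _
  rw [dchart_self]
  rfl

theorem formAt_extDeriv_of_eqOn {k : ℕ} {α : MForm n M F k} {x : M}
    {α' : Cn n → Cn n [⋀^Fin k]→L[ℝ] F}
    (h : ∀ y ∈ (extChartAt 𝓘(ℝ, Cn n) x).target, α.inChart x y = α' y) :
    formAt α.extDeriv x = extDeriv α' (extChartAt 𝓘(ℝ, Cn n) x x) := by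
  rw [formAt_extDeriv]
  refine Filter.EventuallyEq.extDeriv_eq ?_
  filter_upwards [(isOpen_extChartAt_target x).mem_nhds (mem_extChartAt_target x)] with y hy
  exact h y hy

variable (g : HermitianMetric n M) (D : AffineConnection n M)

/-- The form `ρ ∧ ω^k`, for the trace `ρ` of the torsion of `D`. -/
def rhoWedge (k : ℕ) : MForm n M ℝ (2 * k + 1) := fun x =>
  wedgeL (E := Cn n) (2 * k) (rhoForm (mulI n) (torsAt D x)) (wedgePow (metricAt g x ∘L mulI n) k)

/-- The form `(-ρ ∘ J) ∧ ω^k`, for the trace `ρ` of the torsion of `D`. -/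
def lambdaWedge (k : ℕ) : MForm n M ℝ (2 * k + 1) := fun x =>
  wedgeL (E := Cn n) (2 * k) (lambdaForm (mulI n) (torsAt D x))
    (wedgePow (metricAt g x ∘L mulI n) k)

variable {g D} {x₀ : M} {Γ : Cn n → Cn n →L[ℝ] Cn n →L[ℝ] Cn n} {y : Cn n}

theorem inChart_kahlerPow (hy : y ∈ (extChartAt 𝓘(ℝ, Cn n) x₀).target) (k : ℕ) :
    (g.kahlerPow k).inChart x₀ y = wedgePow (chartMetric g x₀ y ∘L mulI n) k := by
  refine (wedgePow_comp (metricAt g ((extChartAt 𝓘(ℝ, Cn n) x₀).symm y) ∘L mulI n) k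
    (dsymm x₀ y)).trans ?_
  congr 1
  ext v w
  change metricAt g _ (mulI n (dsymm x₀ y v)) _ = chartMetric g x₀ y (mulI n v) w
  rw [chartMetric_apply, dsymm_mulI hy]
  rfl

/-- The endomorphisms on the two sides are conjugate by the derivative of the chart, which is
complex linear, and the trace is invariant under conjugation. -/
theorem IsChristoffel.rhoForm_comp (h : IsChristoffel D x₀ Γ)
    (hy : y ∈ (extChartAt 𝓘(ℝ, Cn n) x₀).target) :
    rhoForm (mulI n) (torsAt D ((extChartAt 𝓘(ℝ, Cn n) x₀).symm y)) ∘L dsymm x₀ y =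
      rhoForm (mulI n) (tors (Γ y)) := by
  ext v
  set x := (extChartAt 𝓘(ℝ, Cn n) x₀).symm y
  change rhoForm (mulI n) (torsAt D x) (dsymm x₀ y v) = _
  have e : (mulI n ∘L torsAt D x (dsymm x₀ y v)) =
      dsymm x₀ y ∘L ((mulI n ∘L tors (Γ y) v) ∘L dchart x₀ x) := by
    ext1 w
    have hw : dsymm x₀ y (dchart x₀ x w) = w := DFunLike.congr_fun (dsymm_comp_mfderiv hy) w
    change mulI n (torsAt D x (dsymm x₀ y v) w) = dsymm x₀ y (mulI n (tors (Γ y) v (dchart x₀ x w)))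
    rw [dsymm_mulI hy, ← h.torsAt_eq hy, hw]
  rw [rhoForm_apply, rhoForm_apply, e, traceL_comp_comm, ContinuousLinearMap.comp_assoc,
    mfderiv_comp_dsymm hy, ContinuousLinearMap.comp_id]

theorem IsChristoffel.lambdaForm_comp (h : IsChristoffel D x₀ Γ)
    (hy : y ∈ (extChartAt 𝓘(ℝ, Cn n) x₀).target) :
    lambdaForm (mulI n) (torsAt D ((extChartAt 𝓘(ℝ, Cn n) x₀).symm y)) ∘L dsymm x₀ y =
      lambdaForm (mulI n) (tors (Γ y)) := by
  refine ContinuousLinearMap.ext fun v => ?_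
  have key : ∀ w, rhoForm (mulI n) (torsAt D ((extChartAt 𝓘(ℝ, Cn n) x₀).symm y)) (dsymm x₀ y w) =
      rhoForm (mulI n) (tors (Γ y)) w := fun w => DFunLike.congr_fun (h.rhoForm_comp hy) w
  rw [ContinuousLinearMap.comp_apply, lambdaForm_apply, lambdaForm_apply, ← dsymm_mulI hy, key]

theorem IsChristoffel.inChart_rhoWedge (h : IsChristoffel D x₀ Γ)
    (hy : y ∈ (extChartAt 𝓘(ℝ, Cn n) x₀).target) (k : ℕ) :
    (rhoWedge g D k).inChart x₀ y = wedgeL (2 * k) (rhoForm (mulI n) (tors (Γ y)))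
      (wedgePow (chartMetric g x₀ y ∘L mulI n) k) := by
  rw [← h.rhoForm_comp hy, ← inChart_kahlerPow hy]
  exact wedgeL_comp _ _ (dsymm x₀ y)

theorem IsChristoffel.inChart_lambdaWedge (h : IsChristoffel D x₀ Γ)
    (hy : y ∈ (extChartAt 𝓘(ℝ, Cn n) x₀).target) (k : ℕ) :
    (lambdaWedge g D k).inChart x₀ y = wedgeL (2 * k) (lambdaForm (mulI n) (tors (Γ y)))
      (wedgePow (chartMetric g x₀ y ∘L mulI n) k) := by
  rw [← h.lambdaForm_comp hy, ← inChart_kahlerPow hy]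
  exact wedgeL_comp _ _ (dsymm x₀ y)

/-- A balanced Bismut flat metric is Kähler. -/
theorem isKahler_of_isBalanced [T2Space M] (hn : 1 ≤ n) (hD : IsBismutConnection g D)
    (hflat : IsFlatConnection D) (hbal : g.IsBalanced) : g.IsKahler := by
  refine funext fun x => ?_
  obtain ⟨Γ, hΓ : IsChristoffel D x Γ⟩ := exists_christoffel D x
  have h := hΓ.isBismutChart hD
  have hy := mem_extChartAt_target (I := 𝓘(ℝ, Cn n)) x
  have h0 : formAt (g.kahlerPow (n - 1)).extDeriv x = 0 := congrFun hbal x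
  rw [formAt_extDeriv_of_eqOn fun y hy => inChart_kahlerPow hy (n - 1)] at h0
  have hT := h.tors_eq_zero (hΓ.isFlatChart h.contDiffOn hflat) hy
    (by rw [finrank_Cn, Nat.sub_add_cancel hn]) h0
  exact (formAt_extDeriv_of_eqOn fun y hy => inChart_kahlerPow hy 1).trans
    (h.extDeriv_kahlerPow_eq_zero hy hT 1)

theorem formAt_extDeriv_kahlerPow (hn : 1 ≤ n) (hD : IsBismutConnection g D) (x : M) :
    formAt (g.kahlerPow (n - 1)).toComplex.extDeriv x =
      postcomp Complex.ofRealCLM _ (formAt (lambdaWedge g D (n - 1)) x) := by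
  obtain ⟨Γ, hΓ : IsChristoffel D x Γ⟩ := exists_christoffel D x
  have h := hΓ.isBismutChart hD
  have hy := mem_extChartAt_target (I := 𝓘(ℝ, Cn n)) x
  have e : ∀ y ∈ (extChartAt 𝓘(ℝ, Cn n) x).target,
      (g.kahlerPow (n - 1)).toComplex.inChart x y = postcomp Complex.ofRealCLM _
        (wedgePow (chartMetric g x y ∘L mulI n) (n - 1)) := fun y hy => by
    rw [← inChart_kahlerPow hy]
    rfl
  rw [formAt_extDeriv_of_eqOn e, extDeriv_postcomp _ (h.differentiableAt_kahlerPow hy _),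
    h.extDeriv_kahlerPow hy (by rw [finrank_Cn, Nat.sub_add_cancel hn]), hΓ.tors_self,
    chartMetric_self]
  rfl

variable (g D) in
/-- The form `L λ ∧ ω^k + L' ρ ∧ ω^k` with `λ = -ρ ∘ J`. -/
def complexWedge (L L' : ℝ →L[ℝ] ℂ) (k : ℕ) : MForm n M ℂ (2 * k + 1) := fun x =>
  postcomp (E := Cn n) L (2 * k + 1) (lambdaWedge g D k x) +
    postcomp (E := Cn n) L' (2 * k + 1) (rhoWedge g D k x)

/-- Both real constituents are parallel of degree `2n - 1`, hence closed; any complex combination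
serves. -/
theorem formAt_extDeriv_complexWedge [T2Space M] (hn : 1 ≤ n) (hD : IsBismutConnection g D)
    (hflat : IsFlatConnection D) (L L' : ℝ →L[ℝ] ℂ) (x : M) :
    formAt (complexWedge g D L L' (n - 1)).extDeriv x = 0 := by
  obtain ⟨Γ, hΓ : IsChristoffel D x Γ⟩ := exists_christoffel D x
  have h := hΓ.isBismutChart hD
  have hy := mem_extChartAt_target (I := 𝓘(ℝ, Cn n)) x
  have hfl := hΓ.isFlatChart h.contDiffOn hflat
  have hfin : Module.finrank ℝ (Cn n) = 2 * (n - 1 + 1) := by rw [finrank_Cn, Nat.sub_add_cancel hn]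
  have e : ∀ y ∈ (extChartAt 𝓘(ℝ, Cn n) x).target,
      (complexWedge g D L L' (n - 1)).inChart x y =
        postcomp L _ (wedgeL (2 * (n - 1)) (lambdaForm (mulI n) (tors (Γ y)))
          (wedgePow (chartMetric g x y ∘L mulI n) (n - 1))) +
        postcomp L' _ (wedgeL (2 * (n - 1)) (rhoForm (mulI n) (tors (Γ y)))
          (wedgePow (chartMetric g x y ∘L mulI n) (n - 1))) := fun y hy => by
    rw [← hΓ.inChart_lambdaWedge hy, ← hΓ.inChart_rhoWedge hy]
    rfl
  have d₁ := h.differentiableAt_lambda_wedge hy (n - 1)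
  have d₂ := h.differentiableAt_rho_wedge hy (n - 1)
  have d₃ := ((postcomp L _).hasFDerivAt.comp _ d₁.hasFDerivAt).differentiableAt
  have d₄ := ((postcomp L' _).hasFDerivAt.comp _ d₂.hasFDerivAt).differentiableAt
  rw [formAt_extDeriv_of_eqOn e]
  refine (extDeriv_fun_add d₃ d₄).trans ?_
  simp only [Function.comp_def]
  rw [extDeriv_postcomp _ d₁, extDeriv_postcomp _ d₂, h.extDeriv_lambda_wedge hfl hy hfin,
    h.extDeriv_rho_wedge hfl hy hfin, map_zero, map_zero, add_zero]

end FormsOnM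

end BismutFlat

namespace BismutFlat

/-! ### Types of forms -/

section Types

variable {n : ℕ} {M : Type*} [TopologicalSpace M] [ChartedSpace (Cn n) M]
  [IsManifold 𝓘(ℂ, Cn n) ω M] {g : HermitianMetric n M} {D : AffineConnection n M}

variable (n) in
/-- Multiplication by `e^{it}` on `ℂⁿ`. -/
def rotation (t : ℝ) : Cn n →L[ℝ] Cn n :=
  Real.cos t • ContinuousLinearMap.id ℝ (Cn n) + Real.sin t • mulI n

theorem rotation_apply (t : ℝ) (v : Cn n) :
    rotation n t v = Real.cos t • v + Real.sin t • mulI n v := rfl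

theorem hasType_iff {k p q : ℕ} (α : MForm n M ℂ k) : α.HasType p q ↔
    p + q = k ∧ ∀ (x : M) (t : ℝ) (v : Fin k → Cn n),
      (formAt α x).compContinuousLinearMap (rotation n t) v =
        Complex.exp (Complex.I * ((p : ℂ) - (q : ℂ)) * (t : ℂ)) * formAt α x v := Iff.rfl

theorem wedgePow_comp_rotation (x : M) (k : ℕ) (t : ℝ) :
    (wedgePow (metricAt g x ∘L mulI n) k).compContinuousLinearMap (rotation n t) =
      wedgePow (metricAt g x ∘L mulI n) k := by
  rw [wedgePow_comp]
  congr 1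
  refine ContinuousLinearMap.ext fun v => ContinuousLinearMap.ext fun w => ?_
  change metricAt g x (mulI n (rotation n t v)) (rotation n t w) = metricAt g x (mulI n v) w
  have h := inner_J_left mulI_mulI (metricAt_J g x) (mulI n v) w
  rw [mulI_mulI, inner_neg_left, neg_inj] at h
  have e : mulI n (rotation n t v) = Real.cos t • mulI n v + Real.sin t • -v := by
    rw [rotation_apply, map_add, map_smul, map_smul, mulI_mulI]
  rw [e, inner_add_left, inner_smul_left, inner_smul_left, inner_neg_left,
    rotation_apply, map_add, map_add, map_smul, map_smul, map_smul, map_smul, ← h]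
  have h' : metricAt g x v (mulI n w) = -metricAt g x (mulI n v) w := by
    rw [inner_J_left mulI_mulI (metricAt_J g x), neg_neg]
  rw [h']
  simp only [smul_eq_mul]
  linear_combination (metricAt g x (mulI n v) w) * Real.cos_sq_add_sin_sq t

theorem hasType_kahlerPow (k : ℕ) : (g.kahlerPow k).toComplex.HasType k k := by
  refine (hasType_iff _).mpr ⟨(two_mul k).symm, fun x t v => ?_⟩
  have h := DFunLike.congr_fun (wedgePow_comp_rotation (g := g) x k t) v
  rw [sub_self, mul_zero, zero_mul, Complex.exp_zero, one_mul]
  exact congrArg Complex.ofReal h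

theorem rhoForm_rotation (T : Cn n →L[ℝ] Cn n →L[ℝ] Cn n) (t : ℝ) :
    rhoForm (mulI n) T ∘L rotation n t =
      Real.cos t • rhoForm (mulI n) T - Real.sin t • lambdaForm (mulI n) T := by
  refine ContinuousLinearMap.ext fun v => ?_
  rw [ContinuousLinearMap.comp_apply, rotation_apply, map_add, map_smul, map_smul, sub_apply,
    smul_apply, smul_apply, lambdaForm_apply, smul_neg, sub_neg_eq_add]

theorem lambdaForm_rotation (T : Cn n →L[ℝ] Cn n →L[ℝ] Cn n) (t : ℝ) :
    lambdaForm (mulI n) T ∘L rotation n t =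
      Real.cos t • lambdaForm (mulI n) T + Real.sin t • rhoForm (mulI n) T := by
  refine ContinuousLinearMap.ext fun v => ?_
  rw [ContinuousLinearMap.comp_apply, rotation_apply, map_add, map_smul, map_smul, add_apply,
    smul_apply, smul_apply, lambdaForm_apply (v := mulI n v), mulI_mulI, map_neg, neg_neg]

theorem rhoWedge_rotation (x : M) (k : ℕ) (t : ℝ) :
    (formAt (rhoWedge g D k) x).compContinuousLinearMap (rotation n t) =
      Real.cos t • formAt (rhoWedge g D k) x - Real.sin t • formAt (lambdaWedge g D k) x := by
  refine (wedgeL_comp _ _ _).trans ?_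
  rw [wedgePow_comp_rotation, rhoForm_rotation, map_sub, map_smul, map_smul, sub_apply, smul_apply,
    smul_apply]
  rfl

theorem lambdaWedge_rotation (x : M) (k : ℕ) (t : ℝ) :
    (formAt (lambdaWedge g D k) x).compContinuousLinearMap (rotation n t) =
      Real.cos t • formAt (lambdaWedge g D k) x + Real.sin t • formAt (rhoWedge g D k) x := by
  refine (wedgeL_comp _ _ _).trans ?_
  rw [wedgePow_comp_rotation, lambdaForm_rotation, map_add, map_smul, map_smul, add_apply,
    smul_apply, smul_apply]
  rfl

/-- The real linear map `r ↦ z r`. -/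
def scaleL (z : ℂ) : ℝ →L[ℝ] ℂ := z • Complex.ofRealCLM

theorem complexWedge_apply (z z' : ℂ) (k : ℕ) (x : M) (v : Fin (2 * k + 1) → Cn n) :
    formAt (complexWedge g D (scaleL z) (scaleL z') k) x v =
      z * formAt (lambdaWedge g D k) x v + z' * formAt (rhoWedge g D k) x v := rfl

/-- Rotation mixes λ and ρ through the angle `t`, so `λ + i s ρ` with `s = ±1` is an eigenvector,
with eigenvalue `cos t - i s sin t`. The two signs give the two types occurring in dω^{n-1}. -/
theorem complexWedge_rotation {s : ℝ} (hs : s * s = 1) (x : M) (k : ℕ) (t : ℝ)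
    (v : Fin (2 * k + 1) → Cn n) :
    (formAt (complexWedge g D (scaleL (1 / 2)) (scaleL (s * (Complex.I / 2))) k)
      x).compContinuousLinearMap (rotation n t) v = (Real.cos t - s * Complex.I * Real.sin t) *
      formAt (complexWedge g D (scaleL (1 / 2)) (scaleL (s * (Complex.I / 2))) k) x v := by
  have h₁ := DFunLike.congr_fun (lambdaWedge_rotation (g := g) (D := D) x k t) v
  have h₂ := DFunLike.congr_fun (rhoWedge_rotation (g := g) (D := D) x k t) v
  rw [ContinuousAlternatingMap.compContinuousLinearMap_apply] at h₁ h₂ ⊢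
  rw [complexWedge_apply, complexWedge_apply, h₁, h₂]
  simp only [ContinuousAlternatingMap.add_apply, ContinuousAlternatingMap.sub_apply,
    ContinuousAlternatingMap.smul_apply, smul_eq_mul]
  push_cast
  have hs' : (s : ℂ) * s = 1 := by exact_mod_cast hs
  linear_combination (1 / 2 * Complex.sin t * (formAt (rhoWedge g D k) x v : ℂ)) *
    (s * s * Complex.I_mul_I - hs')

theorem hasType_complexWedge {k p q : ℕ} {s : ℝ} (hs : s * s = 1) (hk : p + q = 2 * k + 1)
    (hpq : (p : ℝ) - q = -s) :
    (complexWedge g D (scaleL (1 / 2)) (scaleL (s * (Complex.I / 2))) k :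
      MForm n M ℂ (2 * k + 1)).HasType p q := by
  refine (hasType_iff _).mpr ⟨hk, fun x t v => ?_⟩
  rw [complexWedge_rotation hs]
  congr 1
  have hpq' : (p : ℂ) - q = -s := by exact_mod_cast hpq
  rw [hpq']
  rcases mul_self_eq_one_iff.mp hs with rfl | rfl
  · rw [show Complex.I * -((1 : ℝ) : ℂ) * (t : ℂ) = (-t : ℂ) * Complex.I by push_cast; ring,
      Complex.exp_mul_I, Complex.cos_neg, Complex.sin_neg]
    push_cast
    ring
  · rw [show Complex.I * -((-1 : ℝ) : ℂ) * (t : ℂ) = (t : ℂ) * Complex.I by push_cast; ring,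
      Complex.exp_mul_I]
    push_cast
    ring

theorem hasType_zero {k p q : ℕ} (h : p + q = k) {α : MForm n M ℂ k} (hα : ∀ x, formAt α x = 0) :
    α.HasType p q := by
  refine (hasType_iff α).mpr ⟨h, fun x t v => ?_⟩
  rw [hα]
  exact (mul_zero _).symm

end Types

/-! ### The Dolbeault operators on ω^{n-1} and linearity of the integral -/

section Main

variable {n : ℕ} {M : Type*} [TopologicalSpace M] [T2Space M] [ChartedSpace (Cn n) M]
  [IsManifold 𝓘(ℂ, Cn n) ω M] {g : HermitianMetric n M} {D : AffineConnection n M}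

/-- The form `∂̄ω^{n-1}` of a Bismut flat metric. -/
theorem isDelbar_kahlerPow (hn : 1 ≤ n) (hD : IsBismutConnection g D) :
    (g.kahlerPow (n - 1)).toComplex.IsDelbar (n - 1) (n - 1)
      (complexWedge g D (scaleL (1 / 2)) (scaleL ((1 : ℝ) * (Complex.I / 2))) (n - 1)) := by
  refine ⟨hasType_kahlerPow _, hasType_complexWedge (one_mul 1) (by omega) (by push_cast; ring), ?_⟩
  -- The real form `λ ∧ ω^{n-1}` is the sum of the combinations with `s = 1` and `s = -1`, so the
  -- remainder is the one with `s = -1`, of type `(n, n-1)`.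
  have e : (fun x => (g.kahlerPow (n - 1)).toComplex.extDeriv x -
      complexWedge g D (scaleL (1 / 2)) (scaleL ((1 : ℝ) * (Complex.I / 2))) (n - 1) x :
      MForm n M ℂ (2 * (n - 1) + 1)) =
      complexWedge g D (scaleL (1 / 2)) (scaleL ((-1 : ℝ) * (Complex.I / 2))) (n - 1) := by
    refine funext fun x => ?_
    refine (congrArg (fun α => α - formAt (complexWedge g D (scaleL (1 / 2))
      (scaleL ((1 : ℝ) * (Complex.I / 2))) (n - 1)) x) (formAt_extDeriv_kahlerPow hn hD x)).trans ?_
    refine ContinuousAlternatingMap.ext fun v => ?_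
    change (formAt (lambdaWedge g D (n - 1)) x v : ℂ) - formAt (complexWedge g D (scaleL (1 / 2))
      (scaleL ((1 : ℝ) * (Complex.I / 2))) (n - 1)) x v = formAt (complexWedge g D (scaleL (1 / 2))
      (scaleL ((-1 : ℝ) * (Complex.I / 2))) (n - 1)) x v
    rw [complexWedge_apply, complexWedge_apply]
    push_cast
    ring
  rw [e]
  exact hasType_complexWedge (by norm_num) (by omega) (by push_cast; ring)

/-- The `(n-1,n)`-form `∂̄ω^{n-1}` of a Bismut flat metric is `∂`-closed. -/
theorem isDel_complexWedge (hn : 1 ≤ n) (hD : IsBismutConnection g D)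
    (hflat : IsFlatConnection D) :
    (complexWedge g D (scaleL (1 / 2)) (scaleL ((1 : ℝ) * (Complex.I / 2)))
      (n - 1)).IsDel (n - 1) (n - 1 + 1) 0 := by
  refine ⟨hasType_complexWedge (one_mul 1) (by omega) (by push_cast; ring),
    hasType_zero (by omega) fun x => rfl, hasType_zero (by omega) fun x => ?_⟩
  refine (sub_zero (formAt (complexWedge g D (scaleL (1 / 2))
    (scaleL ((1 : ℝ) * (Complex.I / 2))) (n - 1)).extDeriv x)).trans ?_
  exact formAt_extDeriv_complexWedge hn hD hflat _ _ x

theorem integral_smul [SigmaCompactSpace M] (r : ℝ) (α : MForm n M ℝ (2 * n)) :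
    MForm.integral (fun x => r • α x) = r * MForm.integral α := by
  refine Eq.trans ?_ (smul_finsum r _).symm
  refine finsum_congr fun c => ?_
  rw [smul_eq_mul, ← MeasureTheory.integral_const_mul]
  refine congrArg _ (funext fun y => ?_)
  exact mul_left_comm _ r _

end Main

end BismutFlat

end

theorem theorem2 (n : ℕ) (hn : 1 ≤ n)
    {M : Type*} [TopologicalSpace M] [T2Space M] [SigmaCompactSpace M]
    [ChartedSpace (Cn n) M] [IsManifold 𝓘(ℂ, Cn n) ω M]
    (g : HermitianMetric n M) (hflat : IsBismutFlat g) :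
    (g.IsBalanced → g.IsKahler) ∧
    ∀ Dc : AffineConnection n M, IsChernConnection g Dc →
      (CompactSpace M →
        MForm.integral (fun x => torsionNormSq g Dc x • g.kahlerPow n x) =
          16 * MForm.integral (fun x => gauduchonNormSq g Dc x • g.kahlerPow n x)) ∧
      ∃ (β : MForm n M ℂ (2 * (n - 1) + 1)) (γ : MForm n M ℂ (2 * (n - 1) + 1 + 1)),
        (g.kahlerPow (n - 1)).toComplex.IsDelbar (n - 1) (n - 1) β ∧
        β.IsDel (n - 1) (n - 1 + 1) γ ∧
        ∀ (x : M) (v : Fin (2 * n) → TM n x),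
          -Complex.I * γ x (fun i => v (Fin.cast (by omega) i)) =
            ((4 / (3 * n) * (torsionNormSq g Dc x / 8 - 2 * gauduchonNormSq g Dc x) *
              g.kahlerPow n x v : ℝ) : ℂ) := by
  obtain ⟨D, hD, hflatD⟩ := hflat
  -- `β` is the form `1/2 (λ + iρ) ∧ ω^{n-1}` and `γ = 0`: both sides of the third claim vanish.
  refine ⟨BismutFlat.isKahler_of_isBalanced hn hD hflatD, fun Dc hDc => ⟨fun _ => ?_, _, 0,
    BismutFlat.isDelbar_kahlerPow hn hD, BismutFlat.isDel_complexWedge hn hD hflatD, fun x v => ?_⟩⟩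
  · rw [← BismutFlat.integral_smul]
    refine congrArg _ (funext fun x => ?_)
    rw [BismutFlat.torsionNormSq_eq_gauduchonNormSq hD hflatD hDc, mul_smul]
  · rw [BismutFlat.torsionNormSq_eq_gauduchonNormSq hD hflatD hDc,
      show 16 * gauduchonNormSq g Dc x / 8 - 2 * gauduchonNormSq g Dc x = 0 by ring, mul_zero,
      zero_mul, Complex.ofReal_zero]
    exact mul_zero _
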